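/- Let $A$ be a germ at $0\in\mathbb{C}^n$ of a holomorphic map $\mathbb{C}^n\to\mathbb{C}^n$ of generic rank $n$ (that is, $\det A'$ does not vanish identically near $0$), let $X$ be a complex manifold, and let $b=b(z,\omega)$ be a $\mathbb{C}^n$-valued holomorphic map defined on an open neighbourhood of $\{0\}\times X$ in $\mathbb{C}^n\times X$. Then there exist an open neighbourhood $\Omega$ of $\{0\}\times \mathrm{GL}_n(\mathbb{C})\times X$ in $\mathbb{C}^n\times \mathrm{GL}_n(\mathbb{C})\times X$ and a holomorphic map $\Gamma=\Gamma(z,\lambda,\omega)\colon\Omega\to\mathbb{C}^n$ with the following property: if $u\colon(\mathbb{C}^n,0)\to(\mathbb{C}^n,0)$ is a germ of a biholomorphism satisfying $A(u(z))=b(z,\omega_0)$ for $z$ near $0$, for some $\omega_0\in X$, then $u(z)=\Gamma(z,u'(0),\omega_0)$ for $z$ near $0$. Furthermore, $\Gamma$ can be chosen such that, in addition: (i) for every $(\lambda,\omega)\in \mathrm{GL}_n(\mathbb{C})\times X$, $\Gamma(0,\lambda,\omega)=0$ and $\Gamma_z(0,\lambda,\omega)=\lambda$, where $\Gamma_z$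 denotes the Jacobian matrix of $\Gamma$ with respect to $z$; (ii) if we write the Taylor expansions at $z=0$ as $$\Gamma(z,\lambda,\omega)=\sum_{\alpha\in\mathbb{N}^n}\Gamma_\alpha(\lambda,\omega)z^\alpha,\qquad b(z,\omega)=\sum_{\alpha\in\mathbb{N}^n}b_\alpha(\omega)z^\alpha,$$ then there exist an integer $\ell_0\ge 0$ and, for every $\alpha\in\mathbb{N}^n$, a nonnegative integer $k_\alpha$ and a $\mathbb{C}^n$-valued map $p_\alpha$ that is polynomial in the entries of $\lambda$ and the components of the Taylor coefficients $b_\beta\in\mathbb{C}^n$, $|\beta|\le \ell_0+|\alpha|$, such that for all $(\lambda,\omega)\in \mathrm{GL}_n(\mathbb{C})\times X$ $$\Gamma_\alpha(\lambda,\omega)=\frac{p_\alpha\bigl(\lambda,(b_\beta(\omega))_{|\beta|\le\ell_0+|\alpha|}\bigr)}{(\det\lambda)^{k_\alpha}}.$$ -/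

import Mathlib

open Filter Topology Manifold
open scoped ContDiff

namespace SingularSystem

noncomputable section

/-- The generic rank of the germ at `0` of `f : ℂⁿ → ℂⁿ` is `r`: the rank of the derivative is
at most `r` near `0`, and the value `r` is attained at points arbitrarily close to `0`. -/
def HasGenericRank {n : ℕ} (f : (Fin n → ℂ) → (Fin n → ℂ)) (r : ℕ) : Prop :=
  (∀ᶠ z in 𝓝 (0 : Fin n → ℂ), Module.finrank ℂ (fderiv ℂ f z).range ≤ r) ∧
    ∃ᶠ z in 𝓝 (0 : Fin n → ℂ), Module.finrank ℂ (fderiv ℂ f z).range = r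

/-- `u` represents a germ of a biholomorphism `(ℂⁿ, 0) → (ℂⁿ, 0)`: it is holomorphic near `0`, fixes
`0`, and has a two-sided inverse germ of the same kind. -/
def IsBiholomorphismGerm {n : ℕ} (u : (Fin n → ℂ) → (Fin n → ℂ)) : Prop :=
  AnalyticAt ℂ u 0 ∧ u 0 = 0 ∧
    ∃ v : (Fin n → ℂ) → (Fin n → ℂ), AnalyticAt ℂ v 0 ∧ v 0 = 0 ∧
      (∀ᶠ z in 𝓝 (0 : Fin n → ℂ), v (u z) = z) ∧ (∀ᶠ z in 𝓝 (0 : Fin n → ℂ), u (v z) = z)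

/-- The partial derivative `∂f/∂zᵢ`. -/
def partialDeriv {n : ℕ} (i : Fin n) (f : (Fin n → ℂ) → (Fin n → ℂ)) :
    (Fin n → ℂ) → (Fin n → ℂ) :=
  fun z => fderiv ℂ f z (Pi.single i 1)

/-- The iterated partial derivative `∂^α f = ∂₁^{α₁} ⋯ ∂ₙ^{αₙ} f` for a multi-index `α ∈ ℕⁿ`. -/
def iteratedPartialDeriv {n : ℕ} (α : Fin n → ℕ) (f : (Fin n → ℂ) → (Fin n → ℂ)) :
    (Fin n → ℂ) → (Fin n → ℂ) :=
  (List.finRange n).foldr (fun i g => (partialDeriv i)^[α i] g) f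

/-- The coefficient `f_α = (1/α!) ∂^α f(0)` of the Taylor expansion `f(z) = ∑_α f_α z^α` at `0`. -/
def taylorCoeff {n : ℕ} (f : (Fin n → ℂ) → (Fin n → ℂ)) (α : Fin n → ℕ) : Fin n → ℂ :=
  ((∏ i, ((α i).factorial : ℂ)))⁻¹ • iteratedPartialDeriv α f 0

/-- The space of linear endomorphisms of `ℂⁿ`, that is, of complex `n × n` matrices. The group
`GLₙ(ℂ)` is the open subset of those with invertible determinant. -/
abbrev Mat (n : ℕ) : Type := (Fin n → ℂ) →L[ℂ] (Fin n → ℂ)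

/-- The indices of the coordinates on `GLₙ(ℂ) × J₀ᵏ(ℂⁿ)`: the entries `(i, j)` of a matrix, and,
for each multi-index `β` with `|β| ≤ k`, the components of the Taylor coefficient
`b_β ∈ ℂⁿ` of a map `b : ℂⁿ → ℂⁿ`. -/
abbrev JetIndex (n k : ℕ) : Type :=
  (Fin n × Fin n) ⊕ ({β : Fin n → ℕ // ∑ i, β i ≤ k} × Fin n)

/-- The point of `GLₙ(ℂ) × J₀ᵏ(ℂⁿ)` with matrix `(l_{ij})` and Taylor coefficients `b_β = c β`, `|β| ≤ k`,
in these coordinates. -/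
def jetPoint {n : ℕ} (k : ℕ) (l : Mat n)
    (c : (Fin n → ℕ) → (Fin n → ℂ)) :
    JetIndex n k → ℂ :=
  Sum.elim (fun e => LinearMap.toMatrix' (l : (Fin n → ℂ) →ₗ[ℂ] (Fin n → ℂ)) e.1 e.2) (fun e => c e.1.1 e.2)

end

end SingularSystem

/-!
# Parametrization of the invertible solutions of a singular system of analytic equations

Since `det A'` does not vanish identically, the components of `A` can be replaced by polynomial
expressions `Bⱼ = Pⱼ(A)` whose leading forms `fⱼ`, of degrees `eⱼ + 1`, have a Jacobian determinant
`D` that is not zero: as long as the leading forms are algebraically dependent, a homogeneous relation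
between them, applied to the components, yields a component of higher order, and the order of the
Jacobian determinant bounds how often this can happen (`exists_independent_leadingForms`,
`exists_leadingSystem`). If `A(u(z)) = b(z, x)` and `l = u'(0)`, then `u(l⁻¹ w) = w + H(w)` is tangent
to the identity and satisfies `B(w + H(w)) = c(w)` with `c(w) = P(b(l⁻¹ w, x))`. It remains to solve
this system for `H` in terms of `c`.

Its part linear in `H` with leading coefficients is `f'(X) H`. This operator has a left inverse that
exists for every right-hand side: apply the adjugate of `f'(X)`, and then divide by `D`, where division
takes a monomial of `D` as dominant and disregards the remainder (`divSeries`, `LeadingSystem.solve`).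
The left inverse lowers the order of the `j`-th component by `eⱼ` at most, while the nonlinear rest of
the system raises it by more than that. So a fixed-point iteration converges formally to a series
`LeadingSystem.sol`, defined for every `c`, and every solution tangent to the identity coincides with
it (`LeadingSystem.eq_sol`). The parametrization is `Γ(z, l, x) = (X + H)(l z)` with `H` this series
(`solMap`); whether the equation has a solution plays no role in its construction.

The iterates are bounded in weighted `ℓ¹` norms. On a polyradius `ε s`, a component of order `k` is of
size `ε ^ k` (`wnorm_le_pow_mul`), so the orders that make the iteration converge formally also make
it converge for small `ε`; the weights in `s` are such that the dominant monomial of `D` carries most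
of its norm (`wnorm_divSeries_le`). The radius of convergence depends on `c` only through a bound for
its norm (`LeadingSystem.exists_wnorm_sol_le`).

The iteration makes sense over every commutative complex algebra and commutes with homomorphisms
(`LeadingSystem.map_sol`), and two choices of the algebra give the remaining assertions. Over the
algebra of convergent power series in the parameters, the estimates show that `Γ` is holomorphic in
all variables (`LeadingSystem.analyticAt_ev_sol`). Over the algebra of the functions
`p / (det l) ^ k` of `l` and of the jet of `b`, which contains the entries of `l⁻¹`, the iteration shows that the
Taylor coefficients of `Γ` have the required form (`LeadingSystem.exists_jetCoeff_eq`). Because the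
division by `D` costs `deg D` orders, the coefficients of `Γ` of degree `|α|` involve those of `b`
up to degree `deg D + |α|`.
-/

namespace SingularSystem

noncomputable section

open scoped ENNReal NNReal

/-! ### The order filtration on formal power series -/

/-- The ideal of power series all of whose terms have degree at least `k`. -/
def ordIdeal (σ R : Type*) [CommRing R] (k : ℕ) : Ideal (MvPowerSeries σ R) where
  carrier := {f | (k : ℕ∞) ≤ f.order}
  add_mem' {f g} hf hg := (le_min hf hg).trans MvPowerSeries.min_order_le_add
  zero_mem' := by simp
  smul_mem' c f hf :=
    le_trans (le_trans hf (le_add_of_nonneg_left (zero_le))) MvPowerSeries.le_order_mul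

section ordIdeal

variable {σ R : Type*} [CommRing R]

theorem mem_ordIdeal_iff_le_order {k : ℕ} {f : MvPowerSeries σ R} :
    f ∈ ordIdeal σ R k ↔ (k : ℕ∞) ≤ f.order := Iff.rfl

theorem mem_ordIdeal {k : ℕ} {f : MvPowerSeries σ R} :
    f ∈ ordIdeal σ R k ↔ ∀ a, a.degree < k → MvPowerSeries.coeff a f = 0 :=
  ⟨fun h _ ha => MvPowerSeries.coeff_of_lt_order (lt_of_lt_of_le (by exact_mod_cast ha) h),
    fun h => MvPowerSeries.nat_le_order h⟩

theorem ordIdeal_anti {j k : ℕ} (h : j ≤ k) : ordIdeal σ R k ≤ ordIdeal σ R j :=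
  fun _ hf => le_trans (Nat.cast_le.2 h : (j : ℕ∞) ≤ k) hf

theorem mem_ordIdeal_zero (f : MvPowerSeries σ R) : f ∈ ordIdeal σ R 0 := by
  simp [mem_ordIdeal_iff_le_order]

theorem mul_mem_ordIdeal {j k : ℕ} {f g : MvPowerSeries σ R} (hf : f ∈ ordIdeal σ R j)
    (hg : g ∈ ordIdeal σ R k) : f * g ∈ ordIdeal σ R (j + k) := by
  rw [mem_ordIdeal_iff_le_order] at *
  push_cast
  exact (add_le_add hf hg).trans MvPowerSeries.le_order_mul

theorem prod_mem_ordIdeal {ι : Type*} (s : Finset ι) (k : ι → ℕ) (f : ι → MvPowerSeries σ R)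
    (h : ∀ i ∈ s, f i ∈ ordIdeal σ R (k i)) : ∏ i ∈ s, f i ∈ ordIdeal σ R (∑ i ∈ s, k i) := by
  classical
  induction s using Finset.induction_on with
  | empty => simpa using mem_ordIdeal_zero 1
  | insert i s hi ih =>
    rw [Finset.prod_insert hi, Finset.sum_insert hi]
    exact mul_mem_ordIdeal (h i (by simp)) (ih fun j hj => h j (by simp [hj]))

theorem det_mem_ordIdeal {ι : Type*} [Fintype ι] [DecidableEq ι]
    {M : Matrix ι ι (MvPowerSeries σ R)} {k : ι → ℕ} (h : ∀ i j, M i j ∈ ordIdeal σ R (k i)) :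
    M.det ∈ ordIdeal σ R (∑ i, k i) := by
  rw [← Matrix.det_transpose, Matrix.det_apply]
  refine sum_mem fun τ _ => ?_
  refine Submodule.smul_of_tower_mem _ _ ?_
  exact prod_mem_ordIdeal _ _ _ fun j _ => h _ _

theorem X_mem_ordIdeal (i : σ) : (MvPowerSeries.X i : MvPowerSeries σ R) ∈ ordIdeal σ R 1 := by
  classical
  rw [mem_ordIdeal]
  intro a ha
  rw [MvPowerSeries.coeff_X, if_neg]
  rintro rfl
  simp at ha

theorem coe_mem_ordIdeal {f : MvPolynomial σ R} {k : ℕ} (hf : f.IsHomogeneous k) :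
    (f : MvPowerSeries σ R) ∈ ordIdeal σ R k := by
  rw [mem_ordIdeal]
  intro a ha
  rw [MvPolynomial.coeff_coe]
  exact hf.coeff_eq_zero ha.ne

theorem pderiv_mem_ordIdeal {f : MvPowerSeries σ R} {k : ℕ} (hf : f ∈ ordIdeal σ R k) (i : σ) :
    MvPowerSeries.pderiv R i f ∈ ordIdeal σ R (k - 1) := by
  rw [mem_ordIdeal] at *
  intro a ha
  rw [MvPowerSeries.coeff_pderiv, hf, zero_mul]
  rw [map_add, Finsupp.degree_single]
  omega

/-- A nonzero homogeneous polynomial of degree `k` does not vanish to order `k + 1`. -/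
theorem eq_zero_of_coe_mem_ordIdeal {f : MvPolynomial σ R} {k : ℕ} (hf : f.IsHomogeneous k)
    (h : (f : MvPowerSeries σ R) ∈ ordIdeal σ R (k + 1)) : f = 0 := by
  ext a
  by_cases ha : a.degree = k
  · simpa using mem_ordIdeal.1 h a (by omega)
  · simpa using hf.coeff_eq_zero ha

theorem mul_notMem_ordIdeal [IsDomain R] {j k : ℕ} {f g : MvPowerSeries σ R}
    (hf : f ∉ ordIdeal σ R (j + 1)) (hg : g ∉ ordIdeal σ R (k + 1)) :
    f * g ∉ ordIdeal σ R (j + k + 1) := by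
  rw [mem_ordIdeal_iff_le_order, not_le] at *
  rw [MvPowerSeries.order_mul]
  have h1 : f.order ≤ j := by
    rw [Nat.cast_add, Nat.cast_one] at hf
    exact Order.le_of_lt_add_one hf
  have h2 : g.order ≤ k := by
    rw [Nat.cast_add, Nat.cast_one] at hg
    exact Order.le_of_lt_add_one hg
  calc f.order + g.order ≤ j + k := add_le_add h1 h2
    _ < ((j + k + 1 : ℕ) : ℕ∞) := by exact_mod_cast Nat.lt_succ_self _

/-- Every nonzero power series is a nonzero homogeneous polynomial plus terms of higher degree. -/
theorem exists_leadingForm {f : MvPowerSeries σ R} [Finite σ] (hf : f ≠ 0) {k : ℕ}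
    (hk : f ∈ ordIdeal σ R k) :
    ∃ (m : ℕ) (p : MvPolynomial σ R), k ≤ m ∧ p.IsHomogeneous m ∧
      f - p ∈ ordIdeal σ R (m + 1) := by
  have h := MvPowerSeries.ne_zero_iff_order_finite.1 hf
  refine ⟨f.order.toNat, MvPolynomial.homogeneousComponent f.order.toNat
    (MvPowerSeries.truncTotal (f.order.toNat + 1) f), ?_,
    MvPolynomial.homogeneousComponent_isHomogeneous _ _, ?_⟩
  · rw [mem_ordIdeal_iff_le_order, ← h] at hk
    exact_mod_cast hk
  · rw [mem_ordIdeal]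
    intro a ha
    rw [map_sub, MvPolynomial.coeff_coe, MvPolynomial.coeff_homogeneousComponent]
    split_ifs with hd
    · rw [MvPowerSeries.coeff_truncTotal _ ha, sub_self]
    · rw [sub_zero]
      apply MvPowerSeries.coeff_of_lt_order
      rw [← h]
      exact_mod_cast (by omega : a.degree < f.order.toNat)

end ordIdeal

/-! ### Replacing a system by one with independent leading forms -/

/-- A derivation that kills algebraically independent polynomials, as many as there are variables,
is zero: every polynomial is algebraic over the algebra they generate, and the derivation
multiplies by the derivative of the minimal equation. -/
theorem derivation_eq_zero_of_algebraicIndependent {K σ : Type*} [Field K] [CharZero K] [Finite σ]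
    {f : σ → MvPolynomial σ K} (hf : AlgebraicIndependent K f)
    (D : Derivation K (MvPolynomial σ K) (MvPolynomial σ K)) (hD : ∀ j, D (f j) = 0)
    (x : MvPolynomial σ K) : D x = 0 := by
  have hb : IsTranscendenceBasis K f := by
    apply hf.isTranscendenceBasis_of_lift_trdeg_le_of_finite
    rw [MvPolynomial.trdeg_of_isDomain]
    simp
  have halg := hb.isAlgebraic
  set S := Algebra.adjoin K (Set.range f) with hS
  have hDS : ∀ s : S, D (s : MvPolynomial σ K) = 0 := by
    rintro ⟨s, hs⟩
    have : Set.EqOn D (0 : Derivation K (MvPolynomial σ K) (MvPolynomial σ K)) (S : Set _) :=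
      Derivation.eqOn_adjoin (by rintro _ ⟨j, rfl⟩; simp [hD])
    simpa using this hs
  let D' : Derivation S (MvPolynomial σ K) (MvPolynomial σ K) :=
    Derivation.mk'
      { toFun := D
        map_add' := fun a b => map_add D a b
        map_smul' := fun s a => by
          rw [RingHom.id_apply, Algebra.smul_def, Derivation.leibniz]
          have : D (algebraMap S (MvPolynomial σ K) s) = 0 := hDS s
          rw [this, smul_zero, add_zero, Algebra.smul_def (R := S), smul_eq_mul] }
      (fun a b => D.leibniz a b)
  obtain ⟨p, hp0, hpx⟩ := halg.isAlgebraic x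
  induction hN : p.natDegree using Nat.strong_induction_on generalizing p with
  | _ N ih =>
    have hder : Polynomial.aeval x (Polynomial.derivative p) * D x = 0 := by
      have := D'.map_aeval p x
      rw [hpx, map_zero] at this
      exact this.symm
    rcases mul_eq_zero.1 hder with h | h
    · by_cases h0 : p.natDegree = 0
      · rw [Polynomial.eq_C_of_natDegree_eq_zero h0, Polynomial.aeval_C] at hpx
        have : p.coeff 0 = 0 := by
          apply FaithfulSMul.algebraMap_injective S (MvPolynomial σ K)
          rw [hpx, map_zero]
        rw [Polynomial.eq_C_of_natDegree_eq_zero h0, this, map_zero] at hp0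
        exact absurd rfl hp0
      · have hlt := Polynomial.natDegree_derivative_lt h0
        refine ih _ (hN ▸ hlt) _ ?_ h rfl
        intro hd
        exact h0 (Polynomial.derivative_eq_zero.1 hd)
    · exact h

/-- The Jacobian criterion in characteristic zero. -/
theorem det_pderiv_ne_zero {K σ : Type*} [Field K] [CharZero K] [Fintype σ] [DecidableEq σ]
    {f : σ → MvPolynomial σ K} (hf : AlgebraicIndependent K f) :
    (Matrix.of fun j k => MvPolynomial.pderiv k (f j)).det ≠ 0 := by
  intro h0
  obtain ⟨v, hv, hv0⟩ := Matrix.exists_mulVec_eq_zero_iff.2 h0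
  apply hv
  have hD := derivation_eq_zero_of_algebraicIndependent hf
    (∑ k, v k • MvPolynomial.pderiv k) (fun j => by
      have := congrFun hv0 j
      simp only [Matrix.mulVec, dotProduct, Matrix.of_apply, Pi.zero_apply] at this
      rw [← this, ← Derivation.coeFnAddMonoidHom_apply, map_sum, Finset.sum_apply]
      exact Finset.sum_congr rfl fun k _ => by simp [mul_comm])
  funext k
  have h := hD (MvPolynomial.X k)
  rw [← Derivation.coeFnAddMonoidHom_apply, map_sum, Finset.sum_apply] at h
  simpa [MvPolynomial.pderiv_X, Pi.single_apply] using h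

/-- The chain rule for a derivation applied to a polynomial expression. -/
theorem derivation_aeval {K A σ : Type*} [CommRing K] [CommRing A] [Algebra K A] [Fintype σ]
    (D : Derivation K A A) (B : σ → A) (Q : MvPolynomial σ K) :
    D (MvPolynomial.aeval B Q) = ∑ l, MvPolynomial.aeval B (MvPolynomial.pderiv l Q) * D (B l) := by
  classical
  induction Q using MvPolynomial.induction_on with
  | C a => simp
  | add p q hp hq => simp only [map_add, hp, hq, add_mul, Finset.sum_add_distrib]
  | mul_X p i hp =>
    simp only [map_mul, MvPolynomial.aeval_X, Derivation.leibniz, smul_eq_mul, hp, map_add,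
      add_mul, Finset.sum_add_distrib, MvPolynomial.pderiv_X]
    congr 1
    · simp [Pi.single_apply]
    · rw [Finset.mul_sum]
      exact Finset.sum_congr rfl fun l _ => by ring

/-- The formal Jacobian matrix `∂Bⱼ/∂wₖ`. -/
def jac {K σ : Type*} [CommRing K] (B : σ → MvPowerSeries σ K) :
    Matrix σ σ (MvPowerSeries σ K) :=
  Matrix.of fun j k => MvPowerSeries.pderiv K k (B j)

section LeadingForms

variable {K σ : Type*} [Field K]

theorem aeval_coe (f : σ → MvPolynomial σ K) (Q : MvPolynomial σ K) :
    MvPolynomial.aeval (fun j => (f j : MvPowerSeries σ K)) Q =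
      ((MvPolynomial.aeval f Q : MvPolynomial σ K) : MvPowerSeries σ K) := by
  have := MvPolynomial.map_aeval f (MvPolynomial.coeToMvPowerSeries.ringHom (σ := σ) (R := K)) Q
  simp only [MvPolynomial.coeToMvPowerSeries.ringHom_apply] at this
  rw [this, MvPolynomial.aeval_def, MvPolynomial.coe_eval₂Hom]
  congr 1
  ext a
  simp [MvPowerSeries.algebraMap_apply]

/-- In a weighted homogeneous polynomial of weight `W`, replacing each argument by its leading
form changes the value only in degrees above `W`. -/
theorem aeval_sub_mem_ordIdeal [Fintype σ] {B : σ → MvPowerSeries σ K} {m : σ → ℕ}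
    {f : σ → MvPowerSeries σ K} (hf : ∀ j, f j ∈ ordIdeal σ K (m j))
    (hB : ∀ j, B j - f j ∈ ordIdeal σ K (m j + 1)) {Q : MvPolynomial σ K} {W : ℕ}
    (hQ : Q.IsWeightedHomogeneous m W) :
    MvPolynomial.aeval B Q - MvPolynomial.aeval f Q ∈ ordIdeal σ K (W + 1) := by
  have hB' : ∀ j, B j ∈ ordIdeal σ K (m j) := fun j => by
    have := add_mem (ordIdeal_anti (Nat.le_succ _) (hB j)) (hf j)
    rwa [sub_add_cancel] at this
  have mono : ∀ a : σ →₀ ℕ, (∏ j, B j ^ a j) - ∏ j, f j ^ a j ∈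
      ordIdeal σ K (Finsupp.weight m a + 1) ∧ (∏ j, f j ^ a j) ∈
      ordIdeal σ K (Finsupp.weight m a) ∧ (∏ j, B j ^ a j) ∈
      ordIdeal σ K (Finsupp.weight m a) := by
    classical
    intro a
    induction a using Finsupp.induction_linear with
    | zero => simp [mem_ordIdeal_zero]
    | add a b ha hb =>
      have hp : ∀ g : σ → MvPowerSeries σ K,
          ∏ j, g j ^ (a + b) j = (∏ j, g j ^ a j) * ∏ j, g j ^ b j := fun g => by
        simp [pow_add, Finset.prod_mul_distrib]
      rw [hp, hp, map_add]
      refine ⟨?_, mul_mem_ordIdeal ha.2.1 hb.2.1, mul_mem_ordIdeal ha.2.2 hb.2.2⟩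
      have : ∀ p q p' q' : MvPowerSeries σ K, p * q - p' * q' = (p - p') * q + p' * (q - q') :=
        fun _ _ _ _ => by ring
      rw [this]
      refine add_mem ?_ ?_
      · have := mul_mem_ordIdeal ha.1 hb.2.2
        rwa [add_right_comm] at this
      · have := mul_mem_ordIdeal ha.2.1 hb.1
        rwa [← add_assoc] at this
    | single i k =>
      have hp : ∀ g : σ → MvPowerSeries σ K, ∏ j, g j ^ (Finsupp.single i k) j = g i ^ k :=
        fun g => by
          rw [Finset.prod_eq_single i] <;> simp +contextual [eq_comm]
      rw [hp, hp]
      simp only [Finsupp.weight_single, smul_eq_mul]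
      clear hp
      induction k with
      | zero => simp [mem_ordIdeal_zero]
      | succ k ih =>
        rw [pow_succ, pow_succ, add_mul, one_mul]
        refine ⟨?_, mul_mem_ordIdeal ih.2.1 (hf i), mul_mem_ordIdeal ih.2.2 (hB' i)⟩
        have : ∀ p q p' q' : MvPowerSeries σ K, p * q - p' * q' = (p - p') * q + p' * (q - q') :=
          fun _ _ _ _ => by ring
        rw [this]
        refine add_mem ?_ ?_
        · have := mul_mem_ordIdeal ih.1 (hB' i)
          rwa [add_right_comm] at this
        · have := mul_mem_ordIdeal ih.2.1 (hB i)
          rwa [← add_assoc] at this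
  rw [MvPolynomial.aeval_def, MvPolynomial.aeval_def, MvPolynomial.eval₂_eq',
    MvPolynomial.eval₂_eq', ← Finset.sum_sub_distrib]
  refine sum_mem fun a ha => ?_
  rw [← mul_sub]
  refine Ideal.mul_mem_left _ _ ?_
  have := (mono a).1
  rwa [hQ (MvPolynomial.mem_support_iff.1 ha)] at this

/-- Substituting homogeneous polynomials of degrees `mⱼ` into a polynomial of weight `W` gives a
homogeneous polynomial of degree `W`. -/
theorem isHomogeneous_aeval [Fintype σ] {m : σ → ℕ} {f : σ → MvPolynomial σ K}
    (hf : ∀ j, (f j).IsHomogeneous (m j)) {Q : MvPolynomial σ K} {W : ℕ}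
    (hQ : Q.IsWeightedHomogeneous m W) : (MvPolynomial.aeval f Q).IsHomogeneous W := by
  rw [MvPolynomial.aeval_def, MvPolynomial.eval₂_eq']
  refine MvPolynomial.IsHomogeneous.sum _ _ _ fun a ha => ?_
  have h1 : (∏ i, f i ^ a i).IsHomogeneous (∑ i, m i * a i) :=
    MvPolynomial.IsHomogeneous.prod _ _ _ fun i _ => (hf i).pow _
  have h2 : ∑ i, m i * a i = W := by
    rw [← hQ (MvPolynomial.mem_support_iff.1 ha), Finsupp.weight_apply, Finsupp.sum_fintype] <;>
      simp [mul_comm]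
  rw [h2] at h1
  simpa using (MvPolynomial.isHomogeneous_C σ (Q.coeff a)).mul h1

theorem eq_C_of_pderiv_eq_zero [CharZero K] {P : MvPolynomial σ K}
    (h : ∀ j, MvPolynomial.pderiv j P = 0) : P = MvPolynomial.C (P.coeff 0) := by
  classical
  ext b
  by_cases hb : b = 0
  · simp [hb]
  · obtain ⟨i, hi⟩ := Finsupp.ne_iff.1 hb
    have hle : Finsupp.single i 1 ≤ b :=
      Finsupp.single_le_iff.2 (Nat.one_le_iff_ne_zero.2 hi)
    have := congrArg (MvPolynomial.coeff (b - Finsupp.single i 1)) (h i)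
    rw [MvPolynomial.coeff_pderiv, tsub_add_cancel_of_le hle, MvPolynomial.coeff_zero] at this
    rw [MvPolynomial.coeff_C, if_neg (Ne.symm hb)]
    exact (mul_eq_zero.1 this).resolve_right (Nat.cast_add_one_ne_zero _)

theorem totalDegree_pderiv_lt {P : MvPolynomial σ K} {j : σ} (hj : MvPolynomial.pderiv j P ≠ 0) :
    (MvPolynomial.pderiv j P).totalDegree < P.totalDegree := by
  classical
  have key : ∀ a ∈ (MvPolynomial.pderiv j P).support, (a.sum fun _ e => e) < P.totalDegree := by
    intro a ha
    rw [MvPolynomial.mem_support_iff, MvPolynomial.coeff_pderiv] at ha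
    have h1 := MvPolynomial.le_totalDegree (MvPolynomial.mem_support_iff.2 (left_ne_zero_of_mul ha))
    rw [Finsupp.sum_add_index' (by simp) (by simp), Finsupp.sum_single_index rfl] at h1
    omega
  obtain ⟨a, ha⟩ := MvPolynomial.support_nonempty.2 hj
  exact (Finset.sup_lt_iff (by simpa using pos_of_gt (key a ha))).2 key

/-- Dependent homogeneous polynomials satisfy a weighted homogeneous relation one of whose partial
derivatives is not a relation: take a relation of minimal total degree. -/
theorem exists_weightedHomogeneous_relation [CharZero K] [Fintype σ] {m : σ → ℕ}
    {f : σ → MvPolynomial σ K} (hf : ∀ j, (f j).IsHomogeneous (m j))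
    (hdep : ¬ AlgebraicIndependent K f) :
    ∃ (Q : MvPolynomial σ K) (W : ℕ) (j : σ), Q.IsWeightedHomogeneous m W ∧
      MvPolynomial.aeval f Q = 0 ∧ MvPolynomial.aeval f (MvPolynomial.pderiv j Q) ≠ 0 := by
  classical
  rw [algebraicIndependent_iff] at hdep
  push Not at hdep
  have hex : ∃ N, ∃ Q : MvPolynomial σ K, MvPolynomial.aeval f Q = 0 ∧ Q ≠ 0 ∧
      Q.totalDegree = N := by
    obtain ⟨Q, h1, h2⟩ := hdep
    exact ⟨_, Q, h1, h2, rfl⟩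
  obtain ⟨Q, hQ, hQ0, hdeg⟩ := Nat.find_spec hex
  have hmin : ∀ P : MvPolynomial σ K, MvPolynomial.aeval f P = 0 →
      P.totalDegree < Q.totalDegree → P = 0 := fun P hP hlt => by
    by_contra hne
    exact Nat.find_min hex (hdeg ▸ hlt) ⟨P, hP, hne, rfl⟩
  -- each weighted homogeneous component of a relation is a relation
  have hcomp : ∀ W, MvPolynomial.aeval f (MvPolynomial.weightedHomogeneousComponent m W Q) = 0 := by
    intro W
    have hfin := MvPolynomial.weightedHomogeneousComponent_finsupp (w := m) Q
    have hsum := MvPolynomial.sum_weightedHomogeneousComponent m Q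
    rw [finsum_eq_sum _ hfin] at hsum
    have h0 := congrArg (fun P => MvPolynomial.homogeneousComponent W (MvPolynomial.aeval f P)) hsum
    simp only [map_sum, hQ, map_zero] at h0
    have hh : ∀ V, (MvPolynomial.aeval f
        (MvPolynomial.weightedHomogeneousComponent m V Q)).IsHomogeneous V := fun V =>
      isHomogeneous_aeval hf (MvPolynomial.weightedHomogeneousComponent_isWeightedHomogeneous _ _)
    simp only [MvPolynomial.homogeneousComponent_of_mem (hh _)] at h0
    rw [Finset.sum_ite_eq] at h0
    split_ifs at h0 with hW
    · exact h0
    · have : MvPolynomial.weightedHomogeneousComponent m W Q = 0 := by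
        by_contra hne
        exact hW (hfin.mem_toFinset.2 hne)
      rw [this, map_zero]
  obtain ⟨W, hW⟩ : ∃ W, MvPolynomial.weightedHomogeneousComponent m W Q ≠ 0 := by
    by_contra! h
    apply hQ0
    rw [← MvPolynomial.sum_weightedHomogeneousComponent m Q]
    simp [h]
  set P := MvPolynomial.weightedHomogeneousComponent m W Q with hP
  have hPdeg : P.totalDegree ≤ Q.totalDegree := by
    rw [MvPolynomial.totalDegree, MvPolynomial.totalDegree]
    refine Finset.sup_mono ?_
    rw [hP, MvPolynomial.support_weightedHomogeneousComponent]
    exact Finset.filter_subset _ _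
  obtain ⟨j, hj⟩ : ∃ j, MvPolynomial.pderiv j P ≠ 0 := by
    by_contra! h
    have hPC := eq_C_of_pderiv_eq_zero h
    have h2 := hcomp W
    rw [← hP, hPC, MvPolynomial.algHom_C, map_eq_zero] at h2
    exact hW (by rw [hPC, h2, map_zero])
  exact ⟨P, W, j, MvPolynomial.weightedHomogeneousComponent_isWeightedHomogeneous _ _, hcomp W,
    fun h => hj (hmin _ h ((totalDegree_pderiv_lt hj).trans_le hPdeg))⟩

theorem det_jac_mem_ordIdeal [Fintype σ] [DecidableEq σ] {B : σ → MvPowerSeries σ K} {m : σ → ℕ}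
    (hB : ∀ j, B j ∈ ordIdeal σ K (m j)) : (jac B).det ∈ ordIdeal σ K (∑ j, (m j - 1)) :=
  det_mem_ordIdeal (k := fun j => m j - 1) fun j _ => pderiv_mem_ordIdeal (hB j) _

/-- Replacing one component of `B` by a polynomial expression `Q(B)` multiplies the Jacobian by
`∂Q(B)`. -/
theorem det_jac_update [Fintype σ] [DecidableEq σ] (B : σ → MvPowerSeries σ K)
    (Q : MvPolynomial σ K) (j : σ) :
    (jac (Function.update B j (MvPolynomial.aeval B Q))).det =
      MvPolynomial.aeval B (MvPolynomial.pderiv j Q) * (jac B).det := by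
  have : jac (Function.update B j (MvPolynomial.aeval B Q)) = (jac B).updateRow j
      (∑ l, MvPolynomial.aeval B (MvPolynomial.pderiv l Q) • jac B l) := by
    ext i k : 2
    by_cases hi : i = j
    · subst hi
      simp [jac, derivation_aeval, Finset.sum_apply]
    · simp [jac, hi]
  rw [this, Matrix.det_updateRow_sum]
  simp

/-- A system with nonvanishing Jacobian can be replaced by polynomial expressions in its components
whose leading forms have nonvanishing Jacobian. While the leading forms are dependent, a component
is replaced by a relation between them; each such step lowers the number `ord det B' + n - ∑ mⱼ`,
which is never negative. -/
theorem exists_independent_leadingForms [CharZero K] [Fintype σ] [DecidableEq σ]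
    (A : σ → MvPowerSeries σ K) (hA : (jac A).det ≠ 0) :
    ∃ (P : σ → MvPolynomial σ K) (m : σ → ℕ) (f : σ → MvPolynomial σ K),
      (∀ j, (f j).IsHomogeneous (m j)) ∧
      (∀ j, MvPolynomial.aeval A (P j) - f j ∈ ordIdeal σ K (m j + 1)) ∧
      (Matrix.of fun j k => MvPolynomial.pderiv k (f j)).det ≠ 0 := by
  have ne_zero_of_det : ∀ B : σ → MvPowerSeries σ K, (jac B).det ≠ 0 → ∀ j, B j ≠ 0 := by
    intro B hB j hj
    exact hB (Matrix.det_eq_zero_of_row_eq_zero j fun k => by simp [jac, hj])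
  have main : ∀ (δ e : ℕ) (P : σ → MvPolynomial σ K) (m : σ → ℕ) (f : σ → MvPolynomial σ K),
      (∀ j, (f j).IsHomogeneous (m j)) →
      (∀ j, MvPolynomial.aeval A (P j) - f j ∈ ordIdeal σ K (m j + 1)) →
      (jac fun j => MvPolynomial.aeval A (P j)).det ∉ ordIdeal σ K (e + 1) →
      e + Fintype.card σ ≤ δ + ∑ j, m j →
      ∃ (P : σ → MvPolynomial σ K) (m : σ → ℕ) (f : σ → MvPolynomial σ K),
        (∀ j, (f j).IsHomogeneous (m j)) ∧
        (∀ j, MvPolynomial.aeval A (P j) - f j ∈ ordIdeal σ K (m j + 1)) ∧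
        (Matrix.of fun j k => MvPolynomial.pderiv k (f j)).det ≠ 0 := by
    intro δ
    induction δ with
    | zero => ?_
    | succ δ ih => ?_
    all_goals
      intro e P m f hf hB hdet hδ
      by_cases hind : AlgebraicIndependent K f
      · exact ⟨P, m, f, hf, hB, det_pderiv_ne_zero hind⟩
      obtain ⟨Q, W, j, hQ, hQf, hQj⟩ := exists_weightedHomogeneous_relation hf hind
      set B : σ → MvPowerSeries σ K := fun j => MvPolynomial.aeval A (P j) with hBdef
      have hWj : ∃ V, V + m j = W ∧ (MvPolynomial.pderiv j Q).IsWeightedHomogeneous m V := by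
        have hne : MvPolynomial.pderiv j Q ≠ 0 := fun h => hQj (by rw [h, map_zero])
        obtain ⟨a, ha⟩ := MvPolynomial.ne_zero_iff.1 hne
        rw [MvPolynomial.coeff_pderiv] at ha
        have hw := hQ (left_ne_zero_of_mul ha)
        rw [map_add, Finsupp.weight_single, one_smul] at hw
        exact ⟨_, hw, hQ.pderiv hw⟩
      obtain ⟨V, hVW, hV⟩ := hWj
      have hfO : ∀ j, (f j : MvPowerSeries σ K) ∈ ordIdeal σ K (m j) := fun j =>
        coe_mem_ordIdeal (hf j)
      have hg : MvPolynomial.aeval B (MvPolynomial.pderiv j Q) ∉ ordIdeal σ K (V + 1) := by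
        intro h
        have h2 := sub_mem h (aeval_sub_mem_ordIdeal hfO hB hV)
        rw [sub_sub_cancel, aeval_coe] at h2
        exact hQj (eq_zero_of_coe_mem_ordIdeal (isHomogeneous_aeval hf hV) h2)
      have hnew : MvPolynomial.aeval B Q ∈ ordIdeal σ K (W + 1) := by
        have h2 := aeval_sub_mem_ordIdeal hfO hB hQ
        rwa [aeval_coe, hQf, MvPolynomial.coe_zero, sub_zero] at h2
      have hdet' := mul_notMem_ordIdeal hg hdet
      rw [← det_jac_update] at hdet'
      have hne := ne_zero_of_det _ (fun h => hdet' (by rw [h]; exact zero_mem _)) j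
      rw [Function.update_self] at hne
      obtain ⟨m', f', hm', hf', hB'⟩ := exists_leadingForm hne hnew
      have hcomp : Function.update B j (MvPolynomial.aeval B Q) =
          fun i => MvPolynomial.aeval A (Function.update P j (MvPolynomial.bind₁ P Q) i) := by
        funext i
        by_cases hi : i = j
        · subst hi
          simp [MvPolynomial.aeval_bind₁, hBdef]
        · simp [hi, hBdef]
      have hupd : ∀ i, Function.update B j (MvPolynomial.aeval B Q) i -
          (Function.update f j f' i : MvPolynomial σ K) ∈
          ordIdeal σ K (Function.update m j m' i + 1) := by
        intro i
        by_cases hi : i = j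
        · subst hi
          simpa using hB'
        · simpa [hi] using hB i
      have hhom : ∀ i, (Function.update f j f' i).IsHomogeneous (Function.update m j m' i) := by
        intro i
        by_cases hi : i = j
        · subst hi
          simpa using hf'
        · simpa [hi] using hf i
      have hsum : ∑ i, Function.update m j m' i + m j = ∑ i, m i + m' := by
        rw [Finset.sum_update_of_mem (Finset.mem_univ j),
          ← Finset.sum_sdiff (Finset.subset_univ {j}) (f := m), Finset.sum_singleton]
        ring
    · exfalso
      refine hdet' (ordIdeal_anti ?_ (det_jac_mem_ordIdeal (m := Function.update m j m')
        fun i => ?_))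
      · have : ∑ i, Function.update m j m' i ≤
            ∑ i, (Function.update m j m' i - 1) + Fintype.card σ := by
          rw [Fintype.card_eq_sum_ones, ← Finset.sum_add_distrib]
          exact Finset.sum_le_sum fun i _ => by omega
        omega
      · have := add_mem (ordIdeal_anti (Nat.le_succ _) (hupd i)) (coe_mem_ordIdeal (hhom i))
        rwa [sub_add_cancel] at this
    · rw [hcomp] at hdet'
      exact ih (V + e) _ _ _ hhom (fun i => by
        have := hupd i
        rwa [hcomp] at this) hdet' (by omega)
  choose m f _ hf hB using fun j => exists_leadingForm (ne_zero_of_det A hA j)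
    (mem_ordIdeal_zero (A j))
  have hord := MvPowerSeries.ne_zero_iff_order_finite.1 hA
  refine main ((jac A).det.order.toNat + Fintype.card σ) (jac A).det.order.toNat
    (fun j => MvPolynomial.X j) m f hf (by simpa using hB) ?_ (by omega)
  simp only [MvPolynomial.aeval_X]
  rw [mem_ordIdeal_iff_le_order, not_le, ← hord]
  exact_mod_cast Nat.lt_succ_self _

end LeadingForms

/-! ### Weighted `ℓ¹` norms of formal power series -/

/-- A submultiplicative size function, with values in `[0, ∞]`, on a commutative complex algebra. -/
structure IsAlgNorm {R : Type*} [CommRing R] [Algebra ℂ R] (ν : R → ℝ≥0∞) : Prop where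
  map_zero : ν 0 = 0
  add_le : ∀ a b, ν (a + b) ≤ ν a + ν b
  mul_le : ∀ a b, ν (a * b) ≤ ν a * ν b
  algebraMap_le : ∀ z : ℂ, ν (algebraMap ℂ R z) ≤ ‖z‖ₑ

namespace IsAlgNorm

variable {R : Type*} [CommRing R] [Algebra ℂ R] {ν : R → ℝ≥0∞}

theorem one_le (h : IsAlgNorm ν) : ν 1 ≤ 1 := by simpa using h.algebraMap_le 1

theorem smul_le (h : IsAlgNorm ν) (z : ℂ) (a : R) : ν (z • a) ≤ ‖z‖ₑ * ν a := by
  rw [Algebra.smul_def]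
  exact (h.mul_le _ _).trans (mul_le_mul_left (h.algebraMap_le z) _)

theorem neg_le (h : IsAlgNorm ν) (a : R) : ν (-a) ≤ ν a := by
  simpa using h.smul_le (-1) a

theorem sub_le (h : IsAlgNorm ν) (a b : R) : ν (a - b) ≤ ν a + ν b := by
  rw [sub_eq_add_neg]
  exact (h.add_le _ _).trans (add_le_add_right (h.neg_le b) _)

theorem sum_le (h : IsAlgNorm ν) {ι : Type*} (s : Finset ι) (f : ι → R) :
    ν (∑ i ∈ s, f i) ≤ ∑ i ∈ s, ν (f i) :=
  Finset.le_sum_of_subadditive ν h.map_zero.le h.add_le s f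

theorem pow_le (h : IsAlgNorm ν) (a : R) (k : ℕ) : ν (a ^ k) ≤ ν a ^ k := by
  induction k with
  | zero => simpa using h.one_le
  | succ k ih =>
    rw [pow_succ, pow_succ]
    exact (h.mul_le _ _).trans (mul_le_mul_left ih _)

theorem prod_le (h : IsAlgNorm ν) {ι : Type*} (s : Finset ι) (f : ι → R) :
    ν (∏ i ∈ s, f i) ≤ ∏ i ∈ s, ν (f i) := by
  classical
  induction s using Finset.induction_on with
  | empty => simpa using h.one_le
  | insert i s hi ih =>
    rw [Finset.prod_insert hi, Finset.prod_insert hi]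
    exact (h.mul_le _ _).trans (mul_le_mul_right ih _)

end IsAlgNorm

theorem isAlgNorm_enorm : IsAlgNorm (fun z : ℂ => ‖z‖ₑ) where
  map_zero := by simp
  add_le := enorm_add_le
  mul_le a b := (enorm_mul a b).le
  algebraMap_le z := le_rfl

/-- The monomial `x^a`. -/
def mpow {σ M : Type*} [Fintype σ] [CommMonoid M] (x : σ → M) (a : σ →₀ ℕ) : M := ∏ i, x i ^ a i

section mpow

variable {σ M : Type*} [Fintype σ] [CommMonoid M]

@[simp] theorem mpow_zero (x : σ → M) : mpow x 0 = 1 := by simp [mpow]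

theorem mpow_add (x : σ → M) (a b : σ →₀ ℕ) : mpow x (a + b) = mpow x a * mpow x b := by
  simp [mpow, pow_add, Finset.prod_mul_distrib]

theorem mpow_single (x : σ → M) (i : σ) (k : ℕ) : mpow x (Finsupp.single i k) = x i ^ k := by
  classical
  rw [mpow, Finset.prod_eq_single i] <;> simp +contextual [eq_comm]

theorem mpow_mul (x y : σ → M) (a : σ →₀ ℕ) :
    mpow (fun i => x i * y i) a = mpow x a * mpow y a := by
  simp [mpow, mul_pow, Finset.prod_mul_distrib]

theorem mpow_const (x : M) (a : σ →₀ ℕ) : mpow (fun _ : σ => x) a = x ^ a.degree := by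
  rw [mpow, Finset.prod_pow_eq_pow_sum, Finsupp.degree_eq_sum]

theorem map_mpow {M' : Type*} [CommMonoid M'] (φ : M →* M') (x : σ → M) (a : σ →₀ ℕ) :
    φ (mpow x a) = mpow (fun i => φ (x i)) a := by
  simp [mpow]

theorem mpow_le_mpow {x y : σ → ℝ≥0∞} (h : ∀ i, x i ≤ y i) (a : σ →₀ ℕ) : mpow x a ≤ mpow y a :=
  Finset.prod_le_prod' fun i _ => pow_le_pow_left' (h i) _

end mpow

/-- The `ℓ¹` norm `∑ₐ ν(fₐ) τ^a` of a power series, for a polyradius `τ` and a size function `ν` on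
the coefficients. -/
def wnorm {σ R : Type*} [Fintype σ] [CommRing R] (ν : R → ℝ≥0∞) (τ : σ → ℝ≥0∞)
    (f : MvPowerSeries σ R) : ℝ≥0∞ :=
  ∑' a, ν (MvPowerSeries.coeff a f) * mpow τ a

section wnorm

variable {σ R : Type*} [Fintype σ] [CommRing R] {ν : R → ℝ≥0∞} {τ : σ → ℝ≥0∞}

theorem tsum_antidiagonal_eq_mul {A : Type*} [AddCommMonoid A] [Finset.HasAntidiagonal A]
    (F G : A → ℝ≥0∞) :
    ∑' a, ∑ x ∈ Finset.HasAntidiagonal.antidiagonal a, F x.1 * G x.2 = (∑' a, F a) * ∑' a, G a := by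
  calc ∑' a, ∑ x ∈ Finset.HasAntidiagonal.antidiagonal a, F x.1 * G x.2
      = ∑' a, ∑' x : Finset.HasAntidiagonal.antidiagonal a, F x.1.1 * G x.1.2 := by
        congr 1; ext a
        rw [Finset.tsum_subtype (Finset.HasAntidiagonal.antidiagonal a) fun x => F x.1 * G x.2]
    _ = ∑' y : (Σ a : A, Finset.HasAntidiagonal.antidiagonal a), F y.2.1.1 * G y.2.1.2 :=
        (ENNReal.tsum_sigma' fun y : (Σ a : A, Finset.HasAntidiagonal.antidiagonal a) =>
          F y.2.1.1 * G y.2.1.2).symm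
    _ = ∑' p : A × A, F p.1 * G p.2 :=
        (Finset.HasAntidiagonal.sigmaAntidiagonalEquivProd.tsum_eq fun p : A × A => F p.1 * G p.2)
    _ = ∑' a, ∑' b, F a * G b :=
        ENNReal.tsum_prod (f := fun a b => F a * G b)
    _ = (∑' a, F a) * ∑' a, G a := by
        simp_rw [ENNReal.tsum_mul_left, ENNReal.tsum_mul_right]

theorem wnorm_mono_radius {τ' : σ → ℝ≥0∞} (h : ∀ i, τ i ≤ τ' i) (f : MvPowerSeries σ R) :
    wnorm ν τ f ≤ wnorm ν τ' f :=
  ENNReal.tsum_le_tsum fun a => mul_le_mul_right (mpow_le_mpow h a) _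

theorem wnorm_mono_coeff {R' : Type*} [CommRing R'] {ν' : R' → ℝ≥0∞} {f : MvPowerSeries σ R}
    {g : MvPowerSeries σ R'}
    (h : ∀ a, ν (MvPowerSeries.coeff a f) ≤ ν' (MvPowerSeries.coeff a g)) :
    wnorm ν τ f ≤ wnorm ν' τ g :=
  ENNReal.tsum_le_tsum fun a => mul_le_mul_left (h a) _

variable [Algebra ℂ R]

theorem isAlgNorm_wnorm (hν : IsAlgNorm ν) (τ : σ → ℝ≥0∞) :
    IsAlgNorm (wnorm ν τ : MvPowerSeries σ R → ℝ≥0∞) where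
  map_zero := by simp [wnorm, hν.map_zero]
  add_le f g := by
    rw [wnorm, wnorm, wnorm, ← ENNReal.tsum_add]
    refine ENNReal.tsum_le_tsum fun a => ?_
    rw [← add_mul, map_add]
    exact mul_le_mul_left (hν.add_le _ _) _
  mul_le f g := by
    classical
    rw [wnorm, wnorm, wnorm, ← tsum_antidiagonal_eq_mul]
    refine ENNReal.tsum_le_tsum fun a => ?_
    rw [MvPowerSeries.coeff_mul]
    refine (mul_le_mul_left (hν.sum_le _ _) _).trans ?_
    rw [Finset.sum_mul]
    refine Finset.sum_le_sum fun x hx => ?_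
    rw [← Finset.HasAntidiagonal.mem_antidiagonal.1 hx, mpow_add]
    refine (mul_le_mul_left (hν.mul_le _ _) _).trans (le_of_eq (by ring))
  algebraMap_le z := by
    classical
    rw [wnorm, tsum_eq_single 0]
    · simpa [MvPowerSeries.algebraMap_apply] using hν.algebraMap_le z
    · intro a ha
      simp [MvPowerSeries.algebraMap_apply, MvPowerSeries.coeff_C, ha, hν.map_zero]

theorem wnorm_X_le (hν : IsAlgNorm ν) (i : σ) :
    wnorm ν τ (MvPowerSeries.X i : MvPowerSeries σ R) ≤ τ i := by
  classical
  rw [wnorm, tsum_eq_single (Finsupp.single i 1)]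
  · rw [MvPowerSeries.coeff_index_single_self_X, mpow_single, pow_one]
    exact (mul_le_mul_left hν.one_le _).trans (one_mul _).le
  · intro a ha
    rw [MvPowerSeries.coeff_X, if_neg ha, hν.map_zero, zero_mul]

/-- Schwarz lemma: shrinking the radius by the factor `ε ≤ 1` shrinks the norm of a series of order
at least `k` by `ε ^ k`. -/
theorem wnorm_le_pow_mul (hν : IsAlgNorm ν) {ε : ℝ≥0∞} (hε : ε ≤ 1) {k : ℕ} {f : MvPowerSeries σ R}
    (hf : f ∈ ordIdeal σ R k) : wnorm ν (fun i => ε * τ i) f ≤ ε ^ k * wnorm ν τ f := by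
  rw [wnorm, wnorm, ← ENNReal.tsum_mul_left]
  refine ENNReal.tsum_le_tsum fun a => ?_
  by_cases ha : a.degree < k
  · rw [mem_ordIdeal.1 hf a ha, hν.map_zero, zero_mul]
    exact zero_le
  · rw [mpow_mul, mpow_const, mul_left_comm]
    exact mul_le_mul_left (pow_le_pow_right_of_le_one' hε (not_lt.1 ha)) _

theorem wnorm_coe_lt_top (p : MvPolynomial σ ℂ) (hτ : ∀ i, τ i ≠ ⊤) :
    wnorm (fun z : ℂ => ‖z‖ₑ) τ (p : MvPowerSeries σ ℂ) < ⊤ := by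
  rw [wnorm, tsum_eq_sum (s := p.support)]
  · refine ENNReal.sum_lt_top.2 fun a _ => ENNReal.mul_lt_top enorm_lt_top ?_
    exact ENNReal.prod_lt_top fun i _ => ENNReal.pow_lt_top (hτ i).lt_top
  · intro a ha
    rw [MvPolynomial.coeff_coe, MvPolynomial.notMem_support_iff.1 ha]
    simp

/-- The norm of a polynomial expression is controlled by the norm of the polynomial. -/
theorem aeval_le_wnorm (hν : IsAlgNorm ν) (g : σ → R) (p : MvPolynomial σ ℂ) :
    ν (MvPolynomial.aeval g p) ≤
      wnorm (fun z : ℂ => ‖z‖ₑ) (fun i => ν (g i)) (p : MvPowerSeries σ ℂ) := by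
  rw [MvPolynomial.aeval_def, MvPolynomial.eval₂_eq', wnorm, tsum_eq_sum (s := p.support)]
  · refine (hν.sum_le _ _).trans (Finset.sum_le_sum fun a _ => ?_)
    refine (hν.mul_le _ _).trans (mul_le_mul' ?_ ?_)
    · simpa using hν.algebraMap_le _
    · exact (hν.prod_le _ _).trans (Finset.prod_le_prod' fun i _ => hν.pow_le _ _)
  · intro a ha
    rw [MvPolynomial.coeff_coe, MvPolynomial.notMem_support_iff.1 ha]
    simp

/-- Taylor's formula of second order for a polynomial, with a bound for the remainder that does not
depend on the norm. -/
theorem exists_taylor_bound (p : MvPolynomial σ ℂ) :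
    ∃ C : ℝ≥0∞, C ≠ ⊤ ∧ ∀ (ν : R → ℝ≥0∞), IsAlgNorm ν → ∀ (x g : σ → R) (η : ℝ≥0∞), η ≤ 1 →
      (∀ i, ν (x i) ≤ 1) → (∀ i, ν (g i) ≤ η) →
      ν (MvPolynomial.aeval (x + g) p - MvPolynomial.aeval x p -
        ∑ k, MvPolynomial.aeval x (MvPolynomial.pderiv k p) * g k) ≤ C * η ^ 2 := by
  classical
  induction p using MvPolynomial.induction_on with
  | C a =>
    refine ⟨0, by simp, fun ν hν x g η _ _ _ => ?_⟩
    simp [hν.map_zero]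
  | add p q hp hq =>
    obtain ⟨C, hC, h⟩ := hp
    obtain ⟨C', hC', h'⟩ := hq
    refine ⟨C + C', by simp [hC, hC'], fun ν hν x g η h1 h2 h3 => ?_⟩
    have : MvPolynomial.aeval (x + g) (p + q) - MvPolynomial.aeval x (p + q) -
        ∑ k, MvPolynomial.aeval x (MvPolynomial.pderiv k (p + q)) * g k =
        (MvPolynomial.aeval (x + g) p - MvPolynomial.aeval x p -
          ∑ k, MvPolynomial.aeval x (MvPolynomial.pderiv k p) * g k) +
        (MvPolynomial.aeval (x + g) q - MvPolynomial.aeval x q -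
          ∑ k, MvPolynomial.aeval x (MvPolynomial.pderiv k q) * g k) := by
      simp only [map_add, add_mul, Finset.sum_add_distrib]
      ring
    rw [this, add_mul]
    exact (hν.add_le _ _).trans (add_le_add (h ν hν x g η h1 h2 h3) (h' ν hν x g η h1 h2 h3))
  | mul_X q i hq =>
    obtain ⟨C, hC, h⟩ := hq
    set K : ℝ≥0∞ := ∑ k, wnorm (fun z : ℂ => ‖z‖ₑ) (fun _ : σ => (1 : ℝ≥0∞))
      ((MvPolynomial.pderiv k q : MvPolynomial σ ℂ) : MvPowerSeries σ ℂ) with hK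
    have hKfin : K ≠ ⊤ := by
      rw [hK]
      exact (ENNReal.sum_lt_top.2 fun k _ => wnorm_coe_lt_top _ (by simp)).ne
    refine ⟨C * 2 + K, ENNReal.add_ne_top.2 ⟨ENNReal.mul_ne_top hC (by simp), hKfin⟩,
      fun ν hν x g η h1 h2 h3 => ?_⟩
    have e : MvPolynomial.aeval (x + g) (q * MvPolynomial.X i) -
        MvPolynomial.aeval x (q * MvPolynomial.X i) -
        ∑ k, MvPolynomial.aeval x (MvPolynomial.pderiv k (q * MvPolynomial.X i)) * g k =
        (MvPolynomial.aeval (x + g) q - MvPolynomial.aeval x q -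
          ∑ k, MvPolynomial.aeval x (MvPolynomial.pderiv k q) * g k) * (x i + g i) +
        (∑ k, MvPolynomial.aeval x (MvPolynomial.pderiv k q) * g k) * g i := by
      have e1 : ∑ k, MvPolynomial.aeval x (MvPolynomial.pderiv k (q * MvPolynomial.X i)) * g k =
          MvPolynomial.aeval x q * g i +
          x i * ∑ k, MvPolynomial.aeval x (MvPolynomial.pderiv k q) * g k := by
        simp only [Derivation.leibniz, MvPolynomial.pderiv_X, map_add, smul_eq_mul, map_mul,
          add_mul, Finset.sum_add_distrib, MvPolynomial.aeval_X, Finset.mul_sum]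
        congr 1
        · simp [Pi.single_apply]
        · exact Finset.sum_congr rfl fun k _ => by ring
      rw [e1]
      simp only [map_mul, MvPolynomial.aeval_X, Pi.add_apply]
      ring
    rw [e, add_mul]
    refine (hν.add_le _ _).trans (add_le_add ?_ ?_)
    · calc _ ≤ C * η ^ 2 * 2 := by
            refine (hν.mul_le _ _).trans (mul_le_mul' (h ν hν x g η h1 h2 h3) ?_)
            refine (hν.add_le _ _).trans ?_
            rw [← one_add_one_eq_two]
            exact add_le_add (h2 i) ((h3 i).trans h1)
        _ = C * 2 * η ^ 2 := by ring
    · rw [sq, ← mul_assoc]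
      refine (hν.mul_le _ _).trans (mul_le_mul' ?_ (h3 i))
      refine (hν.sum_le _ _).trans ?_
      rw [hK, Finset.sum_mul]
      refine Finset.sum_le_sum fun k _ => ?_
      refine (hν.mul_le _ _).trans (mul_le_mul' ?_ (h3 k))
      exact (aeval_le_wnorm hν x _).trans (wnorm_mono_radius h2 _)

end wnorm

/-! ### Convergent power series and the functions they represent -/

/-- The value at `x` of a complex power series (`0` if it does not converge absolutely). -/
def ev {σ : Type*} [Fintype σ] (f : MvPowerSeries σ ℂ) (x : σ → ℂ) : ℂ :=
  ∑' a, MvPowerSeries.coeff a f * mpow x a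

/-- The `ℓ¹` norm of a complex power series on the polydisc of polyradius `τ`. -/
abbrev cnorm {σ : Type*} [Fintype σ] (τ : σ → ℝ≥0∞) (f : MvPowerSeries σ ℂ) : ℝ≥0∞ :=
  wnorm (fun z : ℂ => ‖z‖ₑ) τ f

section ev

variable {σ : Type*} [Fintype σ] {τ : σ → ℝ≥0∞} {f g : MvPowerSeries σ ℂ} {x : σ → ℂ}

theorem enorm_mpow (x : σ → ℂ) (a : σ →₀ ℕ) : ‖mpow x a‖ₑ = mpow (fun i => ‖x i‖ₑ) a :=
  map_mpow (⟨⟨fun z : ℂ => ‖z‖ₑ, by simp⟩, enorm_mul⟩ : ℂ →* ℝ≥0∞) x a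

theorem tsum_enorm_le_cnorm (hx : ∀ i, ‖x i‖ₑ ≤ τ i) :
    ∑' a, ‖MvPowerSeries.coeff a f * mpow x a‖ₑ ≤ cnorm τ f :=
  ENNReal.tsum_le_tsum fun a => by
    rw [enorm_mul, enorm_mpow]
    exact mul_le_mul_right (mpow_le_mpow hx a) _

theorem summable_norm_of_tsum_enorm {ι E : Type*} [SeminormedAddCommGroup E] {u : ι → E}
    (h : ∑' a, ‖u a‖ₑ ≠ ⊤) : Summable fun a => ‖u a‖ := by
  have h' : ∑' a, ((‖u a‖₊ : ℝ≥0) : ℝ≥0∞) ≠ ⊤ := h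
  exact NNReal.summable_coe.2 (ENNReal.tsum_coe_ne_top_iff_summable.1 h')

theorem summable_ev (hf : cnorm τ f < ⊤) (hx : ∀ i, ‖x i‖ₑ ≤ τ i) :
    Summable fun a => ‖MvPowerSeries.coeff a f * mpow x a‖ :=
  summable_norm_of_tsum_enorm ((tsum_enorm_le_cnorm hx).trans_lt hf).ne

theorem enorm_ev_le (hx : ∀ i, ‖x i‖ₑ ≤ τ i) : ‖ev f x‖ₑ ≤ cnorm τ f :=
  (enorm_tsum_le_tsum_enorm).trans (tsum_enorm_le_cnorm hx)

/-- The algebra of power series that converge absolutely on the closed polydisc of polyradius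
`τ`. -/
def convSubalgebra (τ : σ → ℝ≥0∞) : Subalgebra ℂ (MvPowerSeries σ ℂ) where
  carrier := {f | cnorm τ f < ⊤}
  mul_mem' {f g} hf hg :=
    ((isAlgNorm_wnorm isAlgNorm_enorm τ).mul_le f g).trans_lt (ENNReal.mul_lt_top hf hg)
  add_mem' {f g} hf hg :=
    ((isAlgNorm_wnorm isAlgNorm_enorm τ).add_le f g).trans_lt (ENNReal.add_lt_top.2 ⟨hf, hg⟩)
  algebraMap_mem' z :=
    ((isAlgNorm_wnorm isAlgNorm_enorm τ).algebraMap_le z).trans_lt enorm_lt_top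

theorem mem_convSubalgebra : f ∈ convSubalgebra τ ↔ cnorm τ f < ⊤ := Iff.rfl

theorem ev_algebraMap (z : ℂ) : ev (algebraMap ℂ (MvPowerSeries σ ℂ) z) x = z := by
  classical
  rw [ev, tsum_eq_single 0]
  · simp [MvPowerSeries.algebraMap_apply]
  · intro a ha
    simp [MvPowerSeries.algebraMap_apply, MvPowerSeries.coeff_C, ha]

theorem ev_mul (hf : cnorm τ f < ⊤) (hg : cnorm τ g < ⊤) (hx : ∀ i, ‖x i‖ₑ ≤ τ i) :
    ev (f * g) x = ev f x * ev g x := by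
  classical
  have h1 := summable_ev hf hx
  have h2 := summable_ev hg hx
  have h3 := summable_mul_of_summable_norm h1 h2
  have h := Summable.tsum_mul_tsum_eq_tsum_sum_antidiagonal
    (f := fun a => MvPowerSeries.coeff a f * mpow x a)
    (g := fun a => MvPowerSeries.coeff a g * mpow x a) h1.of_norm h2.of_norm h3
  refine Eq.trans (tsum_congr fun a => ?_) h.symm
  rw [MvPowerSeries.coeff_mul, Finset.sum_mul]
  refine Finset.sum_congr rfl fun y hy => ?_
  rw [← Finset.HasAntidiagonal.mem_antidiagonal.1 hy, mpow_add]
  ring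

/-- Evaluation at a point of the closed polydisc of polyradius `τ`. -/
def evHom (hx : ∀ i, ‖x i‖ₑ ≤ τ i) : convSubalgebra τ →ₐ[ℂ] ℂ where
  toFun f := ev f.1 x
  map_one' := by
    have := ev_algebraMap (x := x) (1 : ℂ)
    rwa [map_one] at this
  map_zero' := by
    have := ev_algebraMap (x := x) (0 : ℂ)
    rwa [map_zero] at this
  map_add' f g := by
    rw [ev, ev, ev, ← (summable_ev f.2 hx).of_norm.tsum_add (summable_ev g.2 hx).of_norm]
    simp [add_mul]
  map_mul' f g := ev_mul f.2 g.2 hx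
  commutes' z := ev_algebraMap z

theorem ev_coe (p : MvPolynomial σ ℂ) (x : σ → ℂ) :
    ev (p : MvPowerSeries σ ℂ) x = MvPolynomial.eval x p := by
  rw [MvPolynomial.eval_eq', ev, tsum_eq_sum (s := p.support)]
  · simp [mpow]
  · intro a ha
    rw [MvPolynomial.coeff_coe, MvPolynomial.notMem_support_iff.1 ha, zero_mul]

/-- The power series `f` converges near `0` and its sum is the germ at `0` of `F`. -/
def Represents (f : MvPowerSeries σ ℂ) (F : (σ → ℂ) → ℂ) : Prop :=
  ∃ ρ : ℝ≥0∞, ρ ≠ 0 ∧ cnorm (fun _ => ρ) f < ⊤ ∧ ∀ᶠ x in 𝓝 0, F x = ev f x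

theorem eventually_enorm_le {ρ : ℝ≥0∞} (hρ : ρ ≠ 0) :
    ∀ᶠ x in 𝓝 (0 : σ → ℂ), ∀ i, ‖x i‖ₑ ≤ ρ := by
  rw [eventually_all]
  intro i
  have h : Tendsto (fun x : σ → ℂ => ‖x i‖ₑ) (𝓝 0) (𝓝 0) := by
    have : Continuous fun x : σ → ℂ => ‖x i‖ₑ := by fun_prop
    simpa using this.tendsto 0
  exact (h.eventually (gt_mem_nhds (pos_iff_ne_zero.2 hρ))).mono fun _ => le_of_lt

theorem Represents.congr {F G : (σ → ℂ) → ℂ} (h : Represents f F) (hFG : F =ᶠ[𝓝 0] G) :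
    Represents f G := by
  obtain ⟨ρ, hρ, hf, hF⟩ := h
  exact ⟨ρ, hρ, hf, by filter_upwards [hF, hFG] with x h1 h2; rw [← h2, h1]⟩

theorem represents_coe (p : MvPolynomial σ ℂ) : Represents p fun x => MvPolynomial.eval x p :=
  ⟨1, one_ne_zero, wnorm_coe_lt_top _ (by simp), Eventually.of_forall fun x => (ev_coe p x).symm⟩

/-- Polynomial expressions in convergent series represent polynomial expressions in their sums. -/
theorem Represents.aeval {κ : Type*} [Finite κ] {f : κ → MvPowerSeries σ ℂ}
    {F : κ → (σ → ℂ) → ℂ} (h : ∀ j, Represents (f j) (F j)) (p : MvPolynomial κ ℂ) :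
    Represents (MvPolynomial.aeval f p) fun x => MvPolynomial.eval (fun j => F j x) p := by
  cases nonempty_fintype κ
  choose ρ hρ hf hF using h
  obtain ⟨r, hr, hr'⟩ : ∃ r : ℝ≥0∞, r ≠ 0 ∧ ∀ j, r ≤ ρ j := by
    refine ⟨Finset.univ.inf ρ, ?_, fun j => Finset.inf_le (Finset.mem_univ j)⟩
    rw [← pos_iff_ne_zero, Finset.lt_inf_iff (by simp)]
    exact fun j _ => pos_iff_ne_zero.2 (hρ j)
  have hfr : ∀ j, f j ∈ convSubalgebra (fun _ : σ => r) := fun j =>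
    (wnorm_mono_radius (fun _ => hr' j) _).trans_lt (hf j)
  have e1 : MvPolynomial.aeval f p = ((MvPolynomial.aeval
      (fun j => (⟨f j, hfr j⟩ : convSubalgebra (fun _ : σ => r))) p :
        convSubalgebra (fun _ : σ => r)) : MvPowerSeries σ ℂ) := by
    rw [← Subalgebra.coe_val, MvPolynomial.comp_aeval_apply]
    rfl
  refine ⟨r, hr, ?_, ?_⟩
  · rw [e1]
    exact (MvPolynomial.aeval
      (fun j => (⟨f j, hfr j⟩ : convSubalgebra (fun _ : σ => r))) p).2
  · filter_upwards [eventually_enorm_le hr, eventually_all.2 hF] with x hx hFx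
    have : ev (MvPolynomial.aeval f p) x = evHom hx (MvPolynomial.aeval
        (fun j => (⟨f j, hfr j⟩ : convSubalgebra (fun _ : σ => r))) p) := by
      rw [e1]; rfl
    rw [this, MvPolynomial.comp_aeval_apply, MvPolynomial.aeval_eq_eval]
    congr 2
    funext j
    exact hFx j

theorem Represents.sub {F G : (σ → ℂ) → ℂ} (hf : Represents f F) (hg : Represents g G) :
    Represents (f - g) fun x => F x - G x := by
  have := Represents.aeval (f := ![f, g]) (F := ![F, G]) (by
    intro j; fin_cases j; exacts [hf, hg]) (MvPolynomial.X 0 - MvPolynomial.X 1)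
  simpa using this

/-- A series of order at least `k` represents a function that is `O(‖x‖ ^ k)`. -/
theorem Represents.isBigO {F : (σ → ℂ) → ℂ} (h : Represents f F) {k : ℕ}
    (hk : f ∈ ordIdeal σ ℂ k) : F =O[𝓝 0] fun x => ‖x‖ ^ k := by
  obtain ⟨ρ, hρ, hf, hF⟩ := h
  obtain ⟨r, hr0, hrρ⟩ : ∃ r : ℝ≥0, r ≠ 0 ∧ (r : ℝ≥0∞) ≤ ρ := by
    obtain ⟨r, h0, h1⟩ := ENNReal.lt_iff_exists_nnreal_btwn.1 (pos_iff_ne_zero.2 hρ)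
    exact ⟨r, by simpa using h0.ne', h1.le⟩
  have hfr : cnorm (fun _ => (r : ℝ≥0∞)) f < ⊤ := (wnorm_mono_radius (fun _ => hrρ) _).trans_lt hf
  have hnear : ∀ᶠ x in 𝓝 (0 : σ → ℂ), ‖x‖₊ ≤ r := by
    have : Tendsto (fun x : σ → ℂ => ‖x‖₊) (𝓝 0) (𝓝 0) := by
      simpa using (continuous_nnnorm (E := σ → ℂ)).tendsto 0
    exact (this.eventually (gt_mem_nhds (pos_iff_ne_zero.2 hr0))).mono fun _ => le_of_lt
  refine Asymptotics.IsBigO.of_bound ((r : ℝ)⁻¹ ^ k * (cnorm (fun _ => (r : ℝ≥0∞)) f).toReal) ?_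
  filter_upwards [hF, hnear] with x hx hxr
  have h1 : ‖ev f x‖ₑ ≤ ((‖x‖₊ / r : ℝ≥0) : ℝ≥0∞) ^ k * cnorm (fun _ => (r : ℝ≥0∞)) f := by
    have hle : ∀ i, ‖x i‖ₑ ≤ ((‖x‖₊ / r : ℝ≥0) : ℝ≥0∞) * r := fun i => by
      rw [← ENNReal.coe_mul, div_mul_cancel₀ _ hr0]
      exact ENNReal.coe_le_coe.2 (nnnorm_le_pi_nnnorm x i)
    have h2 := wnorm_le_pow_mul isAlgNorm_enorm (τ := fun _ : σ => (r : ℝ≥0∞))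
      (ε := ((‖x‖₊ / r : ℝ≥0) : ℝ≥0∞)) (by exact_mod_cast div_le_one_of_le₀ hxr (by positivity)) hk
    exact (enorm_ev_le hle).trans h2
  have h3 := ENNReal.toReal_mono (ENNReal.mul_lt_top
    (ENNReal.pow_lt_top ENNReal.coe_lt_top) hfr).ne h1
  rw [hx]
  rw [toReal_enorm, ENNReal.toReal_mul, ENNReal.toReal_pow, ENNReal.coe_toReal] at h3
  refine h3.trans (le_of_eq ?_)
  rw [NNReal.coe_div, coe_nnnorm, norm_pow, norm_norm]
  rw [div_eq_mul_inv, mul_pow]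
  ring

theorem eq_zero_of_isHomogeneous_of_isBigO {p : MvPolynomial σ ℂ} {k : ℕ} (hp : p.IsHomogeneous k)
    (h : (fun x => MvPolynomial.eval x p) =O[𝓝 0] fun x => ‖x‖ ^ (k + 1)) : p = 0 := by
  apply MvPolynomial.funext
  intro x
  rw [map_zero]
  have hs : ∀ s : ℂ, MvPolynomial.eval (s • x) p = s ^ k * MvPolynomial.eval x p := fun s => by
    rw [MvPolynomial.eval_eq', MvPolynomial.eval_eq', Finset.mul_sum]
    refine Finset.sum_congr rfl fun a ha => ?_
    have hd : a.degree = k := by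
      by_contra hne
      exact MvPolynomial.mem_support_iff.1 ha (hp.coeff_eq_zero hne)
    have e : ∏ i, (s • x) i ^ a i = s ^ k * ∏ i, x i ^ a i := by
      simp only [Pi.smul_apply, smul_eq_mul, mul_pow, Finset.prod_mul_distrib]
      rw [Finset.prod_pow_eq_pow_sum, ← Finsupp.degree_eq_sum, hd]
    rw [e]; ring
  have ht : Tendsto (fun s : ℂ => s • x) (𝓝[≠] 0) (𝓝 0) := by
    have : Continuous fun s : ℂ => s • x := by fun_prop
    simpa using (this.tendsto 0).mono_left nhdsWithin_le_nhds
  have h1 := h.comp_tendsto ht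
  obtain ⟨C, hC⟩ := h1.bound
  have h2 : ∀ᶠ s : ℂ in 𝓝[≠] 0, ‖MvPolynomial.eval x p‖ ≤ C * ‖x‖ ^ (k + 1) * ‖s‖ := by
    filter_upwards [hC, self_mem_nhdsWithin] with s hs1 hs0
    have hs0 : 0 < ‖s‖ := norm_pos_iff.2 hs0
    simp only [Function.comp_apply, hs, norm_mul, norm_pow, norm_norm, norm_smul, mul_pow] at hs1
    have hk : 0 < ‖s‖ ^ k := by positivity
    refine le_of_mul_le_mul_left (hs1.trans (le_of_eq ?_)) hk
    ring
  have h3 : Tendsto (fun s : ℂ => C * ‖x‖ ^ (k + 1) * ‖s‖) (𝓝[≠] 0) (𝓝 0) := by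
    have : Continuous fun s : ℂ => C * ‖x‖ ^ (k + 1) * ‖s‖ := by fun_prop
    simpa using (this.tendsto 0).mono_left nhdsWithin_le_nhds
  exact norm_le_zero_iff.1 (ge_of_tendsto h3 h2)

/-- A series that represents a function which is `O(‖x‖ ^ k)` has order at least `k`. -/
theorem Represents.mem_ordIdeal {F : (σ → ℂ) → ℂ} (h : Represents f F) {k : ℕ}
    (hF : F =O[𝓝 0] fun x => ‖x‖ ^ k) : f ∈ ordIdeal σ ℂ k := by
  have key : ∀ j ≤ k, f ∈ ordIdeal σ ℂ j := by
    intro j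
    induction j with
    | zero => exact fun _ => mem_ordIdeal_zero f
    | succ j ih =>
      intro hj
      have hfj := ih (by omega)
      set p := MvPolynomial.homogeneousComponent j (MvPowerSeries.truncTotal (j + 1) f) with hp
      have hph : p.IsHomogeneous j := MvPolynomial.homogeneousComponent_isHomogeneous _ _
      have hfp : f - p ∈ ordIdeal σ ℂ (j + 1) := by
        rw [SingularSystem.mem_ordIdeal]
        intro a ha
        rw [map_sub, MvPolynomial.coeff_coe, hp, MvPolynomial.coeff_homogeneousComponent]
        split_ifs with hd
        · rw [MvPowerSeries.coeff_truncTotal _ ha, sub_self]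
        · rw [sub_zero, SingularSystem.mem_ordIdeal.1 hfj a (by omega)]
      have h1 := (h.sub (represents_coe p)).isBigO hfp
      have h2 : F =O[𝓝 0] fun x : σ → ℂ => ‖x‖ ^ (j + 1) := by
        refine hF.trans (Asymptotics.IsBigO.of_bound 1 ?_)
        have : ∀ᶠ x in 𝓝 (0 : σ → ℂ), ‖x‖ < 1 := by
          have : Tendsto (fun x : σ → ℂ => ‖x‖) (𝓝 0) (𝓝 0) := tendsto_norm_zero
          exact this.eventually (gt_mem_nhds one_pos)
        filter_upwards [this] with x hx
        simp only [norm_pow, norm_norm, one_mul]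
        exact pow_le_pow_of_le_one (norm_nonneg _) hx.le hj
      have hp0 := eq_zero_of_isHomogeneous_of_isBigO hph (by simpa using h2.sub h1)
      rwa [hp0, MvPolynomial.coe_zero, sub_zero] at hfp
  exact key k le_rfl

theorem Represents.unique {F : (σ → ℂ) → ℂ} (hf : Represents f F) (hg : Represents g F) :
    f = g := by
  have h : ∀ k, f - g ∈ ordIdeal σ ℂ k := fun k =>
    (hf.sub hg).mem_ordIdeal (by simpa using Asymptotics.isBigO_zero _ _)
  rw [← sub_eq_zero]
  ext a
  exact SingularSystem.mem_ordIdeal.1 (h (a.degree + 1)) a (Nat.lt_succ_self _)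

end ev

/-! ### Analytic germs are represented by their Taylor series -/

section Analytic

variable {σ : Type*} [Fintype σ]

theorem ev_zero (f : MvPowerSeries σ ℂ) : ev f 0 = MvPowerSeries.coeff 0 f := by
  rw [ev, tsum_eq_single 0]
  · simp
  · intro a ha
    obtain ⟨i, hi⟩ := Finsupp.ne_iff.1 ha
    rw [mpow, Finset.prod_eq_zero (Finset.mem_univ i), mul_zero]
    rw [Pi.zero_apply, zero_pow hi]

theorem Represents.apply_zero {f : MvPowerSeries σ ℂ} {F : (σ → ℂ) → ℂ} (h : Represents f F) : F 0 = MvPowerSeries.coeff 0 f := by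
  obtain ⟨_, _, _, hF⟩ := h
  rw [hF.self_of_nhds, ev_zero]

/-- A monomial of degree `k` is the restriction to the diagonal of a `k`-linear form of norm at
most `1`. -/
theorem exists_monomial_multilinear (k : ℕ) (a : σ →₀ ℕ) (ha : a.degree = k) :
    ∃ M : ContinuousMultilinearMap ℂ (fun _ : Fin k => σ → ℂ) ℂ, ‖M‖ ≤ 1 ∧
      ∀ x, M (fun _ => x) = mpow x a := by
  classical
  have hidx : ∀ (k : ℕ) (a : σ →₀ ℕ), a.degree = k →
      ∃ i : Fin k → σ, ∀ x : σ → ℂ, mpow x a = ∏ j, x (i j) := by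
    intro k
    induction k with
    | zero =>
      intro a ha
      rw [Finsupp.degree_eq_zero_iff] at ha
      exact ⟨Fin.elim0, fun x => by simp [ha]⟩
    | succ k ih =>
      intro a ha
      have h0 : a ≠ 0 := by rintro rfl; simp at ha
      obtain ⟨s, hs⟩ := Finsupp.ne_iff.1 h0
      have hle : Finsupp.single s 1 ≤ a :=
        Finsupp.single_le_iff.2 (Nat.one_le_iff_ne_zero.2 hs)
      have hsplit := tsub_add_cancel_of_le hle
      have hdeg : (a - Finsupp.single s 1).degree = k := by
        rw [← hsplit, map_add, Finsupp.degree_single] at ha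
        omega
      obtain ⟨i, hi⟩ := ih _ hdeg
      refine ⟨Fin.cons s i, fun x => ?_⟩
      rw [← hsplit, mpow_add, hi, Fin.prod_univ_succ, mpow_single]
      simp [mul_comm]
  obtain ⟨i, hi⟩ := hidx k a ha
  refine ⟨(ContinuousMultilinearMap.mkPiAlgebra ℂ (Fin k) ℂ).compContinuousLinearMap
    (fun j => ContinuousLinearMap.proj (i j)), ?_, fun x => ?_⟩
  · refine ContinuousMultilinearMap.opNorm_le_bound zero_le_one fun v => ?_
    simp only [ContinuousMultilinearMap.compContinuousLinearMap_apply,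
      ContinuousMultilinearMap.mkPiAlgebra_apply, ContinuousLinearMap.proj_apply, norm_prod,
      one_mul]
    exact Finset.prod_le_prod (fun _ _ => norm_nonneg _) fun j _ => norm_le_pi_norm (v j) (i j)
  · simp [hi]

instance finite_degree_eq (k : ℕ) : Finite {a : σ →₀ ℕ // a.degree = k} := by
  classical
  refine Set.Finite.subset (Finset.finite_toSet (Finset.univ.finsuppAntidiag k)) fun a ha => ?_
  have ha : a.degree = k := ha
  simp [Finset.mem_finsuppAntidiag, ← Finsupp.degree_eq_sum, ha]

/-- The sum of a convergent power series is analytic: the homogeneous parts of the series form a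
`FormalMultilinearSeries`. -/
theorem Represents.analyticAt {f : MvPowerSeries σ ℂ} {F : (σ → ℂ) → ℂ} (h : Represents f F) :
    AnalyticAt ℂ F 0 := by
  classical
  obtain ⟨ρ, hρ, hf, hF⟩ := h
  refine AnalyticAt.congr ?_ (hF.mono fun _ => Eq.symm)
  obtain ⟨r, hr0, hrρ⟩ : ∃ r : ℝ≥0, r ≠ 0 ∧ (r : ℝ≥0∞) ≤ ρ := by
    obtain ⟨r, h0, h1⟩ := ENNReal.lt_iff_exists_nnreal_btwn.1 (pos_iff_ne_zero.2 hρ)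
    exact ⟨r, by simpa using h0.ne', h1.le⟩
  have hfr : cnorm (fun _ => (r : ℝ≥0∞)) f < ⊤ := (wnorm_mono_radius (fun _ => hrρ) _).trans_lt hf
  choose M hM1 hM using fun (k : ℕ) (a : {a : σ →₀ ℕ // a.degree = k}) =>
    exists_monomial_multilinear k a.1 a.2
  have : ∀ k, Fintype {a : σ →₀ ℕ // a.degree = k} := fun k => Fintype.ofFinite _
  let p : FormalMultilinearSeries ℂ (σ → ℂ) ℂ := fun k =>
    ∑ a : {a : σ →₀ ℕ // a.degree = k}, MvPowerSeries.coeff a.1 f • M k a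
  have hp : HasFPowerSeriesOnBall (ev f) p 0 r := by
    refine ⟨?_, ENNReal.coe_pos.2 (pos_iff_ne_zero.2 hr0), ?_⟩
    · refine p.le_radius_of_bound (cnorm (fun _ => (r : ℝ≥0∞)) f).toReal fun k => ?_
      have h1 : ‖p k‖ₑ * (r : ℝ≥0∞) ^ k ≤ cnorm (fun _ => (r : ℝ≥0∞)) f := by
        calc ‖p k‖ₑ * (r : ℝ≥0∞) ^ k
            ≤ (∑ a : {a : σ →₀ ℕ // a.degree = k}, ‖MvPowerSeries.coeff a.1 f‖ₑ) * r ^ k := by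
              refine mul_le_mul_left (le_trans (enorm_sum_le Finset.univ
                fun a : {a : σ →₀ ℕ // a.degree = k} => MvPowerSeries.coeff a.1 f • M k a)
                (Finset.sum_le_sum fun a _ => ?_)) _
              rw [enorm_smul]
              refine (mul_le_mul_right (?_ : _ ≤ (1 : ℝ≥0∞)) _).trans (mul_one _).le
              rw [← enorm_norm, Real.enorm_eq_ofReal (norm_nonneg _)]
              exact ENNReal.ofReal_le_one.2 (hM1 k a)
          _ = ∑' a : {a : σ →₀ ℕ // a.degree = k},
                ‖MvPowerSeries.coeff a.1 f‖ₑ * mpow (fun _ : σ => (r : ℝ≥0∞)) a.1 := by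
              rw [tsum_fintype, Finset.sum_mul]
              refine Finset.sum_congr rfl fun a _ => ?_
              rw [mpow_const, a.2]
          _ ≤ cnorm (fun _ => (r : ℝ≥0∞)) f :=
              ENNReal.tsum_comp_le_tsum_of_injective Subtype.val_injective
                (fun a => ‖MvPowerSeries.coeff a f‖ₑ * mpow (fun _ : σ => (r : ℝ≥0∞)) a)
      have h2 := ENNReal.toReal_mono hfr.ne h1
      simpa using h2
    · intro y hy
      rw [zero_add]
      have hy' : ∀ i, ‖y i‖ₑ ≤ (r : ℝ≥0∞) := fun i => by
        rw [Metric.mem_eball, edist_zero_right] at hy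
        exact (ENNReal.coe_le_coe.2 (nnnorm_le_pi_nnnorm y i)).trans hy.le
      have hs : HasSum (fun a => MvPowerSeries.coeff a f * mpow y a) (ev f y) :=
        (summable_ev hfr hy').of_norm.hasSum
      have hs2 := ((Equiv.sigmaFiberEquiv (Finsupp.degree : (σ →₀ ℕ) → ℕ)).hasSum_iff.2 hs)
      refine hs2.sigma fun k => ?_
      have : p k (fun _ => y) = ∑ a : {a : σ →₀ ℕ // a.degree = k},
          MvPowerSeries.coeff a.1 f * mpow y a.1 := by
        simp [p, hM]
      rw [this]
      exact hasSum_fintype _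
  exact hp.analyticAt

/-- Analytic germs are sums of absolutely convergent multivariable power series. -/
theorem exists_represents {F : (σ → ℂ) → ℂ} (h : AnalyticAt ℂ F 0) : ∃ f, Represents f F := by
  classical
  obtain ⟨p, r, hp⟩ := h
  let cnt : (Σ k, (Fin k → σ)) → (σ →₀ ℕ) := fun z => ∑ j, Finsupp.single (z.2 j) 1
  let term : (Σ k, (Fin k → σ)) → ℂ := fun z => p z.1 fun j => Pi.single (z.2 j) 1
  have hcnt : ∀ {M : Type} [CommMonoid M] (x : σ → M) (z : Σ k, (Fin k → σ)),
      mpow x (cnt z) = ∏ j, x (z.2 j) := by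
    intro M _ x z
    have : ∀ s : Finset (Fin z.1), mpow x (∑ j ∈ s, Finsupp.single (z.2 j) 1) =
        ∏ j ∈ s, x (z.2 j) := by
      intro s
      induction s using Finset.induction_on with
      | empty => simp
      | insert j s hj ih => rw [Finset.sum_insert hj, Finset.prod_insert hj, mpow_add, ih,
          mpow_single, pow_one]
    exact this _
  let f : MvPowerSeries σ ℂ := fun a => ∑' z : {z // cnt z = a}, term z.1
  have hcoeff : ∀ a, MvPowerSeries.coeff a f = ∑' z : {z // cnt z = a}, term z.1 := fun _ => rfl
  -- the radius is divided by the number of variables, since each homogeneous part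
  -- of degree `k` splits into `(card σ) ^ k` terms
  obtain ⟨r₀, hr0, hr0r⟩ : ∃ r₀ : ℝ≥0, 0 < r₀ ∧ (r₀ : ℝ≥0∞) < r := by
    obtain ⟨r₀, h0, h1⟩ := ENNReal.lt_iff_exists_nnreal_btwn.1 hp.r_pos
    exact ⟨r₀, by simpa using h0, h1⟩
  set N : ℝ≥0 := Fintype.card σ + 1 with hN
  have hN0 : N ≠ 0 := by positivity
  set ρ : ℝ≥0 := r₀ / N with hρ
  have hρ0 : ρ ≠ 0 := (div_pos hr0 (by positivity)).ne'
  have hρr : ρ ≤ r₀ := by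
    rw [hρ]
    exact div_le_self (by positivity) (by rw [hN]; simp)
  have hsum : Summable fun k => ‖p k‖₊ * r₀ ^ k :=
    p.summable_nnnorm_mul_pow (hr0r.trans_le hp.r_le)
  have hterm : ∑' z, ‖term z‖ₑ * (ρ : ℝ≥0∞) ^ z.1 < ⊤ := by
    have h1 : ∀ z, ‖term z‖ₑ ≤ ‖p z.1‖ₑ := fun z => by
      have h2 : ‖term z‖ ≤ ‖p z.1‖ := by
        refine ((p z.1).le_opNorm _).trans ?_
        have : ∏ j, ‖(Pi.single (z.2 j) 1 : σ → ℂ)‖ ≤ 1 := by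
          refine Finset.prod_le_one (fun _ _ => norm_nonneg _) fun j _ => ?_
          rw [pi_norm_le_iff_of_nonneg zero_le_one]
          intro i
          by_cases hi : i = z.2 j
          · subst hi; simp
          · simp [hi]
        exact mul_le_of_le_one_right (norm_nonneg _) this
      exact ENNReal.coe_le_coe.2 h2
    calc ∑' z, ‖term z‖ₑ * (ρ : ℝ≥0∞) ^ z.1
        ≤ ∑' z : (Σ k, (Fin k → σ)), ‖p z.1‖ₑ * (ρ : ℝ≥0∞) ^ z.1 :=
          ENNReal.tsum_le_tsum fun z => mul_le_mul_left (h1 z) _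
      _ = ∑' k, ∑' _ : Fin k → σ, ‖p k‖ₑ * (ρ : ℝ≥0∞) ^ k := ENNReal.tsum_sigma' _
      _ ≤ ∑' k, ((‖p k‖₊ * r₀ ^ k : ℝ≥0) : ℝ≥0∞) := by
          refine ENNReal.tsum_le_tsum fun k => ?_
          rw [tsum_fintype, Finset.sum_const, Finset.card_univ, Fintype.card_fun, Fintype.card_fin,
            nsmul_eq_mul]
          have : ((Fintype.card σ ^ k : ℕ) : ℝ≥0) * (‖p k‖₊ * ρ ^ k) ≤ ‖p k‖₊ * r₀ ^ k := by
            have h3 : (Fintype.card σ : ℝ≥0) * ρ ≤ r₀ := by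
              calc (Fintype.card σ : ℝ≥0) * ρ ≤ N * ρ := by
                    gcongr
                    rw [hN]; simp
                _ = r₀ := by rw [hρ]; field_simp
            calc ((Fintype.card σ ^ k : ℕ) : ℝ≥0) * (‖p k‖₊ * ρ ^ k)
                = ‖p k‖₊ * ((Fintype.card σ : ℝ≥0) * ρ) ^ k := by
                  push_cast
                  rw [mul_pow]; ring
              _ ≤ ‖p k‖₊ * r₀ ^ k := by gcongr
          have h4 := ENNReal.coe_le_coe.2 this
          rwa [ENNReal.coe_mul, ENNReal.coe_mul, ENNReal.coe_natCast, ENNReal.coe_pow] at h4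
      _ < ⊤ := (ENNReal.tsum_coe_ne_top_iff_summable.2 hsum).lt_top
  have hfib : ∀ x : σ → ℂ, (∀ i, ‖x i‖ₑ ≤ ρ) →
      Summable fun z => ‖term z * mpow x (cnt z)‖ := by
    intro x hx
    refine summable_norm_of_tsum_enorm ((lt_of_le_of_lt ?_ hterm).ne)
    refine ENNReal.tsum_le_tsum fun z => ?_
    rw [enorm_mul, enorm_mpow, hcnt]
    refine mul_le_mul_right ?_ _
    calc ∏ j, ‖x (z.2 j)‖ₑ ≤ ∏ _j : Fin z.1, (ρ : ℝ≥0∞) :=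
          Finset.prod_le_prod' fun j _ => hx _
      _ = (ρ : ℝ≥0∞) ^ z.1 := by simp
  refine ⟨f, ρ, by exact_mod_cast hρ0, ?_, ?_⟩
  · refine lt_of_le_of_lt ?_ hterm
    calc cnorm (fun _ => (ρ : ℝ≥0∞)) f
        ≤ ∑' a, ∑' z : {z // cnt z = a}, ‖term z.1‖ₑ * (ρ : ℝ≥0∞) ^ z.1.1 := by
          refine ENNReal.tsum_le_tsum fun a => ?_
          have : ∀ z : {z // cnt z = a}, ‖term z.1‖ₑ * (ρ : ℝ≥0∞) ^ z.1.1 =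
              ‖term z.1‖ₑ * mpow (fun _ : σ => (ρ : ℝ≥0∞)) a := fun z => by
            have h := hcnt (fun _ : σ => (ρ : ℝ≥0∞)) z.1
            rw [z.2] at h
            rw [h]; simp
          simp_rw [this]
          rw [ENNReal.tsum_mul_right, hcoeff]
          exact mul_le_mul_left enorm_tsum_le_tsum_enorm _
      _ = ∑' y : (Σ a, {z // cnt z = a}), ‖term y.2.1‖ₑ * (ρ : ℝ≥0∞) ^ y.2.1.1 :=
          (ENNReal.tsum_sigma' fun y : (Σ a, {z // cnt z = a}) =>
            ‖term y.2.1‖ₑ * (ρ : ℝ≥0∞) ^ y.2.1.1).symm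
      _ = ∑' z, ‖term z‖ₑ * (ρ : ℝ≥0∞) ^ z.1 :=
          (Equiv.sigmaFiberEquiv cnt).tsum_eq fun z => ‖term z‖ₑ * (ρ : ℝ≥0∞) ^ z.1
  · filter_upwards [eventually_enorm_le (σ := σ) (ρ := (ρ : ℝ≥0∞)) (by exact_mod_cast hρ0)]
      with x hx
    have hs := (hfib x hx).of_norm
    -- the double series, summed first over the degree
    have hxr : x ∈ Metric.eball (0 : σ → ℂ) r := by
      rw [Metric.mem_eball, edist_zero_right]
      refine lt_of_le_of_lt ?_ hr0r
      have : ‖x‖₊ ≤ ρ := by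
        rw [pi_nnnorm_le_iff]
        intro i
        exact ENNReal.coe_le_coe.1 (hx i)
      exact ENNReal.coe_le_coe.2 (this.trans hρr)
    have h1 := hp.hasSum hxr
    rw [zero_add] at h1
    have h2 : ∀ k, (p k fun _ => x) = ∑ i : Fin k → σ, term ⟨k, i⟩ * mpow x (cnt ⟨k, i⟩) := by
      intro k
      have hx' : x = ∑ s, x s • (Pi.single s 1 : σ → ℂ) := by
        funext i
        simp [Finset.sum_apply, Pi.single_apply]
      have h3 : (p k fun _ => x) =
          (p k).toMultilinearMap fun _ => ∑ s, x s • (Pi.single s 1 : σ → ℂ) := by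
        rw [← hx']; rfl
      rw [h3, MultilinearMap.map_sum]
      refine Finset.sum_congr rfl fun i _ => ?_
      rw [MultilinearMap.map_smul_univ, hcnt, smul_eq_mul, mul_comm]
      rfl
    have h4 : HasSum (fun z => term z * mpow x (cnt z)) (F x) := by
      have h5 := hs.hasSum.sigma fun k => hasSum_fintype fun i : Fin k → σ =>
        term ⟨k, i⟩ * mpow x (cnt ⟨k, i⟩)
      simp_rw [← h2] at h5
      rw [h1.unique h5]
      exact hs.hasSum
    have h6 := ((Equiv.sigmaFiberEquiv cnt).hasSum_iff.2 h4)
    have h7 := h6.sigma (g := fun a => MvPowerSeries.coeff a f * mpow x a) fun a => ?_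
    · exact h7.tsum_eq.symm
    · have h8 : Summable fun z : {z // cnt z = a} => term z.1 * mpow x (cnt z.1) :=
        hs.comp_injective Subtype.val_injective
      have h9 : ∑' z : {z // cnt z = a}, term z.1 * mpow x (cnt z.1) =
          MvPowerSeries.coeff a f * mpow x a := by
        rw [hcoeff, ← tsum_mul_right]
        exact tsum_congr fun z => by rw [z.2]
      rw [← h9]
      exact h8.hasSum

theorem hasFDerivAt_eval (p : MvPolynomial σ ℂ) (x : σ → ℂ) :
    HasFDerivAt (fun x => MvPolynomial.eval x p)
      (∑ k, MvPolynomial.eval x (MvPolynomial.pderiv k p) •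
        (ContinuousLinearMap.proj k : (σ → ℂ) →L[ℂ] ℂ)) x := by
  classical
  induction p using MvPolynomial.induction_on with
  | C a =>
    simp only [MvPolynomial.eval_C]
    exact (hasFDerivAt_const (𝕜 := ℂ) a x).congr_fderiv (by ext; simp)
  | add p q hp hq =>
    simp only [map_add]
    exact (hp.add hq).congr_fderiv (by ext; simp [add_mul, Finset.sum_add_distrib])
  | mul_X p i hp =>
    have h := hp.mul (ContinuousLinearMap.proj (R := ℂ) (φ := fun _ : σ => ℂ) i).hasFDerivAt
    simp only [ContinuousLinearMap.proj_apply] at h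
    simp only [map_mul, MvPolynomial.eval_X]
    refine h.congr_fderiv ?_
    ext v
    simp [Finset.sum_add_distrib, add_mul, Finset.mul_sum, MvPolynomial.pderiv_X,
      Pi.single_apply, mul_assoc, apply_ite (MvPolynomial.eval x)]

theorem AnalyticAt.fderiv_apply {F : (σ → ℂ) → ℂ} {x : σ → ℂ} (hF : AnalyticAt ℂ F x)
    (v : σ → ℂ) : AnalyticAt ℂ (fun x => fderiv ℂ F x v) x :=
  (ContinuousLinearMap.apply ℂ ℂ v).analyticAt _ |>.comp hF.fderiv

/-- Cauchy's estimate: partial derivatives lower the order of vanishing by at most one. -/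
theorem isBigO_fderiv {F : (σ → ℂ) → ℂ} (hF : AnalyticAt ℂ F 0) {k : ℕ}
    (h : F =O[𝓝 0] fun x => ‖x‖ ^ (k + 1)) (v : σ → ℂ) (hv : ‖v‖ ≤ 1) :
    (fun x => fderiv ℂ F x v) =O[𝓝 0] fun x => ‖x‖ ^ k := by
  rcases eq_or_ne v 0 with rfl | hv0
  · simpa using Asymptotics.isBigO_zero _ _
  have : Nontrivial (σ → ℂ) := ⟨v, 0, hv0⟩
  obtain ⟨C, hC⟩ := h.bound
  obtain ⟨δ, hδ, hball⟩ := Metric.eventually_nhds_iff.1 (hC.and hF.eventually_analyticAt)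
  have hnear : ∀ᶠ x in 𝓝[≠] (0 : σ → ℂ), ‖x‖ < δ / 2 := by
    have : Tendsto (fun x : σ → ℂ => ‖x‖) (𝓝[≠] 0) (𝓝 0) :=
      tendsto_norm_zero.mono_left nhdsWithin_le_nhds
    exact this.eventually (gt_mem_nhds (by positivity))
  have hO : ∀ᶠ x in 𝓝[≠] (0 : σ → ℂ), ‖fderiv ℂ F x v‖ ≤ C * 2 ^ (k + 1) * ‖(‖x‖ ^ k)‖ := ?_
  · refine Asymptotics.IsBigO.of_bound (C * 2 ^ (k + 1)) ?_
    rw [← nhdsNE_sup_pure (0 : σ → ℂ), eventually_sup, eventually_pure]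
    refine ⟨hO, le_of_tendsto_of_tendsto (b := 𝓝[≠] (0 : σ → ℂ)) ?_ ?_ hO⟩
    · exact ((AnalyticAt.fderiv_apply hF v).continuousAt.norm).tendsto.mono_left nhdsWithin_le_nhds
    · have : Continuous fun x : σ → ℂ => C * 2 ^ (k + 1) * ‖(‖x‖ ^ k)‖ := by fun_prop
      exact (this.tendsto 0).mono_left nhdsWithin_le_nhds
  filter_upwards [hnear, self_mem_nhdsWithin] with x hx hx0
  have hx0 : 0 < ‖x‖ := norm_pos_iff.2 hx0
  have hline : ∀ t : ℂ, ‖t‖ ≤ ‖x‖ → ‖x + t • v‖ ≤ 2 * ‖x‖ := fun t ht => by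
    calc ‖x + t • v‖ ≤ ‖x‖ + ‖t‖ * ‖v‖ := (norm_add_le _ _).trans (by rw [norm_smul])
      _ ≤ ‖x‖ + ‖x‖ * 1 := by gcongr
      _ = 2 * ‖x‖ := by ring
  have hd : ∀ t : ℂ, ‖t‖ ≤ ‖x‖ →
      HasDerivAt (fun t : ℂ => F (x + t • v)) (fderiv ℂ F (x + t • v) v) t := fun t ht => by
    have h1 : HasFDerivAt F (fderiv ℂ F (x + t • v)) (x + t • v) :=
      (hball (by rw [dist_zero_right]; linarith [hline t ht])).2.differentiableAt.hasFDerivAt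
    have h2 : HasDerivAt (fun t : ℂ => x + t • v) v t := by
      simpa using ((hasDerivAt_id t).smul_const v).const_add x
    exact h1.comp_hasDerivAt t h2
  have hcl : DiffContOnCl ℂ (fun t : ℂ => F (x + t • v)) (Metric.ball 0 ‖x‖) := by
    refine DifferentiableOn.diffContOnCl fun t ht => ?_
    rw [closure_ball _ hx0.ne', mem_closedBall_zero_iff] at ht
    exact (hd t ht).differentiableAt.differentiableWithinAt
  have hest := Complex.norm_deriv_le_of_forall_mem_sphere_norm_le (C := C * (2 * ‖x‖) ^ (k + 1))
    hx0 hcl fun t ht => by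
      have ht : ‖t‖ = ‖x‖ := by simpa using ht
      have h1 := (hball (y := x + t • v) (by rw [dist_zero_right]; linarith [hline t ht.le])).1
      have hC0 : 0 ≤ C := by
        have h2 := (hball (y := x) (by rw [dist_zero_right]; linarith)).1
        have h3 : 0 ≤ C * ‖(‖x‖ ^ (k + 1))‖ := (norm_nonneg _).trans h2
        have h4 : 0 < ‖(‖x‖ ^ (k + 1))‖ := norm_pos_iff.2 (pow_ne_zero _ hx0.ne')
        exact nonneg_of_mul_nonneg_left h3 h4
      refine h1.trans ?_
      rw [norm_pow, norm_norm]
      gcongr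
      exact hline t ht.le
  rw [(hd 0 (by simp)).deriv, zero_smul, add_zero] at hest
  refine hest.trans (le_of_eq ?_)
  rw [norm_pow, norm_norm, mul_pow, pow_succ ‖x‖]
  field_simp

/-- Convergent power series are differentiated term by term. -/
theorem Represents.pderiv [DecidableEq σ] {f : MvPowerSeries σ ℂ} {F : (σ → ℂ) → ℂ}
    (h : Represents f F) (i : σ) :
    Represents (MvPowerSeries.pderiv ℂ i f) fun x => fderiv ℂ F x (Pi.single i 1) := by
  have hF := h.analyticAt
  obtain ⟨g, hg⟩ := exists_represents (AnalyticAt.fderiv_apply hF (Pi.single i 1))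
  suffices g = MvPowerSeries.pderiv ℂ i f by rwa [← this]
  rw [← sub_eq_zero]
  ext a
  set k := a.degree + 1 with hk
  set P := MvPowerSeries.truncTotal (k + 1) f with hP
  have hfP : f - P ∈ ordIdeal σ ℂ (k + 1) := by
    rw [SingularSystem.mem_ordIdeal]
    intro b hb
    rw [map_sub, MvPolynomial.coeff_coe, MvPowerSeries.coeff_truncTotal _ hb, sub_self]
  have hsub := h.sub (represents_coe P)
  have hO := isBigO_fderiv hsub.analyticAt (hsub.isBigO hfP) (Pi.single i 1 : σ → ℂ) (by
    rw [pi_norm_le_iff_of_nonneg zero_le_one]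
    intro j
    by_cases hj : j = i
    · subst hj; simp
    · simp [hj])
  have hsub' : Represents (g - ((MvPolynomial.pderiv i P : MvPolynomial σ ℂ) : MvPowerSeries σ ℂ))
      fun x => fderiv ℂ (fun x => F x - MvPolynomial.eval x P) x (Pi.single i 1) := by
    refine (hg.sub (represents_coe (MvPolynomial.pderiv i P))).congr ?_
    filter_upwards [hF.eventually_analyticAt] with x hx
    rw [fderiv_fun_sub hx.differentiableAt (hasFDerivAt_eval P x).differentiableAt,
      (hasFDerivAt_eval P x).fderiv]
    simp [Pi.single_apply]
  have hmem : g - ((MvPolynomial.pderiv i P : MvPolynomial σ ℂ) : MvPowerSeries σ ℂ) ∈ ordIdeal σ ℂ k :=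
    hsub'.mem_ordIdeal hO
  have h1 := SingularSystem.mem_ordIdeal.1 hmem a (Nat.lt_succ_self _)
  rw [map_sub, MvPolynomial.coeff_coe, MvPolynomial.coeff_pderiv, hP,
    MvPowerSeries.coeff_truncTotal _ (by
      rw [map_add, Finsupp.degree_single]; omega)] at h1
  rw [map_sub, MvPowerSeries.coeff_pderiv, h1, map_zero]

end Analytic

section taylorCoeff

variable {n : ℕ}

theorem partialDeriv_apply_eventuallyEq {F : (Fin n → ℂ) → (Fin n → ℂ)}
    (hF : ∀ j, AnalyticAt ℂ (fun z => F z j) 0) (i j : Fin n) :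
    (fun z => fderiv ℂ (fun z => F z j) z (Pi.single i 1)) =ᶠ[𝓝 0]
      fun z => partialDeriv i F z j := by
  filter_upwards [eventually_all.2 fun j => (hF j).eventually_analyticAt] with z hz
  have h : HasFDerivAt F (ContinuousLinearMap.pi fun j => fderiv ℂ (fun z => F z j) z) z :=
    hasFDerivAt_pi.2 fun j => (hz j).differentiableAt.hasFDerivAt
  rw [partialDeriv, h.fderiv]
  rfl

/-- The formal counterpart of `iteratedPartialDeriv`, along a list of variables. -/
def formalIteratedPartial (α : Fin n → ℕ) (l : List (Fin n)) (f : MvPowerSeries (Fin n) ℂ) :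
    MvPowerSeries (Fin n) ℂ :=
  l.foldr (fun i g => (MvPowerSeries.pderiv ℂ i)^[α i] g) f

theorem coeff_iterate_pderiv (i : Fin n) (k : ℕ) (f : MvPowerSeries (Fin n) ℂ) (c : Fin n →₀ ℕ)
    (hc : c i = 0) : MvPowerSeries.coeff c ((MvPowerSeries.pderiv ℂ i)^[k] f) =
      (k.factorial : ℂ) * MvPowerSeries.coeff (c + Finsupp.single i k) f := by
  induction k generalizing f with
  | zero => simp
  | succ k ih =>
    rw [Function.iterate_succ_apply, ih, MvPowerSeries.coeff_pderiv, add_assoc,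
      ← Finsupp.single_add, Nat.factorial_succ]
    simp only [Finsupp.add_apply, hc, Finsupp.single_eq_same, zero_add]
    push_cast
    ring

theorem coeff_formalIteratedPartial (α : Fin n → ℕ) (l : List (Fin n)) (hl : l.Nodup)
    (f : MvPowerSeries (Fin n) ℂ) (c : Fin n →₀ ℕ) (hc : ∀ i ∈ l, c i = 0) :
    MvPowerSeries.coeff c (formalIteratedPartial α l f) =
      (l.map fun i => ((α i).factorial : ℂ)).prod *
        MvPowerSeries.coeff (c + (l.map fun i => Finsupp.single i (α i)).sum) f := by
  induction l generalizing c with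
  | nil => simp [formalIteratedPartial]
  | cons i l ih =>
    rw [List.nodup_cons] at hl
    have h1 : formalIteratedPartial α (i :: l) f =
        (MvPowerSeries.pderiv ℂ i)^[α i] (formalIteratedPartial α l f) := rfl
    rw [h1, coeff_iterate_pderiv _ _ _ _ (hc i (by simp)), ih hl.2]
    · simp [mul_assoc, add_assoc]
    · intro j hj
      have hij : j ≠ i := fun h => hl.1 (h ▸ hj)
      simp [hc j (by simp [hj]), hij]

theorem represents_iteratedPartial {F : (Fin n → ℂ) → (Fin n → ℂ)}
    {f : Fin n → MvPowerSeries (Fin n) ℂ} (h : ∀ j, Represents (f j) fun z => F z j)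
    (α : Fin n → ℕ) (l : List (Fin n)) (j : Fin n) :
    Represents (formalIteratedPartial α l (f j))
      fun z => l.foldr (fun i g => (partialDeriv i)^[α i] g) F z j := by
  have step : ∀ (i : Fin n) (F : (Fin n → ℂ) → (Fin n → ℂ)) (f : Fin n → MvPowerSeries (Fin n) ℂ),
      (∀ j, Represents (f j) fun z => F z j) →
      ∀ j, Represents (MvPowerSeries.pderiv ℂ i (f j)) fun z => partialDeriv i F z j :=
    fun i F f h j => ((h j).pderiv i).congr
      (partialDeriv_apply_eventuallyEq (fun j => (h j).analyticAt) i j)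
  have iter : ∀ (i : Fin n) (k : ℕ) (F : (Fin n → ℂ) → (Fin n → ℂ))
      (f : Fin n → MvPowerSeries (Fin n) ℂ), (∀ j, Represents (f j) fun z => F z j) →
      ∀ j, Represents ((MvPowerSeries.pderiv ℂ i)^[k] (f j))
        fun z => (partialDeriv i)^[k] F z j := by
    intro i k
    induction k with
    | zero => exact fun F f h j => h j
    | succ k ih =>
      intro F f h j
      rw [Function.iterate_succ_apply, Function.iterate_succ_apply]
      exact ih _ (fun j => MvPowerSeries.pderiv ℂ i (f j)) (step i F f h) j
  induction l generalizing j with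
  | nil => exact h j
  | cons i l ih => exact iter i (α i) _ _ ih j

/-- The Taylor coefficients of a holomorphic germ are the coefficients of the power series that
represents it. -/
theorem taylorCoeff_eq_coeff {F : (Fin n → ℂ) → (Fin n → ℂ)}
    {f : Fin n → MvPowerSeries (Fin n) ℂ} (h : ∀ j, Represents (f j) fun z => F z j)
    (α : Fin n → ℕ) (j : Fin n) :
    taylorCoeff F α j = MvPowerSeries.coeff (Finsupp.equivFunOnFinite.symm α) (f j) := by
  have h1 := represents_iteratedPartial h α (List.finRange n) j
  have h2 := coeff_formalIteratedPartial α (List.finRange n) (List.nodup_finRange n) (f j) 0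
    (by simp)
  have h3 := h1.apply_zero
  rw [h2, zero_add] at h3
  have h5 : ((List.finRange n).map fun i => Finsupp.single i (α i)).sum =
      Finsupp.equivFunOnFinite.symm α := by
    rw [← Fin.sum_univ_def]
    ext i
    simp [Finsupp.finsetSum_apply, Finsupp.single_apply]
  have h6 : ((List.finRange n).map fun i => ((α i).factorial : ℂ)).prod =
      ∏ i, ((α i).factorial : ℂ) := by
    rw [← Fin.prod_univ_def]
  rw [h5, h6] at h3
  rw [taylorCoeff, Pi.smul_apply, smul_eq_mul]
  change _ * (iteratedPartialDeriv α F 0 j) = _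
  have h7 : iteratedPartialDeriv α F 0 j = _ := h3
  rw [h7, inv_mul_cancel_left₀]
  exact Finset.prod_ne_zero_iff.2 fun i _ => by exact_mod_cast Nat.factorial_ne_zero _

end taylorCoeff

/-! ### Division of power series by a polynomial with a dominant monomial -/

section Division

variable {σ R : Type*} [CommRing R] [Algebra ℂ R]

/-- A complex polynomial as a power series with coefficients in a complex algebra. -/
def liftPoly (R : Type*) [CommRing R] [Algebra ℂ R] (p : MvPolynomial σ ℂ) : MvPowerSeries σ R :=
  MvPolynomial.aeval (MvPowerSeries.X : σ → MvPowerSeries σ R) p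

theorem coeff_liftPoly (p : MvPolynomial σ ℂ) (a : σ →₀ ℕ) :
    MvPowerSeries.coeff a (liftPoly R p) = algebraMap ℂ R (p.coeff a) := by
  have : liftPoly R p = ((MvPolynomial.map (algebraMap ℂ R) p : MvPolynomial σ R) :
      MvPowerSeries σ R) := by
    induction p using MvPolynomial.induction_on with
    | C a => simp [liftPoly, MvPowerSeries.algebraMap_apply]
    | add p q hp hq =>
      simp only [liftPoly] at hp hq ⊢
      rw [map_add, map_add, hp, hq, MvPolynomial.coe_add]
    | mul_X p i hp =>
      simp only [liftPoly] at hp ⊢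
      rw [map_mul, map_mul, hp, MvPolynomial.coe_mul]
      simp
  rw [this, MvPolynomial.coeff_coe, MvPolynomial.coeff_map]

theorem liftPoly_mem_ordIdeal {p : MvPolynomial σ ℂ} {k : ℕ}
    (hp : (p : MvPowerSeries σ ℂ) ∈ ordIdeal σ ℂ k) : liftPoly R p ∈ ordIdeal σ R k := by
  rw [mem_ordIdeal] at *
  intro a ha
  rw [coeff_liftPoly, ← MvPolynomial.coeff_coe, hp a ha, map_zero]

theorem map_liftPoly {R' : Type*} [CommRing R'] [Algebra ℂ R'] (φ : R →ₐ[ℂ] R')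
    (p : MvPolynomial σ ℂ) :
    MvPowerSeries.map (φ : R →+* R') (liftPoly R p) = liftPoly R' p := by
  ext a
  rw [MvPowerSeries.coeff_map, coeff_liftPoly, coeff_liftPoly]
  exact φ.commutes _

variable [DecidableEq σ]

/-- The coefficients of the quotient of the power series `g` by the polynomial `D`: the recursion,
along the weight `wt`, that solves `D * p = g` in the monomials divisible by the monomial `a₀`. If
`a₀` is dominant, the condition `wt x.2 < wt a`, which makes the recursion well-founded, holds
whenever `D.coeff x.1 ≠ 0`. -/
def divCoeff (D : MvPolynomial σ ℂ) (a₀ : σ →₀ ℕ) (wt : (σ →₀ ℕ) →+ ℕ) (g : MvPowerSeries σ R)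
    (a : σ →₀ ℕ) : R :=
  (D.coeff a₀)⁻¹ • (MvPowerSeries.coeff (a + a₀) g -
    ∑ x ∈ Finset.HasAntidiagonal.antidiagonal (a + a₀),
      if _h : x.1 ≠ a₀ ∧ wt x.2 < wt a then D.coeff x.1 • divCoeff D a₀ wt g x.2 else 0)
termination_by wt a
decreasing_by exact _h.2

/-- The quotient of a power series by a polynomial with dominant monomial `a₀`. -/
def divSeries (D : MvPolynomial σ ℂ) (a₀ : σ →₀ ℕ) (wt : (σ →₀ ℕ) →+ ℕ) (g : MvPowerSeries σ R) :
    MvPowerSeries σ R :=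
  fun a => divCoeff D a₀ wt g a

variable {D : MvPolynomial σ ℂ} {a₀ : σ →₀ ℕ} {wt : (σ →₀ ℕ) →+ ℕ}

theorem coeff_divSeries (g : MvPowerSeries σ R) (a : σ →₀ ℕ) :
    MvPowerSeries.coeff a (divSeries D a₀ wt g) =
      (D.coeff a₀)⁻¹ • (MvPowerSeries.coeff (a + a₀) g -
        ∑ x ∈ Finset.HasAntidiagonal.antidiagonal (a + a₀),
          if x.1 ≠ a₀ ∧ wt x.2 < wt a then
            D.coeff x.1 • MvPowerSeries.coeff x.2 (divSeries D a₀ wt g) else 0) := by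
  change divCoeff D a₀ wt g a = _
  rw [divCoeff]
  simp only [dite_eq_ite]
  rfl

theorem divSeries_sub (g h : MvPowerSeries σ R) :
    divSeries D a₀ wt (g - h) = divSeries D a₀ wt g - divSeries D a₀ wt h := by
  ext a
  induction hw : wt a using Nat.strong_induction_on generalizing a with
  | _ w ih =>
    rw [map_sub, coeff_divSeries, coeff_divSeries, coeff_divSeries, ← smul_sub, map_sub,
      sub_sub_sub_comm, ← Finset.sum_sub_distrib]
    congr 2
    refine Finset.sum_congr rfl fun x _ => ?_
    split_ifs with hx
    · rw [ih _ (hw ▸ hx.2) _ rfl, map_sub, smul_sub]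
    · simp

theorem map_divSeries {R' : Type*} [CommRing R'] [Algebra ℂ R'] (φ : R →ₐ[ℂ] R')
    (g : MvPowerSeries σ R) :
    MvPowerSeries.map (φ : R →+* R') (divSeries D a₀ wt g) =
      divSeries D a₀ wt (MvPowerSeries.map (φ : R →+* R') g) := by
  ext a
  induction hw : wt a using Nat.strong_induction_on generalizing a with
  | _ w ih =>
    rw [MvPowerSeries.coeff_map, coeff_divSeries, coeff_divSeries, MvPowerSeries.coeff_map]
    simp only [RingHom.coe_coe, map_smul, map_sub, map_sum]
    congr 2
    refine Finset.sum_congr rfl fun x _ => ?_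
    split_ifs with hx
    · rw [← ih _ (hw ▸ hx.2) _ rfl, MvPowerSeries.coeff_map, map_smul]
      rfl
    · simp

/-- The monomial `a₀` occurs in `D`, and every other monomial of `D` has larger weight. -/
structure IsDominant (D : MvPolynomial σ ℂ) (a₀ : σ →₀ ℕ) (wt : (σ →₀ ℕ) →+ ℕ) : Prop where
  coeff_ne : D.coeff a₀ ≠ 0
  lt : ∀ u, u ≠ a₀ → D.coeff u ≠ 0 → wt a₀ < wt u

theorem IsDominant.lt_of_antidiagonal (h : IsDominant D a₀ wt) {a : σ →₀ ℕ}
    {x : (σ →₀ ℕ) × (σ →₀ ℕ)} (hx : x ∈ Finset.HasAntidiagonal.antidiagonal (a + a₀))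
    (hx1 : x.1 ≠ a₀) (hD : D.coeff x.1 ≠ 0) : wt x.2 < wt a := by
  have h1 := h.lt _ hx1 hD
  have h2 := congrArg wt (Finset.HasAntidiagonal.mem_antidiagonal.1 hx)
  rw [map_add, map_add] at h2
  omega

/-- Division by `D` is a left inverse of multiplication by `D`. -/
theorem divSeries_mul (h : IsDominant D a₀ wt) (p : MvPowerSeries σ R) :
    divSeries D a₀ wt (liftPoly R D * p) = p := by
  ext a
  induction hw : wt a using Nat.strong_induction_on generalizing a with
  | _ w ih =>
    have hmem : (a₀, a) ∈ Finset.HasAntidiagonal.antidiagonal (a + a₀) := by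
      simp [add_comm]
    have e : ∑ x ∈ Finset.HasAntidiagonal.antidiagonal (a + a₀),
        (if x.1 ≠ a₀ ∧ wt x.2 < wt a then D.coeff x.1 • MvPowerSeries.coeff x.2
          (divSeries D a₀ wt (liftPoly R D * p)) else 0) =
        ∑ x ∈ (Finset.HasAntidiagonal.antidiagonal (a + a₀)).erase (a₀, a),
          D.coeff x.1 • MvPowerSeries.coeff x.2 p := by
      rw [← Finset.add_sum_erase _ _ hmem, if_neg (by simp), zero_add]
      refine Finset.sum_congr rfl fun x hx => ?_
      rw [Finset.mem_erase] at hx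
      have hx1 : x.1 ≠ a₀ := by
        intro h1
        apply hx.1
        have h2 := Finset.HasAntidiagonal.mem_antidiagonal.1 hx.2
        rw [h1, add_comm, add_right_cancel_iff] at h2
        exact Prod.ext h1 h2
      by_cases hD : D.coeff x.1 = 0
      · simp [hD]
      · have hlt := h.lt_of_antidiagonal hx.2 hx1 hD
        rw [if_pos ⟨hx1, hlt⟩, ih _ (hw ▸ hlt) _ rfl]
    rw [coeff_divSeries, e, MvPowerSeries.coeff_mul, ← Finset.add_sum_erase _ _ hmem]
    simp only [coeff_liftPoly, ← Algebra.smul_def]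
    rw [add_sub_cancel_right, smul_smul, inv_mul_cancel₀ h.coeff_ne, one_smul]

/-- Division by a homogeneous polynomial of degree `d` lowers the order by at most `d`, whether or not
the division is exact. -/
theorem divSeries_mem_ordIdeal {d : ℕ} (hD : D.IsHomogeneous d) (h : IsDominant D a₀ wt)
    {k : ℕ} {g : MvPowerSeries σ R} (hg : g ∈ ordIdeal σ R (d + k)) :
    divSeries D a₀ wt g ∈ ordIdeal σ R k := by
  rw [mem_ordIdeal] at *
  have hdeg : ∀ u, D.coeff u ≠ 0 → u.degree = d := fun u hu => by
    by_contra hne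
    exact hu (hD.coeff_eq_zero hne)
  have ha₀ := hdeg a₀ h.coeff_ne
  intro a ha
  induction hw : wt a using Nat.strong_induction_on generalizing a with
  | _ w ih =>
    rw [coeff_divSeries, hg _ (by rw [map_add]; omega), Finset.sum_eq_zero, sub_zero, smul_zero]
    intro x hx
    split_ifs with hx1
    · by_cases hD0 : D.coeff x.1 = 0
      · rw [hD0, zero_smul]
      · have h2 := congrArg Finsupp.degree (Finset.HasAntidiagonal.mem_antidiagonal.1 hx)
        rw [map_add, map_add, hdeg _ hD0, ha₀] at h2
        rw [ih _ (hw ▸ hx1.2) _ (by omega) rfl, smul_zero]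
    · rfl

/-- The norm of the quotient, at a polyradius for which the monomial `a₀` carries most of the norm
of `D`. -/
theorem wnorm_divSeries_le [Fintype σ] (h : IsDominant D a₀ wt) {ν : R → ℝ≥0∞} (hν : IsAlgNorm ν)
    {τ : σ → ℝ≥0∞}
    (hdom : 2 * ∑ u ∈ D.support.erase a₀, ‖D.coeff u‖ₑ * mpow τ u ≤ ‖D.coeff a₀‖ₑ * mpow τ a₀)
    (g : MvPowerSeries σ R) :
    ‖D.coeff a₀‖ₑ * mpow τ a₀ * wnorm ν τ (divSeries D a₀ wt g) ≤ 2 * wnorm ν τ g := by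
  set κ := ‖D.coeff a₀‖ₑ * mpow τ a₀ with hκ
  set p := divSeries D a₀ wt g with hp
  set F : ℕ → (σ →₀ ℕ) → ℝ≥0∞ := fun w a =>
    if wt a < w then ν (MvPowerSeries.coeff a p) * mpow τ a else 0 with hF
  set E : (σ →₀ ℕ) → ℝ≥0∞ := fun u => if u = a₀ then 0 else ‖D.coeff u‖ₑ * mpow τ u with hE
  have hEsum : 2 * ∑' u, E u ≤ κ := by
    refine le_trans (le_of_eq ?_) hdom
    congr 1
    rw [tsum_eq_sum (s := D.support.erase a₀)]
    · refine Finset.sum_congr rfl fun u hu => ?_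
      simp [hE, (Finset.mem_erase.1 hu).1]
    · intro u hu
      by_cases hu0 : u = a₀
      · simp [hE, hu0]
      · have : D.coeff u = 0 := by
          by_contra hne
          exact hu (Finset.mem_erase.2 ⟨hu0, MvPolynomial.mem_support_iff.2 hne⟩)
        simp [hE, this]
  -- the bound for the terms of weight less than `w`, by induction on `w`
  have main : ∀ w, κ * ∑' a, F w a ≤ 2 * wnorm ν τ g := by
    intro w
    induction w with
    | zero => simp [hF]
    | succ w ih =>
      have hpt : ∀ a, κ * F (w + 1) a ≤
          ν (MvPowerSeries.coeff (a + a₀) g) * mpow τ (a + a₀) +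
          ∑ x ∈ Finset.HasAntidiagonal.antidiagonal (a + a₀), E x.1 * F w x.2 := by
        intro a
        simp only [hF]
        split_ifs with haw
        swap
        · simp
        have hstep : ‖D.coeff a₀‖ₑ * ν (MvPowerSeries.coeff a p) ≤
            ν (MvPowerSeries.coeff (a + a₀) g) +
            ∑ x ∈ Finset.HasAntidiagonal.antidiagonal (a + a₀),
              if x.1 ≠ a₀ ∧ wt x.2 < wt a then
                ‖D.coeff x.1‖ₑ * ν (MvPowerSeries.coeff x.2 p) else 0 := by
          rw [hp, coeff_divSeries, ← hp]
          refine (mul_le_mul_right (hν.smul_le _ _) _).trans ?_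
          rw [← mul_assoc, ← enorm_mul, mul_inv_cancel₀ h.coeff_ne, enorm_one, one_mul]
          refine (hν.sub_le _ _).trans (add_le_add_right ((hν.sum_le _ _).trans
            (Finset.sum_le_sum fun x _ => ?_)) _)
          split_ifs
          · exact hν.smul_le _ _
          · rw [hν.map_zero]
        calc κ * (ν (MvPowerSeries.coeff a p) * mpow τ a)
            = ‖D.coeff a₀‖ₑ * ν (MvPowerSeries.coeff a p) * mpow τ (a + a₀) := by
              rw [hκ, mpow_add]; ring
          _ ≤ _ := mul_le_mul_left hstep _
          _ ≤ _ := by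
              rw [add_mul, Finset.sum_mul]
              refine add_le_add_right (Finset.sum_le_sum fun x hx => ?_) _
              split_ifs with hx1 hx2
              · rw [← Finset.HasAntidiagonal.mem_antidiagonal.1 hx, mpow_add]
                simp only [hE, if_neg hx1.1]
                exact le_of_eq (by ring)
              · exact absurd (hx1.2.trans_le (Nat.lt_succ_iff.1 haw)) hx2
              · rw [zero_mul]; exact zero_le
              · rw [zero_mul]; exact zero_le
      have hinj : Function.Injective fun a : σ →₀ ℕ => a + a₀ := add_left_injective a₀
      have h1 : ∑' a, ν (MvPowerSeries.coeff (a + a₀) g) * mpow τ (a + a₀) ≤ wnorm ν τ g :=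
        ENNReal.tsum_comp_le_tsum_of_injective hinj
          (fun a => ν (MvPowerSeries.coeff a g) * mpow τ a)
      have h2 : ∑' a, ∑ x ∈ Finset.HasAntidiagonal.antidiagonal (a + a₀), E x.1 * F w x.2 ≤
          (∑' u, E u) * ∑' a, F w a := by
        rw [← tsum_antidiagonal_eq_mul]
        exact ENNReal.tsum_comp_le_tsum_of_injective hinj
          (fun a => ∑ x ∈ Finset.HasAntidiagonal.antidiagonal a, E x.1 * F w x.2)
      have h3 : 2 * ((∑' u, E u) * ∑' a, F w a) ≤ 2 * wnorm ν τ g := by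
        rw [← mul_assoc]
        exact (mul_le_mul_left hEsum _).trans ih
      have h4 : (∑' u, E u) * ∑' a, F w a ≤ wnorm ν τ g := by
        have := ENNReal.mul_le_mul_iff_right (a := 2) (by simp) (by simp) |>.1 h3
        exact this
      calc κ * ∑' a, F (w + 1) a = ∑' a, κ * F (w + 1) a := ENNReal.tsum_mul_left.symm
        _ ≤ ∑' a, (ν (MvPowerSeries.coeff (a + a₀) g) * mpow τ (a + a₀) +
            ∑ x ∈ Finset.HasAntidiagonal.antidiagonal (a + a₀), E x.1 * F w x.2) :=
            ENNReal.tsum_le_tsum hpt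
        _ ≤ wnorm ν τ g + wnorm ν τ g := by
            rw [ENNReal.tsum_add]
            exact add_le_add h1 (h2.trans h4)
        _ = 2 * wnorm ν τ g := (two_mul _).symm
  rw [wnorm, ← ENNReal.tsum_mul_left, ENNReal.tsum_eq_iSup_sum]
  refine iSup_le fun s => ?_
  refine le_trans ?_ (main (s.sup wt + 1))
  rw [← ENNReal.tsum_mul_left]
  refine le_trans (Finset.sum_le_sum fun a ha => ?_) (ENNReal.sum_le_tsum s)
  simp only [hF]
  rw [if_pos (Nat.lt_succ_iff.2 (Finset.le_sup (f := wt) ha))]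

/-- A nonzero polynomial has a dominant monomial for some positive weights on the variables: take
weights `1, N, N², …` with `N` larger than all exponents, so that different monomials have different
weights. -/
theorem exists_isDominant {n : ℕ} {D : MvPolynomial (Fin n) ℂ} (hD : D ≠ 0) :
    ∃ (a₀ : Fin n →₀ ℕ) (θ : Fin n → ℕ), IsDominant D a₀ (Finsupp.weight θ) := by
  set N := D.totalDegree + 1 with hN
  set θ : Fin n → ℕ := fun i => N ^ (i : ℕ) with hθ
  have hw : ∀ a : Fin n →₀ ℕ, Finsupp.weight θ a = ∑ i, a i * N ^ (i : ℕ) := fun a => by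
    rw [Finsupp.weight_apply, Finsupp.sum_fintype] <;> simp [hθ]
  have hlt : ∀ a ∈ D.support, ∀ i, a i < N := fun a ha i => by
    have h1 : a.degree ≤ D.totalDegree := by
      simpa [Finsupp.degree_apply, Finsupp.sum] using MvPolynomial.le_totalDegree ha
    exact Nat.lt_succ_iff.2 ((Finsupp.le_degree i a).trans h1)
  have hinj : Set.InjOn (Finsupp.weight θ) (D.support : Set (Fin n →₀ ℕ)) := by
    intro a ha b hb hab
    have hab : Finsupp.weight θ a = Finsupp.weight θ b := hab
    rw [hw, hw] at hab
    have h1 : (fun i => (⟨a i, hlt a ha i⟩ : Fin N)) = fun i => ⟨b i, hlt b hb i⟩ := by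
      apply finFunctionFinEquiv.injective
      apply Fin.ext
      simpa [finFunctionFinEquiv_apply] using hab
    ext i
    exact congrArg Fin.val (congrFun h1 i)
  obtain ⟨a₀, ha₀, hmin⟩ := D.support.exists_min_image (Finsupp.weight θ)
    (MvPolynomial.support_nonempty.2 hD)
  refine ⟨a₀, θ, MvPolynomial.mem_support_iff.1 ha₀, fun u hu hDu => ?_⟩
  have hmem := MvPolynomial.mem_support_iff.2 hDu
  exact lt_of_le_of_ne (hmin u hmem) fun h => hu (hinj hmem ha₀ h.symm)

end Division

/-! ### Recursive solution of a system with independent leading forms -/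

section Order

variable {σ R : Type*} [Fintype σ] [CommRing R] [Algebra ℂ R]

/-- The Taylor remainder `p(X + G + h) - p(X + G) - p'(X) h`, in which the linear term is taken at
`X` and not at `X + G`. -/
def taylorRem (G h : σ → MvPowerSeries σ R) : MvPolynomial σ ℂ →ₗ[ℂ] MvPowerSeries σ R :=
  (MvPolynomial.aeval (fun i => MvPowerSeries.X i + G i + h i)).toLinearMap -
    (MvPolynomial.aeval (fun i => MvPowerSeries.X i + G i)).toLinearMap -
    ∑ k, (LinearMap.mulRight ℂ (h k)) ∘ₗ
      (MvPolynomial.aeval (MvPowerSeries.X : σ → MvPowerSeries σ R)).toLinearMap ∘ₗ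
        (MvPolynomial.pderiv k).toLinearMap

theorem taylorRem_apply (G h : σ → MvPowerSeries σ R) (p : MvPolynomial σ ℂ) :
    taylorRem G h p = MvPolynomial.aeval (fun i => MvPowerSeries.X i + G i + h i) p -
      MvPolynomial.aeval (fun i => MvPowerSeries.X i + G i) p -
      ∑ k, liftPoly R (MvPolynomial.pderiv k p) * h k := by
  simp [taylorRem, liftPoly, LinearMap.sum_apply]

/-- The case of a monomial `X^a`, proved by induction on the degree together with a bound for
`(X + G)^a - X^a`. -/
theorem taylorRem_monomial_mem {G h : σ → MvPowerSeries σ R} {M : ℕ} (hG : ∀ i, G i ∈ ordIdeal σ R 2)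
    (hh2 : ∀ i, h i ∈ ordIdeal σ R 2)
    (hh : ∀ i, h i ∈ ordIdeal σ R M) (m : ℕ) (a : σ →₀ ℕ) (ha : a.degree = m) :
    taylorRem G h (MvPolynomial.monomial a 1) ∈ ordIdeal σ R (m + M) ∧
      MvPolynomial.aeval (fun i => MvPowerSeries.X i + G i) (MvPolynomial.monomial a (1 : ℂ)) -
        liftPoly R (MvPolynomial.monomial a 1) ∈ ordIdeal σ R (m + 1) := by
  classical
  induction m generalizing a with
  | zero =>
    rw [Finsupp.degree_eq_zero_iff] at ha
    subst ha
    have e : (MvPolynomial.monomial 0 1 : MvPolynomial σ ℂ) = 1 := rfl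
    simp [taylorRem_apply, e, liftPoly]
  | succ m ih =>
    have h0 : a ≠ 0 := by rintro rfl; simp at ha
    obtain ⟨s, hs⟩ := Finsupp.ne_iff.1 h0
    have hle : Finsupp.single s 1 ≤ a := Finsupp.single_le_iff.2 (Nat.one_le_iff_ne_zero.2 hs)
    have hsplit := tsub_add_cancel_of_le hle
    have hdeg : (a - Finsupp.single s 1).degree = m := by
      rw [← hsplit, map_add, Finsupp.degree_single] at ha
      omega
    obtain ⟨ih1, ih2⟩ := ih _ hdeg
    set q : MvPolynomial σ ℂ := MvPolynomial.monomial (a - Finsupp.single s 1) 1 with hq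
    have hqa : (MvPolynomial.monomial a 1 : MvPolynomial σ ℂ) = q * MvPolynomial.X s := by
      rw [hq, ← hsplit, MvPolynomial.monomial_add_single, hsplit, pow_one]
    have hqO : (q : MvPowerSeries σ ℂ) ∈ ordIdeal σ ℂ m :=
      coe_mem_ordIdeal (MvPolynomial.isHomogeneous_monomial _ hdeg)
    have hX : ∀ i, (MvPowerSeries.X i + G i : MvPowerSeries σ R) ∈ ordIdeal σ R 1 := fun i =>
      add_mem (X_mem_ordIdeal i) (ordIdeal_anti (by norm_num) (hG i))
    set x : σ → MvPowerSeries σ R := fun i => MvPowerSeries.X i with hx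
    rw [hqa]
    set dq := ∑ k, liftPoly R (MvPolynomial.pderiv k q) * h k with hdq
    have hdqO : ∀ g ∈ ordIdeal σ R 2, g * dq ∈ ordIdeal σ R (m + 1 + M) := by
      intro g hg
      rw [hdq, Finset.mul_sum]
      refine sum_mem fun k _ => ?_
      rcases Nat.eq_zero_or_pos m with rfl | hm
      · rw [Finsupp.degree_eq_zero_iff] at hdeg
        have : MvPolynomial.pderiv k q = 0 := by
          rw [hq, hdeg]
          exact MvPolynomial.pderiv_C
        simp [this, liftPoly]
      · have h1 := pderiv_mem_ordIdeal hqO k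
        rw [MvPowerSeries.pderiv_coe] at h1
        have h2 := mul_mem_ordIdeal hg (mul_mem_ordIdeal (liftPoly_mem_ordIdeal (R := R) h1) (hh k))
        exact ordIdeal_anti (by omega) h2
    constructor
    · have e1 : ∑ k, liftPoly R (MvPolynomial.pderiv k (q * MvPolynomial.X s)) * h k =
          liftPoly R q * h s + MvPowerSeries.X s * dq := by
        simp only [liftPoly, Derivation.leibniz, MvPolynomial.pderiv_X, map_add, smul_eq_mul,
          map_mul, add_mul, Finset.sum_add_distrib, MvPolynomial.aeval_X, hdq, Finset.mul_sum]
        congr 1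
        · simp [Pi.single_apply]
        · exact Finset.sum_congr rfl fun k _ => by ring
      have e2 : taylorRem G h (q * MvPolynomial.X s) =
          (MvPowerSeries.X s + G s + h s) * taylorRem G h q + G s * dq + h s * dq +
          h s * (MvPolynomial.aeval (fun i => MvPowerSeries.X i + G i) q - liftPoly R q) := by
        rw [taylorRem_apply, taylorRem_apply, e1, ← hdq]
        simp only [map_mul, MvPolynomial.aeval_X]
        ring
      rw [e2]
      refine add_mem (add_mem (add_mem ?_ (hdqO _ (hG s))) (hdqO _ (hh2 s))) ?_
      · have := mul_mem_ordIdeal (add_mem (hX s) (ordIdeal_anti (by norm_num) (hh2 s))) ih1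
        exact ordIdeal_anti (by omega) this
      · exact ordIdeal_anti (by omega) (mul_mem_ordIdeal (hh s) ih2)
    · have e : MvPolynomial.aeval (fun i => MvPowerSeries.X i + G i) (q * MvPolynomial.X s) -
          liftPoly R (q * MvPolynomial.X s) =
          (MvPolynomial.aeval (fun i => MvPowerSeries.X i + G i) q - liftPoly R q) *
            (MvPowerSeries.X s + G s) + liftPoly R q * G s := by
        simp only [liftPoly, map_mul, MvPolynomial.aeval_X]
        ring
      rw [e]
      refine add_mem (mul_mem_ordIdeal ih2 (hX s)) ?_
      exact ordIdeal_anti (by omega) (mul_mem_ordIdeal (liftPoly_mem_ordIdeal (R := R) hqO) (hG s))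

/-- The Taylor remainder of a polynomial of order `m` has order `m + M` if the increment has order
`M ≥ 2`. -/
theorem taylorRem_mem {G h : σ → MvPowerSeries σ R} {M : ℕ} (hG : ∀ i, G i ∈ ordIdeal σ R 2)
    (hh2 : ∀ i, h i ∈ ordIdeal σ R 2) (hh : ∀ i, h i ∈ ordIdeal σ R M) {m : ℕ}
    {p : MvPolynomial σ ℂ} (hp : (p : MvPowerSeries σ ℂ) ∈ ordIdeal σ ℂ m) :
    taylorRem G h p ∈ ordIdeal σ R (m + M) := by
  rw [p.as_sum, map_sum]
  refine sum_mem fun a ha => ?_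
  have hm : m ≤ a.degree := by
    by_contra hlt
    have := mem_ordIdeal.1 hp a (not_le.1 hlt)
    rw [MvPolynomial.coeff_coe] at this
    exact MvPolynomial.mem_support_iff.1 ha this
  have : (MvPolynomial.monomial a (p.coeff a) : MvPolynomial σ ℂ) =
      p.coeff a • MvPolynomial.monomial a 1 := by
    rw [MvPolynomial.smul_monomial, smul_eq_mul, mul_one]
  rw [this, map_smul, Algebra.smul_def]
  exact Ideal.mul_mem_left _ _ (ordIdeal_anti (by omega)
    (taylorRem_monomial_mem hG hh2 hh _ a rfl).1)

end Order

section Cut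

variable {σ R : Type*} [CommRing R]

/-- The terms of degree greater than `m` of a power series. -/
def cut (m : ℕ) (f : MvPowerSeries σ R) : MvPowerSeries σ R :=
  fun a => if m < a.degree then MvPowerSeries.coeff a f else 0

theorem coeff_cut (m : ℕ) (f : MvPowerSeries σ R) (a : σ →₀ ℕ) :
    MvPowerSeries.coeff a (cut m f) = if m < a.degree then MvPowerSeries.coeff a f else 0 := rfl

theorem cut_sub (m : ℕ) (f g : MvPowerSeries σ R) : cut m (f - g) = cut m f - cut m g := by
  ext a
  simp only [coeff_cut, map_sub]
  split_ifs <;> simp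

theorem cut_mem_ordIdeal (m : ℕ) (f : MvPowerSeries σ R) : cut m f ∈ ordIdeal σ R (m + 1) := by
  rw [mem_ordIdeal]
  intro a ha
  rw [coeff_cut, if_neg (by omega)]

theorem cut_mem_ordIdeal_of_mem {m k : ℕ} {f : MvPowerSeries σ R} (hf : f ∈ ordIdeal σ R k) :
    cut m f ∈ ordIdeal σ R k := by
  rw [mem_ordIdeal] at *
  intro a ha
  rw [coeff_cut, hf a ha, ite_self]

theorem cut_eq_self {m : ℕ} {f : MvPowerSeries σ R} (hf : f ∈ ordIdeal σ R (m + 1)) :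
    cut m f = f := by
  ext a
  rw [coeff_cut]
  split_ifs with h
  · rfl
  · rw [mem_ordIdeal.1 hf a (by omega)]

theorem map_cut {R' : Type*} [CommRing R'] (φ : R →+* R') (m : ℕ) (f : MvPowerSeries σ R) :
    MvPowerSeries.map φ (cut m f) = cut m (MvPowerSeries.map φ f) := by
  ext a
  simp only [MvPowerSeries.coeff_map, coeff_cut]
  split_ifs <;> simp

theorem X_add_mem {G : σ → MvPowerSeries σ R} (hG : ∀ i, G i ∈ ordIdeal σ R 2) (i : σ) :
    MvPowerSeries.X i + G i ∈ ordIdeal σ R 1 :=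
  add_mem (X_mem_ordIdeal i) (ordIdeal_anti (by norm_num) (hG i))

end Cut

/-- A system of `n` power series in `n` variables whose leading forms `fⱼ`, of degrees `eⱼ + 1`,
have nonvanishing Jacobian determinant. -/
structure LeadingSystem (n : ℕ) where
  /-- The components of the system. -/
  B : Fin n → MvPowerSeries (Fin n) ℂ
  /-- The leading forms. -/
  f : Fin n → MvPolynomial (Fin n) ℂ
  /-- The degrees of the leading forms, less one. -/
  e : Fin n → ℕ
  isHomogeneous : ∀ j, (f j).IsHomogeneous (e j + 1)
  sub_leading_mem : ∀ j, B j - f j ∈ ordIdeal (Fin n) ℂ (e j + 2)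
  det_ne_zero : (Matrix.of fun j k => MvPolynomial.pderiv k (f j)).det ≠ 0

namespace LeadingSystem

variable {n : ℕ} (S : LeadingSystem n)

/-- The Jacobian matrix of the leading forms. -/
def jacF : Matrix (Fin n) (Fin n) (MvPolynomial (Fin n) ℂ) :=
  Matrix.of fun j k => MvPolynomial.pderiv k (S.f j)

/-- The Jacobian determinant of the leading forms. -/
def D : MvPolynomial (Fin n) ℂ := S.jacF.det

/-- The degree of the Jacobian determinant of the leading forms. -/
def d : ℕ := ∑ j, S.e j

theorem e_le_d (j : Fin n) : S.e j ≤ S.d :=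
  Finset.single_le_sum (f := S.e) (fun _ _ => Nat.zero_le _) (Finset.mem_univ j)

theorem pderiv_isHomogeneous (j k : Fin n) :
    (MvPolynomial.pderiv k (S.f j)).IsHomogeneous (S.e j) := by
  simpa using (S.isHomogeneous j).pderiv (i := k)

theorem D_isHomogeneous : S.D.IsHomogeneous S.d := by
  rw [D, ← Matrix.det_transpose, Matrix.det_apply]
  refine MvPolynomial.IsHomogeneous.sum _ _ _ fun τ _ => ?_
  have h : (∏ i, S.jacF.transpose (τ i) i).IsHomogeneous S.d :=
    MvPolynomial.IsHomogeneous.prod _ _ _ fun i _ => S.pderiv_isHomogeneous _ _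
  rw [Units.smul_def, zsmul_eq_mul]
  have h2 := (MvPolynomial.isHomogeneous_C (Fin n)
    (((Equiv.Perm.sign τ : ℤˣ) : ℤ) : ℂ)).mul h
  rw [zero_add] at h2
  simpa using h2

/-- The entry `(k, j)` of the adjugate of the Jacobian matrix has order at least `d - eⱼ`. -/
theorem adjugate_mem (k j : Fin n) {r : ℕ} (hr : r + S.e j = S.d) :
    ((S.jacF.adjugate k j : MvPolynomial (Fin n) ℂ) : MvPowerSeries (Fin n) ℂ) ∈
      ordIdeal (Fin n) ℂ r := by
  have hc : ((S.jacF.adjugate k j : MvPolynomial (Fin n) ℂ) : MvPowerSeries (Fin n) ℂ) =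
      (((S.jacF.updateRow j (Pi.single k 1)).map
        (MvPolynomial.coeToMvPowerSeries.ringHom (σ := Fin n) (R := ℂ)))).det := by
    rw [Matrix.adjugate_apply, ← RingHom.mapMatrix_apply, ← RingHom.map_det]
    rfl
  have hsum : ∑ i, Function.update S.e j 0 i = r := by
    rw [Finset.sum_update_of_mem (Finset.mem_univ j), zero_add]
    have := Finset.sum_sdiff (Finset.subset_univ {j}) (f := S.e)
    rw [Finset.sum_singleton] at this
    change _ = S.d at this
    omega
  rw [hc, ← hsum]
  refine det_mem_ordIdeal fun i l => ?_
  by_cases hi : i = j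
  · subst hi
    rw [Function.update_self]
    exact mem_ordIdeal_zero _
  · rw [Function.update_of_ne hi, Matrix.map_apply, Matrix.updateRow_ne hi]
    exact coe_mem_ordIdeal (S.pderiv_isHomogeneous i l)

/-- The dominant monomial of the Jacobian determinant. -/
def a₀ : Fin n →₀ ℕ := (exists_isDominant S.det_ne_zero).choose

/-- Weights of the variables for which the Jacobian determinant has a dominant monomial. -/
def θ : Fin n → ℕ := (exists_isDominant S.det_ne_zero).choose_spec.choose

/-- The weight of a monomial. -/
def wt : (Fin n →₀ ℕ) →+ ℕ := Finsupp.weight S.θ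

theorem isDominant : IsDominant S.D S.a₀ S.wt :=
  (exists_isDominant S.det_ne_zero).choose_spec.choose_spec

section Recursion

variable {R : Type*} [CommRing R] [Algebra ℂ R]

/-- A left inverse of the linear operator `H ↦ f'(X) H`, by Cramer's rule and division by the
Jacobian determinant. -/
def solve (g : Fin n → MvPowerSeries (Fin n) R) (k : Fin n) : MvPowerSeries (Fin n) R :=
  divSeries S.D S.a₀ S.wt (∑ j, liftPoly R (S.jacF.adjugate k j) * g j)

/-- The linear operator `H ↦ f'(X) H`. -/
def linear (H : Fin n → MvPowerSeries (Fin n) R) (j : Fin n) : MvPowerSeries (Fin n) R :=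
  ∑ k, liftPoly R (MvPolynomial.pderiv k (S.f j)) * H k

theorem solve_sub (g g' : Fin n → MvPowerSeries (Fin n) R) (k : Fin n) :
    S.solve (g - g') k = S.solve g k - S.solve g' k := by
  simp only [solve, Pi.sub_apply, mul_sub, Finset.sum_sub_distrib, divSeries_sub]

theorem solve_linear (H : Fin n → MvPowerSeries (Fin n) R) (k : Fin n) :
    S.solve (S.linear H) k = H k := by
  have h : ∑ j, liftPoly R (S.jacF.adjugate k j) * S.linear H j = liftPoly R S.D * H k := by
    simp only [linear, Finset.mul_sum]
    rw [Finset.sum_comm]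
    have e : ∀ l, ∑ j, liftPoly R (S.jacF.adjugate k j) *
        (liftPoly R (MvPolynomial.pderiv l (S.f j)) * H l) =
        liftPoly R ((S.jacF.adjugate * S.jacF) k l) * H l := fun l => by
      rw [Matrix.mul_apply, liftPoly, map_sum, Finset.sum_mul]
      refine Finset.sum_congr rfl fun j _ => ?_
      rw [map_mul, mul_assoc]
      rfl
    simp only [e, Matrix.adjugate_mul, Matrix.smul_apply, Matrix.one_apply]
    rw [Finset.sum_eq_single k]
    · simp [D]
    · intro l _ hl
      simp [Ne.symm hl, liftPoly]
    · simp
  rw [solve, h, divSeries_mul S.isDominant]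

/-- If the components `gⱼ` have order `eⱼ + M`, then the solution of `f'(X) H = g` has order `M`. -/
theorem solve_mem {g : Fin n → MvPowerSeries (Fin n) R} {M : ℕ}
    (hg : ∀ j, g j ∈ ordIdeal (Fin n) R (S.e j + M)) (k : Fin n) :
    S.solve g k ∈ ordIdeal (Fin n) R M := by
  refine divSeries_mem_ordIdeal S.D_isHomogeneous S.isDominant (sum_mem fun j _ => ?_)
  have hle := S.e_le_d j
  have h := mul_mem_ordIdeal (liftPoly_mem_ordIdeal (R := R)
    (S.adjugate_mem k j (Nat.sub_add_cancel hle))) (hg j)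
  exact ordIdeal_anti (by omega) h

/-- The nonlinear part `B(X + G) - f'(X) G`, with `B` replaced by the polynomial of its terms of
degree less than `N`, so that no substitution into power series is needed. -/
def err (N : ℕ) (G : Fin n → MvPowerSeries (Fin n) R) (j : Fin n) : MvPowerSeries (Fin n) R :=
  MvPolynomial.aeval (fun i => MvPowerSeries.X i + G i) (MvPowerSeries.truncTotal N (S.B j)) -
    S.linear G j

/-- One step of the recursion that solves `B(X + H) = c` in degrees above those of the leading
forms. -/
def step (N : ℕ) (c G : Fin n → MvPowerSeries (Fin n) R) (k : Fin n) : MvPowerSeries (Fin n) R :=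
  S.solve (fun j => cut (S.e j + 1) (c j - S.err N G j)) k

/-- The iterates of the recursion, started at `0`. The degree at which `B` is truncated in the step `L`
exceeds that of all terms which determine the solution in degrees up to `L + 2`. -/
def iter (c : Fin n → MvPowerSeries (Fin n) R) : ℕ → Fin n → MvPowerSeries (Fin n) R
  | 0 => 0
  | L + 1 => S.step (L + S.d + 4) c (iter c L)

/-- The formal solution `H` of `B(X + H) = c` (of its projection to degrees above those of the
leading forms, so that it exists for every right-hand side `c`). -/
def sol (c : Fin n → MvPowerSeries (Fin n) R) (k : Fin n) : MvPowerSeries (Fin n) R :=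
  fun a => MvPowerSeries.coeff a (S.iter c a.degree k)

theorem coe_f_mem (j : Fin n) :
    (S.f j : MvPowerSeries (Fin n) ℂ) ∈ ordIdeal (Fin n) ℂ (S.e j + 1) :=
  coe_mem_ordIdeal (S.isHomogeneous j)

theorem truncTotal_sub_mem {N : ℕ} {j : Fin n} (hN : S.e j + 2 ≤ N) :
    ((MvPowerSeries.truncTotal N (S.B j) - S.f j : MvPolynomial (Fin n) ℂ) :
      MvPowerSeries (Fin n) ℂ) ∈ ordIdeal (Fin n) ℂ (S.e j + 2) := by
  rw [mem_ordIdeal]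
  intro a ha
  have h := mem_ordIdeal.1 (S.sub_leading_mem j) a ha
  rw [map_sub, MvPolynomial.coeff_coe] at h
  rw [MvPolynomial.coeff_coe, MvPolynomial.coeff_sub, MvPowerSeries.coeff_truncTotal _ (by omega)]
  exact h

theorem aeval_mem_ordIdeal {G : Fin n → MvPowerSeries (Fin n) R}
    (hG : ∀ i, G i ∈ ordIdeal (Fin n) R 1) {p : MvPolynomial (Fin n) ℂ} {m : ℕ}
    (hp : (p : MvPowerSeries (Fin n) ℂ) ∈ ordIdeal (Fin n) ℂ m) :
    MvPolynomial.aeval G p ∈ ordIdeal (Fin n) R m := by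
  rw [MvPolynomial.aeval_def, MvPolynomial.eval₂_eq']
  refine sum_mem fun a ha => Ideal.mul_mem_left _ _ ?_
  have hm : m ≤ a.degree := by
    by_contra hlt
    have := mem_ordIdeal.1 hp a (not_le.1 hlt)
    rw [MvPolynomial.coeff_coe] at this
    exact MvPolynomial.mem_support_iff.1 ha this
  have h : ∀ i ∈ Finset.univ, G i ^ a i ∈ ordIdeal (Fin n) R (a i) := fun i _ => by
    have := prod_mem_ordIdeal (Finset.range (a i)) (fun _ => 1) (fun _ => G i) fun _ _ => hG i
    simpa using this
  have h2 := prod_mem_ordIdeal _ _ _ h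
  rw [← Finsupp.degree_eq_sum] at h2
  exact ordIdeal_anti hm h2

/-- The nonlinear part raises the order of a difference by more than the linear part does. -/
theorem err_sub_mem {N N' M : ℕ} {j : Fin n} {G G' : Fin n → MvPowerSeries (Fin n) R}
    (hG : ∀ i, G i ∈ ordIdeal (Fin n) R 2) (hG' : ∀ i, G' i ∈ ordIdeal (Fin n) R 2)
    (h : ∀ i, G i - G' i ∈ ordIdeal (Fin n) R M) (h2 : S.e j + 2 ≤ N)
    (hN : S.e j + 1 + M ≤ N) (hN' : S.e j + 1 + M ≤ N') :
    S.err N G j - S.err N' G' j ∈ ordIdeal (Fin n) R (S.e j + 1 + M) := by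
  set p := MvPowerSeries.truncTotal N (S.B j) with hp
  set p' := MvPowerSeries.truncTotal N' (S.B j) with hp'
  have hpf := S.truncTotal_sub_mem h2
  have hpO : (p : MvPowerSeries (Fin n) ℂ) ∈ ordIdeal (Fin n) ℂ (S.e j + 1) := by
    have := add_mem (ordIdeal_anti (Nat.le_succ _) hpf) (S.coe_f_mem j)
    rwa [← MvPolynomial.coe_add, sub_add_cancel] at this
  have hpp : ((p - p' : MvPolynomial (Fin n) ℂ) : MvPowerSeries (Fin n) ℂ) ∈
      ordIdeal (Fin n) ℂ (S.e j + 1 + M) := by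
    rw [mem_ordIdeal]
    intro a ha
    rw [MvPolynomial.coeff_coe, MvPolynomial.coeff_sub, hp, hp',
      MvPowerSeries.coeff_truncTotal _ (by omega), MvPowerSeries.coeff_truncTotal _ (by omega),
      sub_self]
  have e : S.err N G j - S.err N' G' j = taylorRem G' (G - G') p +
      (∑ k, liftPoly R (MvPolynomial.pderiv k (p - S.f j)) * (G k - G' k)) +
      MvPolynomial.aeval (fun i => MvPowerSeries.X i + G' i) (p - p') := by
    have e1 : (fun i => MvPowerSeries.X i + G' i + (G - G') i : Fin n → MvPowerSeries (Fin n) R) =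
        fun i => MvPowerSeries.X i + G i := by
      funext i
      simp
    rw [taylorRem_apply, e1]
    simp only [err, linear, liftPoly, map_sub, sub_mul, mul_sub, Finset.sum_sub_distrib,
      Pi.sub_apply, ← hp, ← hp']
    ring
  rw [e]
  refine add_mem (add_mem ?_ (sum_mem fun k _ => ?_)) ?_
  · exact taylorRem_mem hG' (fun i => sub_mem (hG i) (hG' i)) h hpO
  · have h1 := pderiv_mem_ordIdeal hpf k
    rw [MvPowerSeries.pderiv_coe] at h1
    exact ordIdeal_anti (by omega) (mul_mem_ordIdeal (liftPoly_mem_ordIdeal (R := R) h1) (h k))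
  · exact aeval_mem_ordIdeal (X_add_mem hG') hpp

theorem step_mem (N : ℕ) (c G : Fin n → MvPowerSeries (Fin n) R) (k : Fin n) :
    S.step N c G k ∈ ordIdeal (Fin n) R 2 :=
  S.solve_mem (M := 2) (fun _ => cut_mem_ordIdeal _ _) k

/-- The recursion is a contraction for the order filtration. -/
theorem step_sub_mem {N N' M : ℕ} {c c' G G' : Fin n → MvPowerSeries (Fin n) R}
    (hG : ∀ i, G i ∈ ordIdeal (Fin n) R 2) (hG' : ∀ i, G' i ∈ ordIdeal (Fin n) R 2)
    (h : ∀ i, G i - G' i ∈ ordIdeal (Fin n) R M)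
    (hc : ∀ j, c j - c' j ∈ ordIdeal (Fin n) R (S.e j + 1 + M)) (h2 : S.d + 2 ≤ N)
    (hN : S.d + 1 + M ≤ N) (hN' : S.d + 1 + M ≤ N') (k : Fin n) :
    S.step N c G k - S.step N' c' G' k ∈ ordIdeal (Fin n) R (M + 1) := by
  rw [step, step, ← solve_sub]
  refine S.solve_mem (fun j => ?_) k
  have hj := S.e_le_d j
  rw [Pi.sub_apply, ← cut_sub, sub_sub_sub_comm]
  have h3 := sub_mem (hc j) (S.err_sub_mem (N := N) (N' := N') (j := j) hG hG' h (by omega)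
    (by omega) (by omega))
  exact cut_mem_ordIdeal_of_mem (ordIdeal_anti (by omega) h3)

theorem iter_mem (c : Fin n → MvPowerSeries (Fin n) R) (L : ℕ) (k : Fin n) :
    S.iter c L k ∈ ordIdeal (Fin n) R 2 := by
  cases L with
  | zero => exact zero_mem _
  | succ L => exact S.step_mem _ _ _ k

theorem iter_succ_sub_mem (c : Fin n → MvPowerSeries (Fin n) R) (L : ℕ) (k : Fin n) :
    S.iter c (L + 1) k - S.iter c L k ∈ ordIdeal (Fin n) R (L + 2) := by
  induction L generalizing k with
  | zero => exact sub_mem (S.iter_mem c _ k) (S.iter_mem c _ k)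
  | succ L ih =>
    refine S.step_sub_mem (M := L + 2) (S.iter_mem c _) (S.iter_mem c _) ih (fun j => ?_)
      (by omega) (by omega) (by omega) k
    rw [sub_self]
    exact zero_mem _

theorem iter_sub_mem (c : Fin n → MvPowerSeries (Fin n) R) {L L' : ℕ} (h : L ≤ L') (k : Fin n) :
    S.iter c L' k - S.iter c L k ∈ ordIdeal (Fin n) R (L + 2) := by
  induction L', h using Nat.le_induction with
  | base => rw [sub_self]; exact zero_mem _
  | succ L' h ih =>
    have := add_mem (ordIdeal_anti (by omega) (S.iter_succ_sub_mem c L' k)) ih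
    rwa [sub_add_sub_cancel] at this

/-- The coefficients of the solution in degree at most `L + 1` are those of the `L`-th iterate. -/
theorem sol_sub_iter_mem (c : Fin n → MvPowerSeries (Fin n) R) (L : ℕ) (k : Fin n) :
    S.sol c k - S.iter c L k ∈ ordIdeal (Fin n) R (L + 2) := by
  rw [mem_ordIdeal]
  intro a ha
  have e : MvPowerSeries.coeff a (S.sol c k) = MvPowerSeries.coeff a (S.iter c a.degree k) := rfl
  rw [map_sub, e, ← map_sub]
  rcases le_total L a.degree with h | h
  · exact mem_ordIdeal.1 (S.iter_sub_mem c h k) a ha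
  · rw [← neg_sub, map_neg, mem_ordIdeal.1 (S.iter_sub_mem c h k) a (by omega), neg_zero]

theorem sol_mem (c : Fin n → MvPowerSeries (Fin n) R) (k : Fin n) :
    S.sol c k ∈ ordIdeal (Fin n) R 2 := by
  have := add_mem (S.sol_sub_iter_mem c 0 k) (S.iter_mem c 0 k)
  rwa [sub_add_cancel] at this

/-- The coefficients of the solution up to degree `K` depend only on those of the right-hand side
up to degree `d + K`. -/
theorem sol_sub_sol_mem {c c' : Fin n → MvPowerSeries (Fin n) R} {K : ℕ}
    (h : ∀ j, c j - c' j ∈ ordIdeal (Fin n) R (S.d + 1 + K)) (k : Fin n) :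
    S.sol c k - S.sol c' k ∈ ordIdeal (Fin n) R (K + 1) := by
  have key : ∀ L ≤ K, ∀ k, S.iter c L k - S.iter c' L k ∈ ordIdeal (Fin n) R (L + 1) := by
    intro L
    induction L with
    | zero => exact fun _ k => by simp [iter]
    | succ L ih =>
      intro hL k
      refine S.step_sub_mem (M := L + 1) (S.iter_mem c L) (S.iter_mem c' L) (ih (by omega))
        (fun j => ordIdeal_anti ?_ (h j)) (by omega) (by omega) (by omega) k
      have := S.e_le_d j
      omega
  have h1 : S.sol c k - S.iter c K k ∈ ordIdeal (Fin n) R (K + 1) :=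
    ordIdeal_anti (by omega) (S.sol_sub_iter_mem c K k)
  have h2 : S.sol c' k - S.iter c' K k ∈ ordIdeal (Fin n) R (K + 1) :=
    ordIdeal_anti (by omega) (S.sol_sub_iter_mem c' K k)
  convert add_mem (sub_mem h1 h2) (key K le_rfl k) using 1
  ring

/-- Every solution of `B(X + H) = c` tangent to the identity is the one found by the recursion. -/
theorem eq_sol {c H : Fin n → MvPowerSeries (Fin n) R} (hH : ∀ k, H k ∈ ordIdeal (Fin n) R 2)
    (h : ∀ j N, c j - MvPolynomial.aeval (fun i => MvPowerSeries.X i + H i)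
      (MvPowerSeries.truncTotal N (S.B j)) ∈ ordIdeal (Fin n) R N) : H = S.sol c := by
  have hfix : ∀ L k, H k - S.step (L + S.d + 4) c H k ∈ ordIdeal (Fin n) R (L + 3) := by
    intro L k
    have e0 : H k - S.step (L + S.d + 4) c H k = S.solve (S.linear H - fun j =>
        cut (S.e j + 1) (c j - S.err (L + S.d + 4) H j)) k := by
      rw [solve_sub, solve_linear]
      rfl
    rw [e0]
    refine S.solve_mem (fun j => ?_) k
    have hj := S.e_le_d j
    have hlin : S.linear H j ∈ ordIdeal (Fin n) R (S.e j + 1 + 1) := sum_mem fun k _ =>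
      ordIdeal_anti (by omega) (mul_mem_ordIdeal (liftPoly_mem_ordIdeal (R := R)
        (coe_mem_ordIdeal (S.pderiv_isHomogeneous j k))) (hH k))
    rw [Pi.sub_apply]
    nth_rewrite 1 [← cut_eq_self hlin]
    rw [← cut_sub]
    refine cut_mem_ordIdeal_of_mem ?_
    have e : S.linear H j - (c j - S.err (L + S.d + 4) H j) =
        -(c j - MvPolynomial.aeval (fun i => MvPowerSeries.X i + H i)
          (MvPowerSeries.truncTotal (L + S.d + 4) (S.B j))) := by
      rw [err]
      ring
    rw [e]
    exact neg_mem (ordIdeal_anti (by omega) (h j (L + S.d + 4)))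
  have key : ∀ L k, H k - S.iter c L k ∈ ordIdeal (Fin n) R (L + 2) := by
    intro L
    induction L with
    | zero => exact fun k => by simpa [iter] using hH k
    | succ L ih =>
      intro k
      have h1 := S.step_sub_mem (N := L + S.d + 4) (N' := L + S.d + 4) (M := L + 2) (c := c)
        (c' := c) hH (S.iter_mem c L) ih (fun j => by rw [sub_self]; exact zero_mem _)
        (by omega) (by omega) (by omega) k
      have := add_mem (hfix L k) h1
      rwa [sub_add_sub_cancel] at this
  funext k
  rw [← sub_eq_zero]
  ext a
  have h1 := sub_mem (key a.degree k) (S.sol_sub_iter_mem c a.degree k)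
  rw [sub_sub_sub_cancel_right] at h1
  exact mem_ordIdeal.1 h1 a (by omega)

theorem map_solve {R' : Type*} [CommRing R'] [Algebra ℂ R'] (φ : R →ₐ[ℂ] R')
    (g : Fin n → MvPowerSeries (Fin n) R) (k : Fin n) :
    MvPowerSeries.map (φ : R →+* R') (S.solve g k) =
      S.solve (fun j => MvPowerSeries.map (φ : R →+* R') (g j)) k := by
  simp only [solve, map_divSeries, map_sum, map_mul, map_liftPoly]

theorem map_aeval_series {R' : Type*} [CommRing R'] [Algebra ℂ R'] (φ : R →ₐ[ℂ] R')
    (g : Fin n → MvPowerSeries (Fin n) R) (p : MvPolynomial (Fin n) ℂ) :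
    MvPowerSeries.map (φ : R →+* R') (MvPolynomial.aeval g p) =
      MvPolynomial.aeval (fun i => MvPowerSeries.map (φ : R →+* R') (g i)) p := by
  induction p using MvPolynomial.induction_on with
  | C a => simp [MvPowerSeries.algebraMap_apply]
  | add p q hp hq => simp [hp, hq]
  | mul_X p i hp => simp [hp]

/-- The recursion commutes with extension of scalars. -/
theorem map_iter {R' : Type*} [CommRing R'] [Algebra ℂ R'] (φ : R →ₐ[ℂ] R')
    (c : Fin n → MvPowerSeries (Fin n) R) (L : ℕ) (k : Fin n) :
    MvPowerSeries.map (φ : R →+* R') (S.iter c L k) =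
      S.iter (fun j => MvPowerSeries.map (φ : R →+* R') (c j)) L k := by
  induction L generalizing k with
  | zero => simp [iter]
  | succ L ih =>
    simp only [iter, step, map_solve, map_cut, map_sub, err, map_aeval_series, map_add,
      MvPowerSeries.map_X, linear, map_sum, map_mul, map_liftPoly, ih]

/-- The solution is natural in the coefficient algebra. -/
theorem map_sol {R' : Type*} [CommRing R'] [Algebra ℂ R'] (φ : R →ₐ[ℂ] R')
    (c : Fin n → MvPowerSeries (Fin n) R) (k : Fin n) :
    MvPowerSeries.map (φ : R →+* R') (S.sol c k) =
      S.sol (fun j => MvPowerSeries.map (φ : R →+* R') (c j)) k := by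
  ext a
  change _ = MvPowerSeries.coeff a (S.iter _ a.degree k)
  rw [← map_iter, MvPowerSeries.coeff_map, MvPowerSeries.coeff_map]
  rfl

end Recursion

end LeadingSystem

/-! ### Convergence of the recursion -/

section Aux

variable {σ R : Type*} [CommRing R]

theorem aeval_smul_of_isHomogeneous [Algebra ℂ R] {p : MvPolynomial σ ℂ} {m : ℕ}
    (hp : p.IsHomogeneous m) (z : ℂ) (y : σ → R) :
    MvPolynomial.aeval (z • y) p = z ^ m • MvPolynomial.aeval y p := by
  rw [MvPolynomial.aeval_def, MvPolynomial.aeval_def, MvPolynomial.eval₂_eq,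
    MvPolynomial.eval₂_eq, Finset.smul_sum]
  refine Finset.sum_congr rfl fun a ha => ?_
  have hdeg : a.degree = m := by
    rw [Finsupp.degree_eq_weight_one]
    exact hp (MvPolynomial.mem_support_iff.1 ha)
  rw [← hdeg, Finsupp.degree_apply, ← Finset.prod_pow_eq_pow_sum]
  simp only [Pi.smul_apply, Algebra.smul_def, mul_pow, Finset.prod_mul_distrib, map_prod, map_pow]
  ring

variable [Fintype σ] {ν : R → ℝ≥0∞} {τ : σ → ℝ≥0∞}

theorem wnorm_cut_le (hν : ν 0 = 0) (m : ℕ) (f : MvPowerSeries σ R) :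
    wnorm ν τ (cut m f) ≤ wnorm ν τ f := by
  refine wnorm_mono_coeff fun a => ?_
  rw [coeff_cut]
  split_ifs
  · exact le_rfl
  · rw [hν]; exact zero_le

theorem wnorm_truncTotal_le (N : ℕ) (f : MvPowerSeries σ ℂ) :
    wnorm (fun z : ℂ => ‖z‖ₑ) τ (MvPowerSeries.truncTotal N f : MvPowerSeries σ ℂ) ≤
      wnorm (fun z : ℂ => ‖z‖ₑ) τ f := by
  refine wnorm_mono_coeff fun a => ?_
  rw [MvPolynomial.coeff_coe]
  by_cases h : a.degree < N
  · rw [MvPowerSeries.coeff_truncTotal _ h]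
  · rw [MvPowerSeries.coeff_truncTotal_eq_zero _ (not_lt.1 h)]
    simp

theorem wnorm_liftPoly_le [Algebra ℂ R] (hν : IsAlgNorm ν) (p : MvPolynomial σ ℂ) :
    wnorm ν τ (liftPoly R p) ≤ wnorm (fun z : ℂ => ‖z‖ₑ) τ (p : MvPowerSeries σ ℂ) := by
  refine wnorm_mono_coeff fun a => ?_
  rw [coeff_liftPoly, MvPolynomial.coeff_coe]
  exact hν.algebraMap_le _

end Aux

namespace LeadingSystem

variable {n : ℕ} (S : LeadingSystem n)

theorem degree_a₀ : S.a₀.degree = S.d := by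
  rw [Finsupp.degree_eq_weight_one]
  exact S.D_isHomogeneous S.isDominant.coeff_ne

/-- On polyradii `ρ t^θ` with `t` small, the dominant monomial of the Jacobian determinant dominates
the sum of all other monomials. -/
theorem exists_dominant_radius : ∃ t : ℝ≥0∞, t ≠ 0 ∧ t ≤ 1 ∧ ∀ ρ : ℝ≥0∞,
    2 * ∑ u ∈ S.D.support.erase S.a₀, ‖S.D.coeff u‖ₑ * mpow (fun i => ρ * t ^ S.θ i) u ≤
      ‖S.D.coeff S.a₀‖ₑ * mpow (fun i => ρ * t ^ S.θ i) S.a₀ := by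
  set A : ℝ≥0∞ := ∑ u ∈ S.D.support.erase S.a₀, ‖S.D.coeff u‖ₑ with hA
  have hAfin : A ≠ ⊤ := (ENNReal.sum_lt_top.2 fun _ _ => enorm_lt_top).ne
  have hcoeff : ‖S.D.coeff S.a₀‖ₑ ≠ 0 := enorm_ne_zero.2 S.isDominant.coeff_ne
  have hden : 2 * (1 + A) ≠ ⊤ := ENNReal.mul_ne_top (by simp) (by simp [hAfin])
  set t : ℝ≥0∞ := min 1 (‖S.D.coeff S.a₀‖ₑ / (2 * (1 + A))) with ht
  have ht1 : t ≤ 1 := min_le_left _ _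
  refine ⟨t, ?_, ht1, fun ρ => ?_⟩
  · rw [ht]
    exact (lt_min one_pos (ENNReal.div_pos hcoeff hden)).ne'
  have hpow : ∀ u, mpow (fun i => ρ * t ^ S.θ i) u = ρ ^ u.degree * t ^ S.wt u := fun u => by
    rw [mpow_mul, mpow_const, wt, Finsupp.weight_apply, Finsupp.sum_fintype _ _ (by simp),
      ← Finset.prod_pow_eq_pow_sum]
    simp [mpow, ← pow_mul, mul_comm]
  have hA2 : 2 * (A * t) ≤ ‖S.D.coeff S.a₀‖ₑ := by
    calc 2 * (A * t) ≤ 2 * ((1 + A) * (‖S.D.coeff S.a₀‖ₑ / (2 * (1 + A)))) := by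
          gcongr
          · exact le_add_self
          · exact min_le_right _ _
      _ = ‖S.D.coeff S.a₀‖ₑ := by
          rw [← mul_assoc, ENNReal.mul_div_cancel (by simp) hden]
  calc _ ≤ 2 * ∑ u ∈ S.D.support.erase S.a₀, ‖S.D.coeff u‖ₑ *
        (ρ ^ S.d * t ^ (S.wt S.a₀ + 1)) := by
        refine mul_le_mul_right (Finset.sum_le_sum fun u hu => mul_le_mul_right ?_ _) _
        obtain ⟨hu1, hu2⟩ := Finset.mem_erase.1 hu
        have hu2 := MvPolynomial.mem_support_iff.1 hu2
        have hdeg : u.degree = S.d := by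
          rw [Finsupp.degree_eq_weight_one]
          exact S.D_isHomogeneous hu2
        rw [hpow, hdeg]
        exact mul_le_mul_right (pow_le_pow_right_of_le_one' ht1 (S.isDominant.lt u hu1 hu2)) _
    _ = 2 * (A * t) * (ρ ^ S.d * t ^ S.wt S.a₀) := by
        rw [← Finset.sum_mul, ← hA]
        ring
    _ ≤ _ := by
        rw [hpow, degree_a₀]
        exact mul_le_mul_left hA2 _

section Estimate

variable {R : Type*} [CommRing R] [Algebra ℂ R]

/-- The right-hand side of the linear system solved in one step of the recursion is small of order
`ε ^ (eⱼ + 2)` on the polyradius `ε s`, if the previous iterate is bounded by `κ ε²` there. -/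
theorem wnorm_cut_sub_err_le {ν : R → ℝ≥0∞} (hν : IsAlgNorm ν) {s : Fin n → ℝ≥0∞}
    {r ε κ K C : ℝ≥0∞} (hr1 : r ≤ 1) (hs : ∀ i, s i ≤ r / 2) (hε0 : ε ≠ 0) (hε1 : ε ≤ 1)
    (hκr : κ * ε ≤ r / 2) (hκ : κ ^ 2 * ε ≤ 1) {j : Fin n}
    (hC : ∀ μ : MvPowerSeries (Fin n) R → ℝ≥0∞, IsAlgNorm μ →
      ∀ (x g : Fin n → MvPowerSeries (Fin n) R) (η : ℝ≥0∞), η ≤ 1 →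
      (∀ i, μ (x i) ≤ 1) → (∀ i, μ (g i) ≤ η) →
      μ (MvPolynomial.aeval (x + g) (S.f j) - MvPolynomial.aeval x (S.f j) -
        ∑ k, MvPolynomial.aeval x (MvPolynomial.pderiv k (S.f j)) * g k) ≤ C * η ^ 2)
    {c : Fin n → MvPowerSeries (Fin n) R} (hc : wnorm ν s (c j) ≤ K)
    {G : Fin n → MvPowerSeries (Fin n) R}
    (hG : ∀ k, wnorm ν (fun i => ε * s i) (G k) ≤ κ * ε ^ 2) {N : ℕ} (hN : S.e j + 2 ≤ N) :
    wnorm ν (fun i => ε * s i) (cut (S.e j + 1) (c j - S.err N G j)) ≤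
      ε ^ (S.e j + 2) * (K + C + (wnorm (fun z : ℂ => ‖z‖ₑ) (fun _ => r) (S.B j) +
        wnorm (fun z : ℂ => ‖z‖ₑ) (fun _ => r) (S.f j : MvPowerSeries (Fin n) ℂ))) := by
  have hμ := isAlgNorm_wnorm hν (fun i => ε * s i)
  have hεtop : ε ≠ ⊤ := ne_top_of_le_ne_top ENNReal.one_ne_top hε1
  set μ : MvPowerSeries (Fin n) R → ℝ≥0∞ := wnorm ν (fun i => ε * s i) with hμdef
  set p := MvPowerSeries.truncTotal N (S.B j) with hp
  have hr2 : r / 2 ≤ 1 := (ENNReal.half_le_self).trans hr1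
  set w : ℂ := (ε.toReal : ℂ) with hw
  have hwe : ‖w‖ₑ = ε := by
    rw [hw, ← ofReal_norm, Complex.norm_real, Real.norm_of_nonneg ENNReal.toReal_nonneg,
      ENNReal.ofReal_toReal hεtop]
  have hw0 : w ≠ 0 := by
    rw [← enorm_ne_zero, hwe]
    exact hε0
  have hwi : ‖w⁻¹‖ₑ = ε⁻¹ := by rw [enorm_inv hw0, hwe]
  set x : Fin n → MvPowerSeries (Fin n) R := fun i => MvPowerSeries.X i with hx
  set T := MvPolynomial.aeval (x + G) (S.f j) - MvPolynomial.aeval x (S.f j) - S.linear G j with hT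
  -- The linear rescaling by `w` turns the radius `ε s` into one bounded independently of `ε`.
  have hTle : μ T ≤ ε ^ (S.e j + 2) * C := by
    have hxw : x = w • (w⁻¹ • x) := by rw [smul_smul, mul_inv_cancel₀ hw0, one_smul]
    have hGw : G = w • (w⁻¹ • G) := by rw [smul_smul, mul_inv_cancel₀ hw0, one_smul]
    have hTw : T = w ^ (S.e j + 1) • (MvPolynomial.aeval (w⁻¹ • x + w⁻¹ • G) (S.f j) -
        MvPolynomial.aeval (w⁻¹ • x) (S.f j) -
        ∑ k, MvPolynomial.aeval (w⁻¹ • x) (MvPolynomial.pderiv k (S.f j)) * (w⁻¹ • G) k) := by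
      rw [smul_sub, smul_sub, ← aeval_smul_of_isHomogeneous (S.isHomogeneous j),
        ← aeval_smul_of_isHomogeneous (S.isHomogeneous j), smul_add, ← hxw, ← hGw, hT]
      congr 1
      rw [linear, Finset.smul_sum]
      refine Finset.sum_congr rfl fun k _ => ?_
      have h1 := aeval_smul_of_isHomogeneous (S.pderiv_isHomogeneous j k) w (w⁻¹ • x)
      rw [← hxw] at h1
      rw [liftPoly, h1, pow_succ, Pi.smul_apply, smul_mul_assoc, mul_smul, mul_smul_comm,
        smul_smul w, mul_inv_cancel₀ hw0, one_smul]
    have h1 := hC μ hμ (w⁻¹ • x) (w⁻¹ • G) (κ * ε) (hκr.trans hr2) (fun i => ?_) (fun i => ?_)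
    · rw [hTw]
      refine (hμ.smul_le _ _).trans ((mul_le_mul_right h1 _).trans ?_)
      rw [enorm_pow, hwe]
      calc ε ^ (S.e j + 1) * (C * (κ * ε) ^ 2) = ε ^ (S.e j + 2) * C * (κ ^ 2 * ε) := by ring
        _ ≤ ε ^ (S.e j + 2) * C * 1 := mul_le_mul_right hκ _
        _ = _ := mul_one _
    · refine (hμ.smul_le _ _).trans ?_
      rw [hwi]
      refine (mul_le_mul_right (wnorm_X_le hν i) _).trans ?_
      rw [← mul_assoc, ENNReal.inv_mul_cancel hε0 hεtop, one_mul]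
      exact (hs i).trans hr2
    · refine (hμ.smul_le _ _).trans ?_
      rw [hwi]
      refine (mul_le_mul_right (hG i) _).trans (le_of_eq ?_)
      calc ε⁻¹ * (κ * ε ^ 2) = (ε⁻¹ * ε) * (κ * ε) := by ring
        _ = κ * ε := by rw [ENNReal.inv_mul_cancel hε0 hεtop, one_mul]
  have hrest : μ (MvPolynomial.aeval (x + G) (p - S.f j)) ≤ ε ^ (S.e j + 2) *
      (wnorm (fun z : ℂ => ‖z‖ₑ) (fun _ => r) (S.B j) +
        wnorm (fun z : ℂ => ‖z‖ₑ) (fun _ => r) (S.f j : MvPowerSeries (Fin n) ℂ)) := by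
    have hX : ∀ i, μ ((x + G) i) ≤ ε * r := fun i => by
      refine (hμ.add_le _ _).trans ((add_le_add (wnorm_X_le hν i) (hG i)).trans ?_)
      calc ε * s i + κ * ε ^ 2 = ε * (s i + κ * ε) := by ring
        _ ≤ ε * (r / 2 + r / 2) := by gcongr; exact hs i
        _ = ε * r := by rw [ENNReal.add_halves]
    refine (aeval_le_wnorm hμ _ _).trans ((wnorm_mono_radius hX _).trans ?_)
    refine (wnorm_le_pow_mul isAlgNorm_enorm hε1 (S.truncTotal_sub_mem hN)).trans ?_
    refine mul_le_mul_right ?_ _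
    have : ((p - S.f j : MvPolynomial (Fin n) ℂ) : MvPowerSeries (Fin n) ℂ) = p - S.f j :=
      map_sub MvPolynomial.coeToMvPowerSeries.ringHom _ _
    rw [this]
    exact ((isAlgNorm_wnorm isAlgNorm_enorm _).sub_le _ _).trans
      (add_le_add_left (wnorm_truncTotal_le _ _) _)
  have hcut : cut (S.e j + 1) (c j - S.err N G j) = cut (S.e j + 1) (c j) -
      cut (S.e j + 1) T - cut (S.e j + 1) (MvPolynomial.aeval (x + G) (p - S.f j)) := by
    have hz : cut (S.e j + 1) (MvPolynomial.aeval x (S.f j)) = 0 := by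
      ext a
      rw [coeff_cut]
      split_ifs with ha
      · have : MvPowerSeries.coeff a (liftPoly R (S.f j)) = 0 := by
          rw [coeff_liftPoly, (S.isHomogeneous j).coeff_eq_zero (by omega), map_zero]
        exact this
      · rfl
    have herr : S.err N G j = T + MvPolynomial.aeval (x + G) (p - S.f j) +
        MvPolynomial.aeval x (S.f j) := by
      rw [err, hT, map_sub, ← hp]
      have : (fun i => MvPowerSeries.X i + G i) = x + G := rfl
      rw [this]
      ring
    rw [herr, ← sub_sub, ← sub_sub, cut_sub, cut_sub, cut_sub, hz, sub_zero]
  rw [hcut, mul_add, mul_add]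
  refine (hμ.sub_le _ _).trans (add_le_add ((hμ.sub_le _ _).trans (add_le_add ?_ ?_)) ?_)
  · refine (wnorm_le_pow_mul hν hε1 (cut_mem_ordIdeal _ _)).trans (mul_le_mul_right ?_ _)
    exact (wnorm_cut_le hν.map_zero _ _).trans hc
  · exact (wnorm_cut_le hν.map_zero _ _).trans hTle
  · exact (wnorm_cut_le hν.map_zero _ _).trans hrest

/-- On the polyradius `ε s`, Cramer's rule and the division by the Jacobian determinant turn a bound of
order `ε ^ (eⱼ + 2)` for the right-hand sides into one of order `ε ^ 2` for the solution. -/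
theorem wnorm_solve_le {ν : R → ℝ≥0∞} (hν : IsAlgNorm ν) {s : Fin n → ℝ≥0∞} {ε T : ℝ≥0∞}
    (hε0 : ε ≠ 0) (hε1 : ε ≤ 1)
    (hdom : 2 * ∑ u ∈ S.D.support.erase S.a₀, ‖S.D.coeff u‖ₑ * mpow (fun i => ε * s i) u ≤
      ‖S.D.coeff S.a₀‖ₑ * mpow (fun i => ε * s i) S.a₀)
    {g : Fin n → MvPowerSeries (Fin n) R}
    (hg : ∀ j, wnorm ν (fun i => ε * s i) (g j) ≤ ε ^ (S.e j + 2) * T) (k : Fin n) :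
    ‖S.D.coeff S.a₀‖ₑ * mpow s S.a₀ * wnorm ν (fun i => ε * s i) (S.solve g k) ≤
      2 * (∑ j, wnorm (fun z : ℂ => ‖z‖ₑ) s (S.jacF.adjugate k j : MvPowerSeries (Fin n) ℂ)) * T *
        ε ^ 2 := by
  have hμ := isAlgNorm_wnorm hν (fun i => ε * s i)
  have hεtop : ε ≠ ⊤ := ne_top_of_le_ne_top ENNReal.one_ne_top hε1
  have h1 := wnorm_divSeries_le S.isDominant hν hdom (∑ j, liftPoly R (S.jacF.adjugate k j) * g j)
  have h2 : wnorm ν (fun i => ε * s i) (∑ j, liftPoly R (S.jacF.adjugate k j) * g j) ≤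
      ε ^ S.d * ((∑ j, wnorm (fun z : ℂ => ‖z‖ₑ) s
        (S.jacF.adjugate k j : MvPowerSeries (Fin n) ℂ)) * T * ε ^ 2) := by
    refine (hμ.sum_le _ _).trans ?_
    rw [Finset.sum_mul, Finset.sum_mul, Finset.mul_sum]
    refine Finset.sum_le_sum fun j _ => (hμ.mul_le _ _).trans ?_
    have hd := Nat.sub_add_cancel (S.e_le_d j)
    refine (mul_le_mul' ((wnorm_liftPoly_le hν _).trans (wnorm_le_pow_mul isAlgNorm_enorm hε1
      (S.adjugate_mem k j hd))) (hg j)).trans (le_of_eq ?_)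
    have : ε ^ S.d = ε ^ (S.d - S.e j) * ε ^ S.e j := by rw [← pow_add, hd]
    rw [this]
    ring
  rw [mpow_mul, mpow_const, degree_a₀] at h1
  have h3 := h1.trans (mul_le_mul_right h2 _)
  rw [← ENNReal.mul_le_mul_iff_right (a := ε ^ S.d) (pow_ne_zero _ hε0) (ENNReal.pow_ne_top hεtop)]
  refine le_trans (le_of_eq ?_) (h3.trans (le_of_eq ?_))
  · rw [solve]; ring
  · ring

/-- Uniform convergence of the recursion: on a small multiple `ε s` of a suitable polyradius `s`, all
iterates are bounded by `1`. The number `ε` depends on the right-hand side only through a bound for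
its norm. -/
theorem exists_wnorm_iter_le {r : ℝ≥0∞} (hr0 : r ≠ 0) (hr1 : r ≤ 1)
    (hB : ∀ j, wnorm (fun z : ℂ => ‖z‖ₑ) (fun _ => r) (S.B j) < ⊤) {s : Fin n → ℝ≥0∞}
    (hs0 : ∀ i, s i ≠ 0) (hs : ∀ i, s i ≤ r / 2)
    (hdom : ∀ ε : ℝ≥0∞,
      2 * ∑ u ∈ S.D.support.erase S.a₀, ‖S.D.coeff u‖ₑ * mpow (fun i => ε * s i) u ≤
        ‖S.D.coeff S.a₀‖ₑ * mpow (fun i => ε * s i) S.a₀)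
    {K : ℝ≥0∞} (hK : K ≠ ⊤) :
    ∃ ε : ℝ≥0∞, ε ≠ 0 ∧ ε ≤ 1 ∧ ∀ ν : R → ℝ≥0∞, IsAlgNorm ν →
      ∀ c : Fin n → MvPowerSeries (Fin n) R, (∀ j, wnorm ν s (c j) ≤ K) →
      ∀ L k, wnorm ν (fun i => ε * s i) (S.iter c L k) ≤ 1 := by
  have hr : r ≠ ⊤ := ne_top_of_le_ne_top ENNReal.one_ne_top hr1
  have hr2 : r / 2 ≤ 1 := ENNReal.half_le_self.trans hr1
  have hsfin : ∀ i, s i ≠ ⊤ := fun i => ne_top_of_le_ne_top ENNReal.one_ne_top ((hs i).trans hr2)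
  choose C hCtop hC using fun j => exists_taylor_bound (R := MvPowerSeries (Fin n) R) (S.f j)
  set T : ℝ≥0∞ := ∑ j, (K + C j + (wnorm (fun z : ℂ => ‖z‖ₑ) (fun _ => r) (S.B j) +
        wnorm (fun z : ℂ => ‖z‖ₑ) (fun _ => r) (S.f j : MvPowerSeries (Fin n) ℂ))) with hT
  have hTtop : T ≠ ⊤ := by
    refine (ENNReal.sum_lt_top.2 fun j _ => ?_).ne
    exact ENNReal.add_lt_top.2 ⟨ENNReal.add_lt_top.2 ⟨hK.lt_top, (hCtop j).lt_top⟩,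
      ENNReal.add_lt_top.2 ⟨hB j, wnorm_coe_lt_top _ fun _ => hr⟩⟩
  set A : ℝ≥0∞ := ∑ k, ∑ j, wnorm (fun z : ℂ => ‖z‖ₑ) s
    (S.jacF.adjugate k j : MvPowerSeries (Fin n) ℂ) with hA
  have hAtop : A ≠ ⊤ := (ENNReal.sum_lt_top.2 fun k _ => ENNReal.sum_lt_top.2 fun j _ =>
    wnorm_coe_lt_top _ hsfin).ne
  set c₀ : ℝ≥0∞ := ‖S.D.coeff S.a₀‖ₑ * mpow s S.a₀ with hc₀
  have hc₀0 : c₀ ≠ 0 := mul_ne_zero (enorm_ne_zero.2 S.isDominant.coeff_ne)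
    (Finset.prod_ne_zero_iff.2 fun i _ => pow_ne_zero _ (hs0 i))
  have hc₀top : c₀ ≠ ⊤ := (ENNReal.mul_lt_top enorm_lt_top
    (ENNReal.prod_lt_top fun i _ => ENNReal.pow_lt_top (hsfin i).lt_top)).ne
  set κ : ℝ≥0∞ := 2 * A * T / c₀ with hκ
  have hκtop : κ ≠ ⊤ := ENNReal.div_ne_top
    (ENNReal.mul_ne_top (ENNReal.mul_ne_top (by simp) hAtop) hTtop) hc₀0
  have h1κ : (1 + κ) ^ 2 ≠ ⊤ := ENNReal.pow_ne_top (by simp [hκtop])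
  have h1κ0 : (1 + κ) ^ 2 ≠ 0 := pow_ne_zero _ (by simp)
  set ε : ℝ≥0∞ := r / 2 / (1 + κ) ^ 2 with hε
  have hεmul : (1 + κ) ^ 2 * ε = r / 2 := ENNReal.mul_div_cancel h1κ0 h1κ
  have hε0 : ε ≠ 0 := (ENNReal.div_pos (ENNReal.div_pos hr0 (by simp)).ne' h1κ).ne'
  have hle : ∀ q : ℝ≥0∞, q ≤ (1 + κ) ^ 2 → q * ε ≤ r / 2 := fun q hq => by
    rw [← hεmul]
    exact mul_le_mul_left hq _
  have hε1 : ε ≤ 1 := by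
    have := hle 1 (one_le_pow₀ (by simp))
    rw [one_mul] at this
    exact this.trans hr2
  have hκle : κ ≤ (1 + κ) ^ 2 := by
    calc κ ≤ 1 + κ := le_add_self
      _ ≤ (1 + κ) ^ 2 := le_self_pow₀ (by simp) two_ne_zero
  have hκε := hle κ hκle
  have hκ2 : κ ^ 2 * ε ≤ 1 := (hle _ (pow_le_pow_left' le_add_self 2)).trans hr2
  refine ⟨ε, hε0, hε1, fun ν hν c hc L => ?_⟩
  have key : ∀ k, wnorm ν (fun i => ε * s i) (S.iter c L k) ≤ κ * ε ^ 2 := by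
    induction L with
    | zero =>
      intro k
      have : wnorm ν (fun i => ε * s i) (S.iter c 0 k) = 0 :=
        (isAlgNorm_wnorm hν _).map_zero
      rw [this]
      exact zero_le
    | succ L ih =>
      intro k
      have h1 := S.wnorm_solve_le hν (T := T) hε0 hε1 (hdom ε)
        (g := fun j => cut (S.e j + 1) (c j - S.err (L + S.d + 4) (S.iter c L) j))
        (fun j => ?_) k
      · rw [← ENNReal.mul_le_mul_iff_right (a := c₀) hc₀0 hc₀top, ← mul_assoc, hκ,
          ENNReal.mul_div_cancel hc₀0 hc₀top]
        refine h1.trans ?_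
        gcongr
        exact Finset.single_le_sum (f := fun k => ∑ j, wnorm (fun z : ℂ => ‖z‖ₑ) s
          (S.jacF.adjugate k j : MvPowerSeries (Fin n) ℂ)) (fun _ _ => zero_le) (Finset.mem_univ k)
      · have hj := S.e_le_d j
        refine (S.wnorm_cut_sub_err_le hν hr1 hs hε0 hε1 hκε hκ2 (hC j) (hc j) ih
          (by omega)).trans (mul_le_mul_right ?_ _)
        exact Finset.single_le_sum (f := fun j => K + C j +
          (wnorm (fun z : ℂ => ‖z‖ₑ) (fun _ => r) (S.B j) +
          wnorm (fun z : ℂ => ‖z‖ₑ) (fun _ => r) (S.f j : MvPowerSeries (Fin n) ℂ)))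
          (fun _ _ => zero_le) (Finset.mem_univ j)
  intro k
  refine (key k).trans ?_
  rw [sq, ← mul_assoc]
  exact mul_le_one' (hκε.trans hr2) hε1

theorem wnorm_sol_le {ν : R → ℝ≥0∞} {τ : Fin n → ℝ≥0∞} {c : Fin n → MvPowerSeries (Fin n) R}
    {k : Fin n} {M : ℝ≥0∞} (h : ∀ L, wnorm ν τ (S.iter c L k) ≤ M) :
    wnorm ν τ (S.sol c k) ≤ M := by
  rw [wnorm, ENNReal.tsum_eq_iSup_sum]
  refine iSup_le fun t => ?_
  refine le_trans (le_of_eq (Finset.sum_congr rfl fun a ha => ?_))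
    ((ENNReal.sum_le_tsum t).trans (h (t.sup Finsupp.degree)))
  have h1 := mem_ordIdeal.1 (S.sol_sub_iter_mem c (t.sup Finsupp.degree) k) a
    ((Nat.lt_succ_iff.2 (Finset.le_sup (f := Finsupp.degree) ha)).trans (Nat.lt_succ_self _))
  rw [map_sub, sub_eq_zero] at h1
  rw [h1]

/-- The formal solution converges, with a radius that depends on the right-hand side only through a
radius and a bound. -/
theorem exists_wnorm_sol_le (hB : ∃ r : ℝ≥0∞, r ≠ 0 ∧ ∀ j,
      wnorm (fun z : ℂ => ‖z‖ₑ) (fun _ => r) (S.B j) < ⊤) {ρ K : ℝ≥0∞} (hρ : ρ ≠ 0) (hK : K ≠ ⊤) :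
    ∃ δ : ℝ≥0∞, δ ≠ 0 ∧ ∀ ν : R → ℝ≥0∞, IsAlgNorm ν →
      ∀ c : Fin n → MvPowerSeries (Fin n) R, (∀ j, wnorm ν (fun _ => ρ) (c j) ≤ K) →
      ∀ k, wnorm ν (fun _ => δ) (S.sol c k) ≤ 1 := by
  obtain ⟨r₀, hr₀, hB⟩ := hB
  obtain ⟨t, ht0, ht1, ht⟩ := S.exists_dominant_radius
  set r := min r₀ 1 with hr
  have hr0 : r ≠ 0 := (lt_min (pos_iff_ne_zero.2 hr₀) one_pos).ne'
  set q := min (r / 2) ρ with hq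
  have hq0 : q ≠ 0 :=
    (lt_min (ENNReal.div_pos hr0 (by simp)) (pos_iff_ne_zero.2 hρ)).ne'
  set s : Fin n → ℝ≥0∞ := fun i => q * t ^ S.θ i with hs
  have hsq : ∀ i, s i ≤ q := fun i => mul_le_of_le_one_right' (pow_le_one' ht1 _)
  have hs0 : ∀ i, s i ≠ 0 := fun i => mul_ne_zero hq0 (pow_ne_zero _ ht0)
  obtain ⟨ε, hε0, hε1, h⟩ := S.exists_wnorm_iter_le (R := R) hr0 (min_le_right _ _)
    (fun j => (wnorm_mono_radius (fun _ => min_le_left _ _) _).trans_lt (hB j)) hs0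
    (fun i => (hsq i).trans (min_le_left _ _)) (fun ε => by
      simpa only [hs, ← mul_assoc] using ht (ε * q)) hK
  refine ⟨ε * (q * t ^ (∑ i, S.θ i)), mul_ne_zero hε0 (mul_ne_zero hq0 (pow_ne_zero _ ht0)),
    fun ν hν c hc k => ?_⟩
  refine le_trans (wnorm_mono_radius (fun i => ?_) _) (S.wnorm_sol_le fun L => h ν hν c
    (fun j => (wnorm_mono_radius (fun i => (hsq i).trans (min_le_right _ _)) _).trans (hc j)) L k)
  refine mul_le_mul_right (mul_le_mul_right ?_ _) _
  exact pow_le_pow_right_of_le_one' ht1 (Finset.single_le_sum (fun _ _ => Nat.zero_le _)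
    (Finset.mem_univ i))

end Estimate

end LeadingSystem

/-! ### Systems with convergent coefficients -/

section Represents

variable {σ : Type*} [Fintype σ] {f g : MvPowerSeries σ ℂ} {F G : (σ → ℂ) → ℂ}

theorem represents_ev {ρ : ℝ≥0∞} (hρ : ρ ≠ 0) (hf : cnorm (fun _ => ρ) f < ⊤) :
    Represents f (ev f) :=
  ⟨ρ, hρ, hf, Eventually.of_forall fun _ => rfl⟩

theorem Represents.add (hf : Represents f F) (hg : Represents g G) :
    Represents (f + g) fun x => F x + G x := by
  have := Represents.aeval (f := ![f, g]) (F := ![F, G]) (by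
    intro j; fin_cases j; exacts [hf, hg]) (MvPolynomial.X 0 + MvPolynomial.X 1)
  simpa using this

theorem represents_X (i : σ) : Represents (MvPowerSeries.X i) fun x => x i := by
  simpa using represents_coe (MvPolynomial.X i : MvPolynomial σ ℂ)

/-- A function that vanishes to first order at `0` has a Taylor series of order at least `2`. -/
theorem Represents.mem_ordIdeal_two [DecidableEq σ] (h : Represents f F) (h0 : F 0 = 0)
    (h1 : ∀ i, fderiv ℂ F 0 (Pi.single i 1) = 0) : f ∈ ordIdeal σ ℂ 2 := by
  rw [SingularSystem.mem_ordIdeal]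
  intro a ha
  have h2 : a.degree = 0 ∨ a.degree = 1 := by omega
  rcases h2 with h2 | h2
  · rw [Finsupp.degree_eq_zero_iff] at h2
    rw [h2, ← h.apply_zero, h0]
  · obtain ⟨i, rfl⟩ : ∃ i, a = Finsupp.single i 1 := by
      have h3 : a ∈ Set.range fun i : σ => Finsupp.single i 1 := by
        rw [Finsupp.range_single_one]
        exact h2
      exact h3.imp fun _ => Eq.symm
    have := (h.pderiv i).apply_zero
    rw [h1, MvPowerSeries.coeff_pderiv] at this
    simpa using this.symm

/-- The Taylor series at `0` of a function that is analytic there (and `0` for other functions). -/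
def taylorSeries (F : (σ → ℂ) → ℂ) : MvPowerSeries σ ℂ := by
  classical
  exact if h : ∃ f, Represents f F then h.choose else 0

theorem represents_taylorSeries (hF : AnalyticAt ℂ F 0) : Represents (taylorSeries F) F := by
  have h := exists_represents hF
  rw [taylorSeries, dif_pos h]
  exact h.choose_spec

theorem Represents.taylorSeries_eq (h : Represents f F) : taylorSeries F = f :=
  (represents_taylorSeries h.analyticAt).unique h

end Represents

theorem AnalyticAt.eval_poly {E σ : Type*} [NormedAddCommGroup E] [NormedSpace ℂ E] [Fintype σ]
    {g : E → σ → ℂ} {x : E} (hg : AnalyticAt ℂ g x) (p : MvPolynomial σ ℂ) :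
    AnalyticAt ℂ (fun y => MvPolynomial.eval (g y) p) x := by
  have hg' := analyticAt_pi_iff.1 hg
  induction p using MvPolynomial.induction_on with
  | C a => simpa using analyticAt_const
  | add p q hp hq =>
    simp only [map_add]
    exact hp.add hq
  | mul_X p i hp =>
    simp only [map_mul, MvPolynomial.eval_X]
    exact hp.mul (hg' i)

variable {n : ℕ}

/-- A germ of generic rank `n` has a nonvanishing formal Jacobian determinant. -/
theorem det_jac_ne_zero {A : (Fin n → ℂ) → (Fin n → ℂ)} (hA : AnalyticAt ℂ A 0)
    (hrank : HasGenericRank A n) {f : Fin n → MvPowerSeries (Fin n) ℂ}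
    (hf : ∀ j, Represents (f j) fun z => A z j) : (jac f).det ≠ 0 := by
  intro h0
  have hA' := analyticAt_pi_iff.1 hA
  -- The determinant of the derivative is a polynomial in its entries.
  set p : MvPolynomial (Fin n × Fin n) ℂ :=
    (Matrix.of fun j k => (MvPolynomial.X (j, k) : MvPolynomial (Fin n × Fin n) ℂ)).det with hp
  have h1 := Represents.aeval (κ := Fin n × Fin n)
    (f := fun e => MvPowerSeries.pderiv ℂ e.2 (f e.1))
    (F := fun e z => fderiv ℂ (fun z => A z e.1) z (Pi.single e.2 1))
    (fun e => (hf e.1).pderiv e.2) p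
  have e1 : MvPolynomial.aeval (fun e : Fin n × Fin n => MvPowerSeries.pderiv ℂ e.2 (f e.1)) p =
      (jac f).det := by
    rw [hp, AlgHom.map_det]
    congr 1
    ext j k : 2
    simp [jac]
  rw [e1, h0] at h1
  obtain ⟨_, _, _, h2⟩ := h1
  have h3 : ∀ᶠ z in 𝓝 (0 : Fin n → ℂ),
      (fderiv ℂ A z : (Fin n → ℂ) →ₗ[ℂ] (Fin n → ℂ)).det = 0 := by
    filter_upwards [h2, eventually_all.2 fun j => (hA' j).eventually_analyticAt] with z hz han
    have hd : HasFDerivAt A (ContinuousLinearMap.pi fun j => fderiv ℂ (fun z => A z j) z) z :=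
      hasFDerivAt_pi.2 fun j => (han j).differentiableAt.hasFDerivAt
    rw [hd.fderiv, ← LinearMap.det_toMatrix']
    have e2 : ev (0 : MvPowerSeries (Fin n) ℂ) z = 0 := by simp [ev]
    rw [e2, hp, RingHom.map_det] at hz
    rw [← hz]
    congr 1
    ext j k
    simp [LinearMap.toMatrix'_apply]
  obtain ⟨z, hz, hz'⟩ := (hrank.2.and_eventually h3).exists
  have h4 : Function.Surjective (fderiv ℂ A z : (Fin n → ℂ) →ₗ[ℂ] (Fin n → ℂ)) := by
    rw [← LinearMap.range_eq_top]
    apply Submodule.eq_top_of_finrank_eq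
    rw [Module.finrank_fin_fun]
    exact hz
  have h5 : Function.Injective (fderiv ℂ A z : (Fin n → ℂ) →ₗ[ℂ] (Fin n → ℂ)) :=
    LinearMap.injective_iff_surjective.2 h4
  have h6 := (LinearMap.isUnit_iff_ker_eq_bot _).2 (LinearMap.ker_eq_bot.2 h5)
  exact ((LinearMap.isUnit_iff_isUnit_det _).1 h6).ne_zero hz'

/-- Polynomials `Pⱼ` for which the germs `Pⱼ ∘ A` form a system with independent leading forms. -/
theorem exists_leadingSystem {A : (Fin n → ℂ) → (Fin n → ℂ)} (hA : AnalyticAt ℂ A 0)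
    (hrank : HasGenericRank A n) :
    ∃ (S : LeadingSystem n) (P : Fin n → MvPolynomial (Fin n) ℂ),
      ∀ j, Represents (S.B j) fun z => MvPolynomial.eval (A z) (P j) := by
  choose f hf using fun j => exists_represents (analyticAt_pi_iff.1 hA j)
  obtain ⟨P, m, g, hg, hP, hdet⟩ := exists_independent_leadingForms f (det_jac_ne_zero hA hrank hf)
  have hm : ∀ j, m j - 1 + 1 = m j := fun j => by
    refine Nat.sub_add_cancel (Nat.one_le_iff_ne_zero.2 fun h0 => hdet ?_)
    refine Matrix.det_eq_zero_of_row_eq_zero j fun k => ?_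
    have h1 := hg j
    rw [h0] at h1
    rw [Matrix.of_apply, MvPolynomial.totalDegree_eq_zero_iff_eq_C.1
      (Nat.le_zero.1 h1.totalDegree_le), MvPolynomial.pderiv_C]
  exact ⟨{
    B := fun j => MvPolynomial.aeval f (P j)
    f := g
    e := fun j => m j - 1
    isHomogeneous := fun j => by rw [hm]; exact hg j
    sub_leading_mem := fun j => by
      have := hP j
      rwa [← hm] at this
    det_ne_zero := hdet }, P, fun j => Represents.aeval hf (P j)⟩

namespace LeadingSystem

variable (S : LeadingSystem n)

theorem exists_radius {F : Fin n → (Fin n → ℂ) → ℂ} (hB : ∀ j, Represents (S.B j) (F j)) :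
    ∃ r : ℝ≥0∞, r ≠ 0 ∧ ∀ j, cnorm (fun _ => r) (S.B j) < ⊤ := by
  choose ρ hρ hf hF using hB
  refine ⟨Finset.univ.inf ρ, ?_, fun j => (wnorm_mono_radius
    (fun _ => Finset.inf_le (Finset.mem_univ j)) _).trans_lt (hf j)⟩
  rw [← pos_iff_ne_zero, Finset.lt_inf_iff (by simp)]
  exact fun j _ => pos_iff_ne_zero.2 (hρ j)

/-- The formal solution is the Taylor series of every analytic solution tangent to the identity. -/
theorem eq_sol_of_represents {F : Fin n → (Fin n → ℂ) → ℂ} (hB : ∀ j, Represents (S.B j) (F j))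
    {U : (Fin n → ℂ) → (Fin n → ℂ)} (hU : HasFDerivAt U (ContinuousLinearMap.id ℂ _) 0)
    (hU0 : U 0 = 0) {u c : Fin n → MvPowerSeries (Fin n) ℂ}
    (hu : ∀ i, Represents (u i) fun w => U w i)
    (hc : ∀ j, Represents (c j) fun w => F j (U w)) (i : Fin n) :
    u i = MvPowerSeries.X i + S.sol c i := by
  have hUi : ∀ i, HasFDerivAt (fun w => U w i) (ContinuousLinearMap.proj i) 0 :=
    hasFDerivAt_pi'.1 hU
  have hH : ∀ k, u k - MvPowerSeries.X k ∈ ordIdeal (Fin n) ℂ 2 := fun k => by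
    refine Represents.mem_ordIdeal_two ((hu k).sub (represents_X k)) (by simp [hU0]) fun l => ?_
    have : HasFDerivAt (fun w : Fin n → ℂ => U w k - w k) _ 0 :=
      (hUi k).sub (ContinuousLinearMap.proj (R := ℂ) (φ := fun _ : Fin n => ℂ) k).hasFDerivAt
    rw [this.fderiv]
    simp
  have h := S.eq_sol (c := c) hH fun j N => ?_
  · rw [← h]; ring
  have e1 : (fun i => MvPowerSeries.X i + (u i - MvPowerSeries.X i)) = u := by
    funext i; ring
  rw [e1]
  have hrep := (hc j).sub (Represents.aeval hu (MvPowerSeries.truncTotal N (S.B j)))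
  refine hrep.mem_ordIdeal ?_
  have h1 := ((hB j).sub (represents_coe (MvPowerSeries.truncTotal N (S.B j)))).isBigO (k := N) (by
    rw [mem_ordIdeal]
    intro a ha
    rw [map_sub, MvPolynomial.coeff_coe, MvPowerSeries.coeff_truncTotal _ ha, sub_self])
  have htend : Tendsto U (𝓝 0) (𝓝 0) := by
    have := hU.continuousAt.tendsto
    rwa [hU0] at this
  have h2 : U =O[𝓝 0] fun w => w := by
    have := hU.isBigO_sub
    simpa [hU0] using this
  exact (h1.comp_tendsto htend).trans (h2.norm_norm.pow N)

/-- The formal solution of a convergent system converges. -/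
theorem represents_sol {F : Fin n → (Fin n → ℂ) → ℂ} (hB : ∀ j, Represents (S.B j) (F j))
    {c : Fin n → MvPowerSeries (Fin n) ℂ} {G : Fin n → (Fin n → ℂ) → ℂ}
    (hc : ∀ j, Represents (c j) (G j)) (i : Fin n) : Represents (S.sol c i) (ev (S.sol c i)) := by
  choose ρ hρ hf hF using hc
  have h0 : Finset.univ.inf ρ ≠ 0 := by
    rw [← pos_iff_ne_zero, Finset.lt_inf_iff (by simp)]
    exact fun j _ => pos_iff_ne_zero.2 (hρ j)
  have hK : ∑ j, cnorm (fun _ => ρ j) (c j) ≠ ⊤ := (ENNReal.sum_lt_top.2 fun j _ => hf j).ne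
  obtain ⟨δ, hδ, h⟩ := S.exists_wnorm_sol_le (R := ℂ) (S.exists_radius hB) h0 hK
  refine represents_ev hδ ((h _ isAlgNorm_enorm c (fun j => ?_) i).trans_lt ENNReal.one_lt_top)
  refine (wnorm_mono_radius (fun _ => Finset.inf_le (Finset.mem_univ j)) _).trans ?_
  exact Finset.single_le_sum (f := fun j => cnorm (fun _ => ρ j) (c j)) (fun _ _ => zero_le)
    (Finset.mem_univ j)

end LeadingSystem

/-! ### Analytic dependence of the solution on parameters -/

section Fiber

variable {σ κ : Type*}

/-- The coefficient of `x^a` in a power series in two groups of variables `x` and `y`, a power series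
in `y`. -/
def fiber (f : MvPowerSeries (σ ⊕ κ) ℂ) (a : σ →₀ ℕ) : MvPowerSeries κ ℂ :=
  fun b => MvPowerSeries.coeff (Finsupp.sumFinsuppEquivProdFinsupp.symm (a, b)) f

/-- The power series in two groups of variables `x` and `y` in which the coefficient of `x^a` is the
power series `g a` in `y`. -/
def ofFibers (g : (σ →₀ ℕ) → MvPowerSeries κ ℂ) : MvPowerSeries (σ ⊕ κ) ℂ :=
  fun c => MvPowerSeries.coeff (Finsupp.sumFinsuppEquivProdFinsupp c).2
    (g (Finsupp.sumFinsuppEquivProdFinsupp c).1)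

theorem fiber_ofFibers (g : (σ →₀ ℕ) → MvPowerSeries κ ℂ) (a : σ →₀ ℕ) :
    fiber (ofFibers g) a = g a := by
  ext b
  change MvPowerSeries.coeff (Finsupp.sumFinsuppEquivProdFinsupp
    (Finsupp.sumFinsuppEquivProdFinsupp.symm (a, b))).2
    (g (Finsupp.sumFinsuppEquivProdFinsupp (Finsupp.sumFinsuppEquivProdFinsupp.symm (a, b))).1) = _
  rw [Equiv.apply_symm_apply]

variable [Fintype σ] [Fintype κ]

theorem mpow_sumElim {M : Type*} [CommMonoid M] (x : σ → M) (y : κ → M) (a : σ →₀ ℕ)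
    (b : κ →₀ ℕ) : mpow (Sum.elim x y) (Finsupp.sumFinsuppEquivProdFinsupp.symm (a, b)) =
      mpow x a * mpow y b := by
  simp [mpow, Fintype.prod_sum_type]

theorem cnorm_sumElim (s : σ → ℝ≥0∞) (t : κ → ℝ≥0∞) (f : MvPowerSeries (σ ⊕ κ) ℂ) :
    cnorm (Sum.elim s t) f = ∑' a, cnorm t (fiber f a) * mpow s a := by
  rw [cnorm, wnorm, ← Finsupp.sumFinsuppEquivProdFinsupp.symm.tsum_eq, ENNReal.tsum_prod']
  refine tsum_congr fun a => ?_
  rw [cnorm, wnorm, ← ENNReal.tsum_mul_right]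
  refine tsum_congr fun b => ?_
  rw [mpow_sumElim]
  change _ = ‖MvPowerSeries.coeff (Finsupp.sumFinsuppEquivProdFinsupp.symm (a, b)) f‖ₑ * _ * _
  ring

theorem ev_sumElim {s : σ → ℝ≥0∞} {t : κ → ℝ≥0∞} {f : MvPowerSeries (σ ⊕ κ) ℂ}
    (hf : cnorm (Sum.elim s t) f < ⊤) {x : σ → ℂ} {y : κ → ℂ} (hx : ∀ i, ‖x i‖ₑ ≤ s i)
    (hy : ∀ i, ‖y i‖ₑ ≤ t i) :
    ev f (Sum.elim x y) = ∑' a, ev (fiber f a) y * mpow x a := by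
  have h1 := (summable_ev hf (x := Sum.elim x y) (by rintro (i | i); exacts [hx i, hy i])).of_norm
  rw [ev, ← Finsupp.sumFinsuppEquivProdFinsupp.symm.tsum_eq]
  refine ((Finsupp.sumFinsuppEquivProdFinsupp.symm.summable_iff).2 h1).tsum_prod.trans ?_
  refine tsum_congr fun a => ?_
  rw [ev, ← tsum_mul_right]
  refine tsum_congr fun b => ?_
  rw [Function.comp_apply, mpow_sumElim]
  change _ = MvPowerSeries.coeff (Finsupp.sumFinsuppEquivProdFinsupp.symm (a, b)) f * _ * _
  ring

theorem isAlgNorm_convSubalgebra (τ : κ → ℝ≥0∞) :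
    IsAlgNorm fun f : convSubalgebra τ => cnorm τ f.1 where
  map_zero := (isAlgNorm_wnorm isAlgNorm_enorm τ).map_zero
  add_le f g := (isAlgNorm_wnorm isAlgNorm_enorm τ).add_le f.1 g.1
  mul_le f g := (isAlgNorm_wnorm isAlgNorm_enorm τ).mul_le f.1 g.1
  algebraMap_le z := (isAlgNorm_wnorm isAlgNorm_enorm τ).algebraMap_le z

end Fiber

namespace LeadingSystem

variable {n : ℕ} (S : LeadingSystem n)

/-- If the right-hand side depends analytically on parameters in `ℂᵈ`, so does the solution. The
recursion is run over the algebra of convergent power series in the parameters; evaluation at a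
value of the parameters gives the recursion over `ℂ`. -/
theorem analyticAt_ev_sol_fin {F₀ : Fin n → (Fin n → ℂ) → ℂ}
    (hB : ∀ j, Represents (S.B j) (F₀ j)) {d : ℕ} {F : Fin n → (Fin n → ℂ) × (Fin d → ℂ) → ℂ}
    (hF : ∀ j, AnalyticAt ℂ (F j) 0) (i : Fin n) :
    AnalyticAt ℂ (fun p : (Fin n → ℂ) × (Fin d → ℂ) =>
      ev (S.sol (fun j => taylorSeries fun w => F j (w, p.2)) i) p.1) 0 := by
  let split : (Fin n ⊕ Fin d → ℂ) →L[ℂ] (Fin n → ℂ) × (Fin d → ℂ) :=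
    (ContinuousLinearMap.pi fun i => ContinuousLinearMap.proj (Sum.inl i)).prod
      (ContinuousLinearMap.pi fun i => ContinuousLinearMap.proj (Sum.inr i))
  have hsplit : ∀ p : (Fin n → ℂ) × (Fin d → ℂ), split (Sum.elim p.1 p.2) = p := fun p => rfl
  let glue : (Fin n → ℂ) × (Fin d → ℂ) →L[ℂ] (Fin n ⊕ Fin d → ℂ) :=
    ContinuousLinearMap.pi (Sum.elim
      (fun i => (ContinuousLinearMap.proj i).comp (ContinuousLinearMap.fst ℂ _ _))
      (fun i => (ContinuousLinearMap.proj i).comp (ContinuousLinearMap.snd ℂ _ _)))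
  have hglue : ∀ p, glue p = Sum.elim p.1 p.2 := fun p => by
    funext i
    rcases i with i | i <;> rfl
  have hrep : ∀ j, ∃ f, Represents f fun y => F j (split y) := fun j =>
    exists_represents ((hF j).fun_comp_of_eq (split.analyticAt 0) (map_zero split))
  choose f ρ hρ hf hFf using hrep
  set r := Finset.univ.inf ρ with hr
  have hr0 : r ≠ 0 := by
    rw [← pos_iff_ne_zero, Finset.lt_inf_iff (by simp)]
    exact fun j _ => pos_iff_ne_zero.2 (hρ j)
  have helim : ∀ q : ℝ≥0∞, (Sum.elim (fun _ => q) fun _ => q : Fin n ⊕ Fin d → ℝ≥0∞) = fun _ => q :=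
    fun q => by funext i; rcases i with i | i <;> rfl
  have hfr : ∀ j, cnorm (Sum.elim (fun _ => r) fun _ => r) (f j) < ⊤ := fun j => by
    rw [helim]
    exact (wnorm_mono_radius (fun _ => Finset.inf_le (Finset.mem_univ j)) _).trans_lt (hf j)
  have hmem : ∀ j a, fiber (f j) a ∈ convSubalgebra fun _ : Fin d => r := fun j a => by
    have h1 := hfr j
    rw [cnorm_sumElim] at h1
    have h2 := (ENNReal.le_tsum a).trans_lt h1
    rw [mpow_const] at h2
    by_contra h3
    rw [mem_convSubalgebra, not_lt, top_le_iff] at h3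
    rw [h3, ENNReal.top_mul (pow_ne_zero _ hr0)] at h2
    exact lt_irrefl _ h2
  let c : Fin n → MvPowerSeries (Fin n) (convSubalgebra fun _ : Fin d => r) :=
    fun j a => ⟨fiber (f j) a, hmem j a⟩
  have hν := isAlgNorm_convSubalgebra fun _ : Fin d => r
  have hcnorm : ∀ j, wnorm (fun g : convSubalgebra fun _ : Fin d => r => cnorm (fun _ => r) g.1)
      (fun _ => r) (c j) = cnorm (Sum.elim (fun _ => r) fun _ => r) (f j) := fun j => by
    rw [cnorm_sumElim]
    rfl
  have hK : ∑ j, cnorm (Sum.elim (fun _ => r) fun _ => r) (f j) ≠ ⊤ :=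
    (ENNReal.sum_lt_top.2 fun j _ => hfr j).ne
  obtain ⟨δ, hδ, hsol⟩ := S.exists_wnorm_sol_le (R := convSubalgebra fun _ : Fin d => r)
    (S.exists_radius hB) hr0 hK
  have hsol := hsol _ hν c (fun j => (hcnorm j).le.trans (Finset.single_le_sum
    (f := fun j => cnorm (Sum.elim (fun _ => r) fun _ => r) (f j)) (fun _ _ => zero_le)
    (Finset.mem_univ j))) i
  set g := ofFibers fun a => (MvPowerSeries.coeff a (S.sol c i)).1 with hg
  have hgnorm : cnorm (Sum.elim (fun _ => δ) fun _ => r) g < ⊤ := by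
    rw [cnorm_sumElim]
    refine lt_of_le_of_lt (le_of_eq ?_) (hsol.trans_lt ENNReal.one_lt_top)
    exact tsum_congr fun a => by rw [hg, fiber_ofFibers]
  have hgrep : Represents g (ev g) := by
    refine represents_ev (lt_min (pos_iff_ne_zero.2 hδ) (pos_iff_ne_zero.2 hr0)).ne'
      ((wnorm_mono_radius ?_ _).trans_lt hgnorm)
    rintro (i | i)
    exacts [min_le_left _ _, min_le_right _ _]
  have han : AnalyticAt ℂ (fun p : (Fin n → ℂ) × (Fin d → ℂ) => ev g (glue p)) 0 :=
    hgrep.analyticAt.fun_comp_of_eq (glue.analyticAt 0) (map_zero glue)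
  refine han.congr ?_
  -- For small parameters `q`, the right-hand side at `q` is the value at `q` of the series `c`.
  have hq : ∀ᶠ q in 𝓝 (0 : Fin d → ℂ), ∀ j, ∀ᶠ w in 𝓝 (0 : Fin n → ℂ),
      F j (w, q) = ev (f j) (Sum.elim w q) := by
    rw [eventually_all]
    intro j
    have h1 : Tendsto (fun p : (Fin d → ℂ) × (Fin n → ℂ) => glue (p.2, p.1)) (𝓝 0 ×ˢ 𝓝 0)
        (𝓝 0) := by
      rw [← nhds_prod_eq]
      have h2 : Continuous fun p : (Fin d → ℂ) × (Fin n → ℂ) => glue (p.2, p.1) := by fun_prop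
      have h3 := h2.tendsto (0, 0)
      have h4 : glue ((0 : Fin n → ℂ), (0 : Fin d → ℂ)) = 0 := map_zero glue
      rwa [h4] at h3
    refine (h1.eventually (hFf j)).curry.mono fun q hq => hq.mono fun w hw => ?_
    rw [hglue] at hw
    exact hw
  have hqr : ∀ᶠ p : (Fin n → ℂ) × (Fin d → ℂ) in 𝓝 0, ∀ k, ‖p.2 k‖ₑ ≤ r :=
    (continuous_snd.tendsto (0 : (Fin n → ℂ) × (Fin d → ℂ))).eventually (eventually_enorm_le hr0)
  have hwδ : ∀ᶠ p : (Fin n → ℂ) × (Fin d → ℂ) in 𝓝 0, ∀ k, ‖p.1 k‖ₑ ≤ δ :=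
    (continuous_fst.tendsto (0 : (Fin n → ℂ) × (Fin d → ℂ))).eventually (eventually_enorm_le hδ)
  filter_upwards [(continuous_snd.tendsto (0 : (Fin n → ℂ) × (Fin d → ℂ))).eventually hq, hqr, hwδ]
    with p h1 h2 h3
  have hser : ∀ j, taylorSeries (fun w => F j (w, p.2)) =
      MvPowerSeries.map (evHom h2 : (convSubalgebra fun _ : Fin d => r) →+* ℂ) (c j) := by
    intro j
    refine Represents.taylorSeries_eq ⟨r, hr0, ?_, ?_⟩
    · refine lt_of_le_of_lt ?_ ((hcnorm j).le.trans_lt (hfr j))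
      refine wnorm_mono_coeff fun a => ?_
      rw [MvPowerSeries.coeff_map]
      exact enorm_ev_le h2
    · filter_upwards [h1 j, eventually_enorm_le hr0] with w hw hwr
      rw [hw, ev_sumElim (hfr j) hwr h2]
      rfl
  rw [hglue, ev_sumElim hgnorm h3 h2]
  simp only [hser, ← map_sol]
  rw [ev]
  refine tsum_congr fun a => ?_
  rw [hg, fiber_ofFibers, MvPowerSeries.coeff_map]
  rfl

/-- If the right-hand side depends analytically on parameters in a finite-dimensional space, so does
the solution. -/
theorem analyticAt_ev_sol {F₀ : Fin n → (Fin n → ℂ) → ℂ} (hB : ∀ j, Represents (S.B j) (F₀ j))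
    {Q : Type*} [NormedAddCommGroup Q] [NormedSpace ℂ Q] [FiniteDimensional ℂ Q] {q₀ : Q}
    {F : Fin n → (Fin n → ℂ) × Q → ℂ} (hF : ∀ j, AnalyticAt ℂ (F j) (0, q₀)) (i : Fin n) :
    AnalyticAt ℂ (fun p : (Fin n → ℂ) × Q =>
      ev (S.sol (fun j => taylorSeries fun w => F j (w, p.2)) i) p.1) (0, q₀) := by
  let κ : (Fin (Module.finrank ℂ Q) → ℂ) ≃L[ℂ] Q := ContinuousLinearEquiv.ofFinrankEq (by simp)
  have h := S.analyticAt_ev_sol_fin hB (F := fun j p => F j (p.1, q₀ + κ p.2)) (fun j => ?_) i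
  · have h1 : AnalyticAt ℂ (fun p : (Fin n → ℂ) × Q => (p.1, κ.symm (p.2 - q₀))) (0, q₀) := by
      refine analyticAt_fst.prod ?_
      exact (κ.symm.toContinuousLinearMap.analyticAt _).fun_comp (analyticAt_snd.sub analyticAt_const)
    have h2 := h.fun_comp_of_eq h1 (by simp)
    simpa using h2
  · have h1 : AnalyticAt ℂ (fun p : (Fin n → ℂ) × (Fin (Module.finrank ℂ Q) → ℂ) =>
        (p.1, q₀ + κ p.2)) 0 := by
      refine analyticAt_fst.prod (analyticAt_const.add ?_)
      exact (κ.toContinuousLinearMap.analyticAt _).fun_comp analyticAt_snd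
    exact (hF j).fun_comp_of_eq h1 (by simp)

end LeadingSystem

/-! ### Dependence of the coefficients of the solution on jets -/

section LinearSubstitution

variable {σ R R' : Type*} [Fintype σ] [CommRing R] [CommRing R']

/-- The linear forms `∑ₖ Lₘₖ Xₖ` given by the rows of a square matrix. -/
def linForm (L : Matrix σ σ R) (m : σ) : MvPolynomial σ R :=
  ∑ k, MvPolynomial.C (L m k) * MvPolynomial.X k

theorem map_linForm (φ : R →+* R') (L : Matrix σ σ R) (m : σ) :
    MvPolynomial.map φ (linForm L m) = linForm (L.map φ) m := by
  simp [linForm]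

theorem eval_bind₁_linForm (L : Matrix σ σ R) (p : MvPolynomial σ R) (w : σ → R) :
    MvPolynomial.eval w (MvPolynomial.bind₁ (linForm L) p) = MvPolynomial.eval (L.mulVec w) p := by
  rw [MvPolynomial.eval, MvPolynomial.eval₂Hom_bind₁]
  congr 2
  funext m
  simp [linForm, Matrix.mulVec, dotProduct]

theorem truncTotal_congr {N : ℕ} {f g : MvPowerSeries σ R} (h : f - g ∈ ordIdeal σ R N) :
    MvPowerSeries.truncTotal N f = MvPowerSeries.truncTotal N g := by
  ext a
  by_cases ha : a.degree < N
  · rw [MvPowerSeries.coeff_truncTotal _ ha, MvPowerSeries.coeff_truncTotal _ ha, ← sub_eq_zero,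
      ← map_sub, mem_ordIdeal.1 h a ha]
  · rw [MvPowerSeries.coeff_truncTotal_eq_zero _ (not_lt.1 ha),
      MvPowerSeries.coeff_truncTotal_eq_zero _ (not_lt.1 ha)]

theorem map_truncTotal (φ : R →+* R') (N : ℕ) (f : MvPowerSeries σ R) :
    MvPolynomial.map φ (MvPowerSeries.truncTotal N f) =
      MvPowerSeries.truncTotal N (MvPowerSeries.map φ f) := by
  ext a
  rw [MvPolynomial.coeff_map]
  by_cases ha : a.degree < N
  · rw [MvPowerSeries.coeff_truncTotal _ ha, MvPowerSeries.coeff_truncTotal _ ha,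
      MvPowerSeries.coeff_map]
  · rw [MvPowerSeries.coeff_truncTotal_eq_zero _ (not_lt.1 ha),
      MvPowerSeries.coeff_truncTotal_eq_zero _ (not_lt.1 ha), map_zero]

theorem aeval_sub_aeval_mem {σ A : Type*} [CommRing A] [Algebra ℂ A] (I : Ideal A) {f g : σ → A}
    (h : ∀ i, f i - g i ∈ I) (p : MvPolynomial σ ℂ) :
    MvPolynomial.aeval f p - MvPolynomial.aeval g p ∈ I := by
  induction p using MvPolynomial.induction_on with
  | C a => simp
  | add p q hp hq =>
    rw [map_add, map_add, add_sub_add_comm]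
    exact add_mem hp hq
  | mul_X p i hp =>
    rw [map_mul, map_mul, MvPolynomial.aeval_X, MvPolynomial.aeval_X,
      show MvPolynomial.aeval f p * f i - MvPolynomial.aeval g p * g i =
        (MvPolynomial.aeval f p - MvPolynomial.aeval g p) * f i +
          MvPolynomial.aeval g p * (f i - g i) by ring]
    exact add_mem (I.mul_mem_right _ hp) (I.mul_mem_left _ (h i))

/-- The Taylor series of `F(L w)` agrees to order `N` with the substitution of `L w` in the Taylor
polynomial of `F`. -/
theorem Represents.sub_linear_mem {f g : MvPowerSeries σ ℂ} {F : (σ → ℂ) → ℂ} (hf : Represents f F)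
    {L : Matrix σ σ ℂ} (hg : Represents g fun w => F (L.mulVec w)) (N : ℕ) :
    g - (MvPolynomial.bind₁ (linForm L) (MvPowerSeries.truncTotal N f) : MvPolynomial σ ℂ) ∈
      ordIdeal σ ℂ N := by
  have h1 := (hf.sub (represents_coe (MvPowerSeries.truncTotal N f))).isBigO (k := N) (by
    rw [SingularSystem.mem_ordIdeal]
    intro a ha
    rw [map_sub, MvPolynomial.coeff_coe, MvPowerSeries.coeff_truncTotal _ ha, sub_self])
  refine (hg.sub (represents_coe _)).mem_ordIdeal ?_
  simp only [eval_bind₁_linForm]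
  have hL : (fun w => L.mulVec w) = ⇑(L.mulVecLin.toContinuousLinearMap) := rfl
  have htend : Tendsto (fun w => L.mulVec w) (𝓝 (0 : σ → ℂ)) (𝓝 0) := by
    rw [hL]
    simpa using L.mulVecLin.toContinuousLinearMap.continuous.tendsto 0
  have h2 : (fun w : σ → ℂ => L.mulVec w) =O[𝓝 0] fun w => w := by
    rw [hL]
    exact L.mulVecLin.toContinuousLinearMap.isBigO_id _
  exact (h1.comp_tendsto htend).trans (h2.norm_norm.pow N)

end LinearSubstitution

namespace LeadingSystem

variable {n : ℕ} (S : LeadingSystem n)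

section JetCoeff

variable {R : Type*} [CommRing R] [Algebra ℂ R]

/-- The right-hand side `P(p(M X))` for a polynomial map `p` and a matrix `M`. -/
def jetRhs (P : Fin n → MvPolynomial (Fin n) ℂ) (M : Matrix (Fin n) (Fin n) R)
    (p : Fin n → MvPolynomial (Fin n) R) (j : Fin n) : MvPowerSeries (Fin n) R :=
  MvPolynomial.aeval (fun i => ((MvPolynomial.bind₁ (linForm M) (p i) : MvPolynomial (Fin n) R) :
    MvPowerSeries (Fin n) R)) (P j)

/-- The coefficient of index `a` in the component `i` of `(X + H)(L X)`, where `H` is the solution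
with right-hand side `P(p(M X))`. -/
def jetCoeff (P : Fin n → MvPolynomial (Fin n) ℂ) (L M : Matrix (Fin n) (Fin n) R)
    (p : Fin n → MvPolynomial (Fin n) R) (a : Fin n →₀ ℕ) (i : Fin n) : R :=
  MvPolynomial.coeff a (MvPolynomial.bind₁ (linForm L) (MvPowerSeries.truncTotal (a.degree + 1)
    (MvPowerSeries.X i + S.sol (jetRhs P M p) i)))

theorem map_jetRhs {R' : Type*} [CommRing R'] [Algebra ℂ R'] (φ : R →ₐ[ℂ] R')
    (P : Fin n → MvPolynomial (Fin n) ℂ) (M : Matrix (Fin n) (Fin n) R)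
    (p : Fin n → MvPolynomial (Fin n) R) (j : Fin n) :
    MvPowerSeries.map (φ : R →+* R') (jetRhs P M p j) =
      jetRhs P (M.map φ) (fun i => MvPolynomial.map (φ : R →+* R') (p i)) j := by
  have h : ∀ q : MvPolynomial (Fin n) R, MvPowerSeries.map (φ : R →+* R') (q : MvPowerSeries (Fin n) R) =
      ((MvPolynomial.map (φ : R →+* R') q : MvPolynomial (Fin n) R') : MvPowerSeries (Fin n) R') := fun q => by
    ext a
    rw [MvPowerSeries.coeff_map, MvPolynomial.coeff_coe, MvPolynomial.coeff_coe,
      MvPolynomial.coeff_map]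
  rw [jetRhs, map_aeval_series, jetRhs]
  congr 2
  funext i
  rw [h, MvPolynomial.map_bind₁]
  simp only [map_linForm]
  rfl

theorem map_jetCoeff {R' : Type*} [CommRing R'] [Algebra ℂ R'] (φ : R →ₐ[ℂ] R')
    (P : Fin n → MvPolynomial (Fin n) ℂ) (L M : Matrix (Fin n) (Fin n) R)
    (p : Fin n → MvPolynomial (Fin n) R) (a : Fin n →₀ ℕ) (i : Fin n) :
    φ (S.jetCoeff P L M p a i) = S.jetCoeff P (L.map φ) (M.map φ)
      (fun i => MvPolynomial.map (φ : R →+* R') (p i)) a i := by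
  have h1 : φ (S.jetCoeff P L M p a i) = (φ : R →+* R') (S.jetCoeff P L M p a i) := rfl
  rw [h1, jetCoeff, ← MvPolynomial.coeff_map, MvPolynomial.map_bind₁, map_truncTotal, map_add,
    MvPowerSeries.map_X, map_sol, jetCoeff]
  simp only [map_linForm, map_jetRhs]
  rfl

end JetCoeff

/-- The coefficients of the solution depend only on a finite jet of the right-hand side. -/
theorem coeff_eq_jetCoeff (P : Fin n → MvPolynomial (Fin n) ℂ) {L M : Matrix (Fin n) (Fin n) ℂ}
    {b : (Fin n → ℂ) → (Fin n → ℂ)} {f c γ : Fin n → MvPowerSeries (Fin n) ℂ}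
    (hf : ∀ i, Represents (f i) fun w => b w i)
    (hc : ∀ j, Represents (c j) fun w => MvPolynomial.eval (b (M.mulVec w)) (P j))
    {G : Fin n → (Fin n → ℂ) → ℂ} (hG : ∀ i, Represents (MvPowerSeries.X i + S.sol c i) (G i))
    (hγ : ∀ i, Represents (γ i) fun z => G i (L.mulVec z)) (a : Fin n →₀ ℕ) (i : Fin n) :
    MvPowerSeries.coeff a (γ i) = S.jetCoeff P L M
      (fun i => MvPowerSeries.truncTotal (S.d + a.degree + 1) (f i)) a i := by
  have hbM : ∀ i, ∃ g, Represents g fun w => b (M.mulVec w) i := fun i => by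
    refine exists_represents ((hf i).analyticAt.fun_comp_of_eq
      (M.mulVecLin.toContinuousLinearMap.analyticAt 0) (Matrix.mulVec_zero M))
  choose g hg using hbM
  have hcg : ∀ j, c j = MvPolynomial.aeval g (P j) := fun j =>
    (hc j).unique (Represents.aeval hg (P j))
  have h1 : ∀ j, c j - jetRhs P M (fun i => MvPowerSeries.truncTotal (S.d + a.degree + 1) (f i)) j ∈
      ordIdeal (Fin n) ℂ (S.d + 1 + a.degree) := fun j => by
    rw [hcg, jetRhs]
    refine aeval_sub_aeval_mem _ (fun i => ?_) (P j)
    rw [add_right_comm]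
    exact (hf i).sub_linear_mem (hg i) _
  have h2 := S.sol_sub_sol_mem h1 i
  have h3 := (hG i).sub_linear_mem (hγ i) (a.degree + 1)
  have h4 := mem_ordIdeal.1 h3 a (Nat.lt_succ_self _)
  rw [map_sub, sub_eq_zero, MvPolynomial.coeff_coe] at h4
  rw [h4, jetCoeff]
  congr 2
  refine truncTotal_congr ?_
  rwa [add_sub_add_left_eq_sub]

end LeadingSystem

section Rational

variable {ι : Type*}

/-- The algebra of functions of the form `p / δᵏ`, where `p` is a polynomial, on the complement of the
zero set of the polynomial `δ`. -/
def ratAlgebra (δ : MvPolynomial ι ℂ) :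
    Subalgebra ℂ ({y : ι → ℂ // MvPolynomial.eval y δ ≠ 0} → ℂ) where
  carrier := {g | ∃ (p : MvPolynomial ι ℂ) (k : ℕ), ∀ y : {y : ι → ℂ // MvPolynomial.eval y δ ≠ 0},
    g y = MvPolynomial.eval y.1 p / MvPolynomial.eval y.1 δ ^ k}
  mul_mem' := by
    rintro g g' ⟨p, k, h⟩ ⟨p', k', h'⟩
    refine ⟨p * p', k + k', fun y => ?_⟩
    rw [Pi.mul_apply, h, h', map_mul, pow_add, div_mul_div_comm]
  add_mem' := by
    rintro g g' ⟨p, k, h⟩ ⟨p', k', h'⟩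
    refine ⟨p * δ ^ k' + p' * δ ^ k, k + k', fun y => ?_⟩
    have hy := y.2
    rw [Pi.add_apply, h, h', map_add, map_mul, map_mul, map_pow, map_pow, pow_add,
      div_add_div _ _ (pow_ne_zero _ hy) (pow_ne_zero _ hy)]
    ring
  algebraMap_mem' z := ⟨MvPolynomial.C z, 0, fun y => by simp⟩

/-- Evaluation of rational functions at a point. -/
def ratEval {δ : MvPolynomial ι ℂ} (y : {y : ι → ℂ // MvPolynomial.eval y δ ≠ 0}) :
    ratAlgebra δ →ₐ[ℂ] ℂ :=
  (Pi.evalAlgHom ℂ (fun _ => ℂ) y).comp (ratAlgebra δ).val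

end Rational

/-- The matrix of coordinates on the space of matrices. -/
def genericMatrix (n K : ℕ) : Matrix (Fin n) (Fin n) (MvPolynomial (JetIndex n K) ℂ) :=
  Matrix.of fun i j => MvPolynomial.X (Sum.inl (i, j))

theorem map_eval_genericMatrix {n K : ℕ} (y : JetIndex n K → ℂ) :
    (genericMatrix n K).map (MvPolynomial.eval y) = Matrix.of fun i j => y (Sum.inl (i, j)) := by
  ext i j
  simp [genericMatrix]

theorem eval_det_genericMatrix {n K : ℕ} (y : JetIndex n K → ℂ) :
    MvPolynomial.eval y (genericMatrix n K).det =
      (Matrix.of fun i j => y (Sum.inl (i, j)) : Matrix (Fin n) (Fin n) ℂ).det := by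
  rw [← map_eval_genericMatrix, ← RingHom.mapMatrix_apply, ← RingHom.map_det]

namespace LeadingSystem

variable {n : ℕ} (S : LeadingSystem n)

/-- The coefficients of the solution are polynomial in the matrix `l` and the jet of `b`, up to a power
of `det l` in the denominator: the recursion can be run over the algebra of such functions. -/
theorem exists_jetCoeff_eq (P : Fin n → MvPolynomial (Fin n) ℂ) (α : Fin n → ℕ) :
    ∃ (k : ℕ) (p : Fin n → MvPolynomial (JetIndex n (S.d + ∑ i, α i)) ℂ),
      ∀ (l : Mat n), IsUnit l.det → ∀ (b : (Fin n → ℂ) → (Fin n → ℂ))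
        (f : Fin n → MvPowerSeries (Fin n) ℂ), (∀ i, Represents (f i) fun z => b z i) → ∀ i,
        S.jetCoeff P (LinearMap.toMatrix' (l : (Fin n → ℂ) →ₗ[ℂ] (Fin n → ℂ)))
          (LinearMap.toMatrix' (l : (Fin n → ℂ) →ₗ[ℂ] (Fin n → ℂ)))⁻¹
          (fun i => MvPowerSeries.truncTotal
            (S.d + (Finsupp.equivFunOnFinite.symm α).degree + 1) (f i))
          (Finsupp.equivFunOnFinite.symm α) i =
          MvPolynomial.eval (jetPoint (S.d + ∑ i, α i) l (taylorCoeff b)) (p i) / l.det ^ k := by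
  set K := S.d + ∑ i, α i with hK
  have hdeg : ∀ a : Fin n →₀ ℕ, a.degree = ∑ i, a i := fun a => Finsupp.degree_eq_sum a
  have hKα : S.d + (Finsupp.equivFunOnFinite.symm α).degree = K := by
    rw [hdeg]
    rfl
  set δ := (genericMatrix n K).det with hδ
  let coord : JetIndex n K → ratAlgebra δ := fun e =>
    ⟨fun y => y.1 e, MvPolynomial.X e, 0, fun y => by simp⟩
  let L : Matrix (Fin n) (Fin n) (ratAlgebra δ) := Matrix.of fun i j => coord (Sum.inl (i, j))
  let M : Matrix (Fin n) (Fin n) (ratAlgebra δ) := Matrix.of fun i j =>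
    ⟨fun y => (Matrix.of fun i j => y.1 (Sum.inl (i, j)) : Matrix (Fin n) (Fin n) ℂ)⁻¹ i j,
      (genericMatrix n K).adjugate i j, 1, fun y => by
        have h := RingHom.map_adjugate (MvPolynomial.eval y.1) (genericMatrix n K)
        rw [RingHom.mapMatrix_apply, RingHom.mapMatrix_apply, map_eval_genericMatrix] at h
        have h' := congrFun (congrFun h i) j
        rw [Matrix.map_apply] at h'
        change (Matrix.of fun i j => y.1 (Sum.inl (i, j)) : Matrix (Fin n) (Fin n) ℂ)⁻¹ i j = _
        have hd : MvPolynomial.eval y.1 δ = _ := eval_det_genericMatrix y.1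
        rw [h', Matrix.inv_def, Matrix.smul_apply, hd, pow_one, Ring.inverse_eq_inv', smul_eq_mul,
          div_eq_inv_mul]⟩
  let q : Fin n → MvPowerSeries (Fin n) (ratAlgebra δ) := fun i a =>
    if h : ∑ m, a m ≤ K then coord (Sum.inr (⟨a, h⟩, i)) else 0
  choose p k hp using fun i => (S.jetCoeff P L M (fun i => MvPowerSeries.truncTotal (K + 1) (q i))
    (Finsupp.equivFunOnFinite.symm α) i).2
  refine ⟨∑ i, k i, fun i => p i * δ ^ (∑ i, k i - k i), fun l hl b f hf i => ?_⟩
  have hdet : MvPolynomial.eval (jetPoint K l (taylorCoeff b)) δ = l.det := by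
    rw [hδ, eval_det_genericMatrix]
    change _ = LinearMap.det (l : (Fin n → ℂ) →ₗ[ℂ] (Fin n → ℂ))
    rw [← LinearMap.det_toMatrix']
    rfl
  have hy : MvPolynomial.eval (jetPoint K l (taylorCoeff b)) δ ≠ 0 := by
    rw [hdet]
    exact hl.ne_zero
  set y : {y : JetIndex n K → ℂ // MvPolynomial.eval y δ ≠ 0} :=
    ⟨jetPoint K l (taylorCoeff b), hy⟩ with hydef
  have h1 := S.map_jetCoeff (ratEval y) P L M (fun i => MvPowerSeries.truncTotal (K + 1) (q i))
    (Finsupp.equivFunOnFinite.symm α) i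
  have hq : (fun i => MvPolynomial.map (ratEval y : ratAlgebra δ →+* ℂ)
      (MvPowerSeries.truncTotal (K + 1) (q i))) = fun i => MvPowerSeries.truncTotal (K + 1) (f i) := by
    funext i
    ext a
    rw [MvPolynomial.coeff_map]
    by_cases ha : a.degree < K + 1
    · rw [MvPowerSeries.coeff_truncTotal _ ha, MvPowerSeries.coeff_truncTotal _ ha]
      have ha' : ∑ m, a m ≤ K := by
        rw [hdeg] at ha
        omega
      have e1 : MvPowerSeries.coeff a (q i) = coord (Sum.inr (⟨a, ha'⟩, i)) := dif_pos ha'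
      rw [e1]
      change taylorCoeff b a i = _
      rw [taylorCoeff_eq_coeff hf, Finsupp.equivFunOnFinite_symm_coe]
    · rw [MvPowerSeries.coeff_truncTotal_eq_zero _ (not_lt.1 ha),
        MvPowerSeries.coeff_truncTotal_eq_zero _ (not_lt.1 ha), map_zero]
  rw [hq] at h1
  rw [hKα]
  refine (Eq.trans ?_ h1.symm).trans ((hp i y).trans ?_)
  · rfl
  · rw [hydef, hdet, map_mul, map_pow, hdet]
    have hle : k i ≤ ∑ i, k i := Finset.single_le_sum (f := k) (fun _ _ => Nat.zero_le _)
      (Finset.mem_univ i)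
    rw [div_eq_div_iff (pow_ne_zero _ hl.ne_zero) (pow_ne_zero _ hl.ne_zero), mul_assoc, ← pow_add,
      Nat.sub_add_cancel hle]

end LeadingSystem

/-! ### The parametrization of the solutions -/

section Matrices

variable {n : ℕ} {l : Mat n}

theorem isUnit_of_isUnit_det (hl : IsUnit l.det) : IsUnit l := by
  have h1 : IsUnit (l : (Fin n → ℂ) →ₗ[ℂ] (Fin n → ℂ)) := (LinearMap.isUnit_iff_isUnit_det _).2 hl
  have h2 := h1.map (Module.End.toContinuousLinearMap (Fin n → ℂ) (𝕜 := ℂ))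
  exact h2

theorem toMatrix'_inverse (hl : IsUnit l) :
    LinearMap.toMatrix' ((Ring.inverse l : Mat n) : (Fin n → ℂ) →ₗ[ℂ] (Fin n → ℂ)) =
      (LinearMap.toMatrix' (l : (Fin n → ℂ) →ₗ[ℂ] (Fin n → ℂ)))⁻¹ := by
  refine (Matrix.inv_eq_right_inv ?_).symm
  rw [← LinearMap.toMatrix'_comp]
  have h : (l : (Fin n → ℂ) →ₗ[ℂ] (Fin n → ℂ)) ∘ₗ
      ((Ring.inverse l : Mat n) : (Fin n → ℂ) →ₗ[ℂ] (Fin n → ℂ)) = LinearMap.id := by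
    ext1 i
    exact congrArg (fun g : Mat n => (g : (Fin n → ℂ) →ₗ[ℂ] (Fin n → ℂ)) ∘ₗ
      LinearMap.single ℂ (fun _ => ℂ) i) (Ring.mul_inverse_cancel l hl)
  rw [h, LinearMap.toMatrix'_id]

theorem inverse_apply_apply (hl : IsUnit l) (z : Fin n → ℂ) : Ring.inverse l (l z) = z :=
  congrArg (fun g : Mat n => g z) (Ring.inverse_mul_cancel l hl)

end Matrices

theorem Represents.eventuallyEq {σ : Type*} [Fintype σ] {f : MvPowerSeries σ ℂ}
    {F G : (σ → ℂ) → ℂ} (hF : Represents f F) (hG : Represents f G) : F =ᶠ[𝓝 0] G := by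
  obtain ⟨_, _, _, h1⟩ := hF
  obtain ⟨_, _, _, h2⟩ := hG
  filter_upwards [h1, h2] with x h1 h2
  rw [h1, h2]

section Parametrization

variable {n : ℕ} {X : Type*}

/-- The Taylor series in `w` of `P(b(l⁻¹ w, x))`. -/
def rhsSeries (P : Fin n → MvPolynomial (Fin n) ℂ) (b : (Fin n → ℂ) × X → (Fin n → ℂ)) (l : Mat n)
    (x : X) (j : Fin n) : MvPowerSeries (Fin n) ℂ :=
  taylorSeries fun w => MvPolynomial.eval (b (Ring.inverse l w, x)) (P j)

/-- The map `(z, l, x) ↦ (X + H)(l z)`, where `H` solves `B(X + H) = P(b(l⁻¹ X, x))`. -/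
def solMap (S : LeadingSystem n) (P : Fin n → MvPolynomial (Fin n) ℂ)
    (b : (Fin n → ℂ) × X → (Fin n → ℂ)) (q : (Fin n → ℂ) × Mat n × X) (i : Fin n) : ℂ :=
  q.2.1 q.1 i + ev (S.sol (rhsSeries P b q.2.1 q.2.2) i) (q.2.1 q.1)

variable {S : LeadingSystem n} {P : Fin n → MvPolynomial (Fin n) ℂ}
  {b : (Fin n → ℂ) × X → (Fin n → ℂ)} {x : X}

theorem represents_rhsSeries (hb : AnalyticAt ℂ (fun z => b (z, x)) 0) (l : Mat n) (j : Fin n) :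
    Represents (rhsSeries P b l x j)
      fun w => MvPolynomial.eval (b (Ring.inverse l w, x)) (P j) := by
  refine represents_taylorSeries (AnalyticAt.eval_poly ?_ (P j))
  exact hb.fun_comp_of_eq ((Ring.inverse l).analyticAt 0) (map_zero _)

variable {F : Fin n → (Fin n → ℂ) → ℂ} (hB : ∀ j, Represents (S.B j) (F j))
include hB

theorem represents_X_add_sol (hb : AnalyticAt ℂ (fun z => b (z, x)) 0) (l : Mat n) (i : Fin n) :
    Represents (MvPowerSeries.X i + S.sol (rhsSeries P b l x) i)
      fun w => w i + ev (S.sol (rhsSeries P b l x) i) w :=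
  (represents_X i).add (S.represents_sol hB (represents_rhsSeries hb l) i)

theorem solMap_zero (hb : AnalyticAt ℂ (fun z => b (z, x)) 0) (l : Mat n) :
    solMap S P b (0, l, x) = 0 := by
  funext i
  have h := S.represents_sol hB (represents_rhsSeries hb l (P := P)) i
  have h1 := h.apply_zero
  rw [mem_ordIdeal.1 (S.sol_mem _ i) 0 (by simp)] at h1
  simp [solMap, h1]

theorem hasFDerivAt_solMap (hb : AnalyticAt ℂ (fun z => b (z, x)) 0) (l : Mat n) :
    HasFDerivAt (fun z => solMap S P b (z, l, x)) l 0 := by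
  rw [hasFDerivAt_pi']
  intro i
  have h := S.represents_sol hB (represents_rhsSeries hb l (P := P)) i
  have h1 := h.isBigO (S.sol_mem _ i)
  have h2 : HasFDerivAt (ev (S.sol (rhsSeries P b l x) i)) (0 : (Fin n → ℂ) →L[ℂ] ℂ) (l 0) := by
    rw [map_zero]
    refine Asymptotics.IsBigO.hasFDerivAt (n := 2) ?_ one_lt_two
    simpa using h1
  have h3 := (((ContinuousLinearMap.proj i).comp l).hasFDerivAt (x := 0)).add
    (h2.comp 0 l.hasFDerivAt)
  rw [ContinuousLinearMap.zero_comp, add_zero] at h3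
  exact h3

/-- Every biholomorphic solution `u` of `A(u(z)) = b(z, x)` is the one parametrized by its derivative
`l` at `0`: the map `u ∘ l⁻¹` is tangent to the identity and solves the system `P ∘ A`. -/
theorem eventually_eq_solMap {A : (Fin n → ℂ) → (Fin n → ℂ)}
    (hF : ∀ j z, F j z = MvPolynomial.eval (A z) (P j))
    (hb : AnalyticAt ℂ (fun z => b (z, x)) 0) {u : (Fin n → ℂ) → (Fin n → ℂ)}
    (hu : IsBiholomorphismGerm u) (hsol : ∀ᶠ z in 𝓝 (0 : Fin n → ℂ), A (u z) = b (z, x)) :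
    ∀ᶠ z in 𝓝 (0 : Fin n → ℂ), u z = solMap S P b (z, fderiv ℂ u 0, x) := by
  obtain ⟨hua, hu0, v, hva, hv0, hvu, huv⟩ := hu
  set l : Mat n := fderiv ℂ u 0 with hl
  have hdu : HasFDerivAt u l 0 := hua.differentiableAt.hasFDerivAt
  have hdv : HasFDerivAt v (fderiv ℂ v 0) 0 := hva.differentiableAt.hasFDerivAt
  have hunit : IsUnit l := by
    refine ⟨⟨l, fderiv ℂ v 0, ?_, ?_⟩, rfl⟩
    · have h1 : HasFDerivAt (fun z => u (v z)) (l.comp (fderiv ℂ v 0)) 0 :=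
        HasFDerivAt.comp 0 (by rwa [hv0]) hdv
      exact h1.unique ((hasFDerivAt_id 0).congr_of_eventuallyEq huv)
    · have h1 : HasFDerivAt (fun z => v (u z)) ((fderiv ℂ v 0).comp l) 0 :=
        HasFDerivAt.comp 0 (by rwa [hu0]) hdu
      exact h1.unique ((hasFDerivAt_id 0).congr_of_eventuallyEq hvu)
  set m : Mat n := Ring.inverse l with hm
  have hm0 : m 0 = 0 := map_zero m
  have htend : Tendsto m (𝓝 0) (𝓝 0) := by
    have := m.continuous.tendsto 0
    rwa [hm0] at this
  have hU : HasFDerivAt (fun w => u (m w)) (ContinuousLinearMap.id ℂ (Fin n → ℂ)) 0 := by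
    have h1 : HasFDerivAt (fun w => u (m w)) (l.comp m) 0 :=
      HasFDerivAt.comp 0 (by rwa [hm0]) m.hasFDerivAt
    have h2 : l.comp m = ContinuousLinearMap.id ℂ (Fin n → ℂ) := Ring.mul_inverse_cancel l hunit
    rwa [h2] at h1
  have hUa : AnalyticAt ℂ (fun w => u (m w)) 0 := hua.fun_comp_of_eq (m.analyticAt 0) hm0
  have hrep : ∀ i, Represents (taylorSeries fun w => u (m w) i) fun w => u (m w) i := fun i =>
    represents_taylorSeries (analyticAt_pi_iff.1 hUa i)
  have heq := S.eq_sol_of_represents hB hU (by rw [hm0, hu0]) hrep (c := rhsSeries P b l x)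
    fun j => (represents_rhsSeries hb l j).congr (by
      filter_upwards [htend.eventually hsol] with w hw
      rw [hF, hw])
  have hev : ∀ᶠ w in 𝓝 (0 : Fin n → ℂ), ∀ i,
      u (m w) i = w i + ev (S.sol (rhsSeries P b l x) i) w := by
    rw [eventually_all]
    intro i
    have h1 := hrep i
    rw [heq i] at h1
    exact h1.eventuallyEq (represents_X_add_sol hB hb l i)
  have hl0 : Tendsto l (𝓝 0) (𝓝 0) := by
    have := l.continuous.tendsto 0
    rwa [map_zero] at this
  filter_upwards [hl0.eventually hev] with z hz
  funext i
  have := hz i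
  rwa [hm, inverse_apply_apply hunit] at this

/-- The Taylor coefficients of index `α` of the parametrization are determined by the matrix `l`, its
inverse, and the jet of `b` of order `d + |α|`. -/
theorem taylorCoeff_solMap (hb : AnalyticAt ℂ (fun z => b (z, x)) 0) {l : Mat n}
    (hl : IsUnit l.det) {f : Fin n → MvPowerSeries (Fin n) ℂ}
    (hf : ∀ i, Represents (f i) fun z => b (z, x) i) (α : Fin n → ℕ) (i : Fin n) :
    taylorCoeff (fun z => solMap S P b (z, l, x)) α i =
      S.jetCoeff P (LinearMap.toMatrix' (l : (Fin n → ℂ) →ₗ[ℂ] (Fin n → ℂ)))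
        (LinearMap.toMatrix' (l : (Fin n → ℂ) →ₗ[ℂ] (Fin n → ℂ)))⁻¹
        (fun i => MvPowerSeries.truncTotal
          (S.d + (Finsupp.equivFunOnFinite.symm α).degree + 1) (f i))
        (Finsupp.equivFunOnFinite.symm α) i := by
  have hG := represents_X_add_sol hB hb l (P := P)
  have hγ : ∀ i, ∃ γ, Represents γ fun z => solMap S P b (z, l, x) i := fun i =>
    exists_represents ((hG i).analyticAt.fun_comp_of_eq (l.analyticAt 0) (map_zero _))
  choose γ hγ using hγ
  rw [taylorCoeff_eq_coeff hγ]
  have hmul : ∀ (g : Mat n) (z : Fin n → ℂ),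
      (LinearMap.toMatrix' (g : (Fin n → ℂ) →ₗ[ℂ] (Fin n → ℂ))).mulVec z = g z := fun g z =>
    LinearMap.toMatrix'_mulVec _ z
  refine S.coeff_eq_jetCoeff P (b := fun z => b (z, x)) hf
    (c := rhsSeries P b l x) (fun j => ?_) hG (fun i => ?_) _ i
  · simp only [← toMatrix'_inverse (isUnit_of_isUnit_det hl), hmul]
    exact represents_rhsSeries hb l j
  · simp only [hmul]
    exact hγ i

end Parametrization

section Manifold

variable {n : ℕ} {E : Type*} [NormedAddCommGroup E] [NormedSpace ℂ E] {X : Type*}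
  [TopologicalSpace X] [ChartedSpace E X] [IsManifold 𝓘(ℂ, E) ω X]
  {b : (Fin n → ℂ) × X → (Fin n → ℂ)} {x : X}

/-- A holomorphic map on a manifold is analytic in a chart. -/
theorem analyticAt_extChartAt
    (hb : ContMDiffAt (𝓘(ℂ, Fin n → ℂ).prod 𝓘(ℂ, E)) 𝓘(ℂ, Fin n → ℂ) ω b (0, x)) :
    AnalyticAt ℂ (fun p : (Fin n → ℂ) × E => b (p.1, (extChartAt 𝓘(ℂ, E) x).symm p.2))
      (0, extChartAt 𝓘(ℂ, E) x x) := by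
  have h1 : ContMDiffAt 𝓘(ℂ, E) 𝓘(ℂ, E) ω (extChartAt 𝓘(ℂ, E) x).symm
      (extChartAt 𝓘(ℂ, E) x x) :=
    (contMDiffOn_extChartAt_symm x).contMDiffAt (extChartAt_target_mem_nhds x)
  have h2 : ContMDiffAt 𝓘(ℂ, (Fin n → ℂ) × E) (𝓘(ℂ, Fin n → ℂ).prod 𝓘(ℂ, E)) ω
      (fun p : (Fin n → ℂ) × E => (p.1, (extChartAt 𝓘(ℂ, E) x).symm p.2))
      (0, extChartAt 𝓘(ℂ, E) x x) := by
    refine ContMDiffAt.prodMk contDiffAt_fst.contMDiffAt ?_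
    exact ContMDiffAt.comp (0, extChartAt 𝓘(ℂ, E) x x) h1 contDiffAt_snd.contMDiffAt
  have h3 := ContMDiffAt.comp_of_eq (g := b) hb h2 (by simp)
  have h4 := h3.contDiffAt
  rwa [← contDiffWithinAt_univ, contDiffWithinAt_omega_iff_analyticWithinAt,
    analyticWithinAt_univ] at h4

theorem analyticAt_of_contMDiffAt
    (hb : ContMDiffAt (𝓘(ℂ, Fin n → ℂ).prod 𝓘(ℂ, E)) 𝓘(ℂ, Fin n → ℂ) ω b (0, x)) :
    AnalyticAt ℂ (fun z => b (z, x)) 0 := by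
  have h := (analyticAt_extChartAt hb).fun_comp_of_eq
    (f := fun z : Fin n → ℂ => (z, extChartAt 𝓘(ℂ, E) x x)) (x := 0)
    (analyticAt_id.prod analyticAt_const) rfl
  simpa using h

theorem AnalyticAt.apply_mat {H : Type*} [NormedAddCommGroup H] [NormedSpace ℂ H] {g : H → Mat n}
    {f : H → Fin n → ℂ} {y : H} (hg : AnalyticAt ℂ g y) (hf : AnalyticAt ℂ f y) :
    AnalyticAt ℂ (fun y => g y (f y)) y :=
  ((ContinuousLinearMap.id ℂ (Mat n)).analyticAt_bilinear (g y, f y)).fun_comp_of_eq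
    (f := fun y => (g y, f y)) (hg.prod hf) rfl

/-- The parametrization of the solutions is holomorphic near `{0} × GLₙ(ℂ) × X`. -/
theorem contMDiffAt_solMap [FiniteDimensional ℂ E] {S : LeadingSystem n}
    {P : Fin n → MvPolynomial (Fin n) ℂ} {F : Fin n → (Fin n → ℂ) → ℂ}
    (hB : ∀ j, Represents (S.B j) (F j)) {l : Mat n} (hl : IsUnit l.det)
    (hb : ContMDiffAt (𝓘(ℂ, Fin n → ℂ).prod 𝓘(ℂ, E)) 𝓘(ℂ, Fin n → ℂ) ω b (0, x)) :
    ContMDiffAt (𝓘(ℂ, Fin n → ℂ).prod (𝓘(ℂ, Mat n).prod 𝓘(ℂ, E))) 𝓘(ℂ, Fin n → ℂ) ω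
      (solMap S P b) (0, l, x) := by
  set φ := extChartAt 𝓘(ℂ, E) x with hφ
  have hβ := analyticAt_extChartAt hb
  have hinv : AnalyticAt ℂ (Ring.inverse : Mat n → Mat n) l := by
    obtain ⟨l', rfl⟩ := isUnit_of_isUnit_det hl
    exact analyticAt_inverse l'
  have hF : ∀ j, AnalyticAt ℂ (fun p : (Fin n → ℂ) × (Mat n × E) =>
      MvPolynomial.eval (b (Ring.inverse p.2.1 p.1, φ.symm p.2.2)) (P j)) (0, (l, φ x)) := by
    intro j
    refine AnalyticAt.eval_poly ?_ (P j)
    have h1 : AnalyticAt ℂ (fun p : (Fin n → ℂ) × (Mat n × E) => Ring.inverse p.2.1)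
        (0, (l, φ x)) :=
      hinv.fun_comp_of_eq (analyticAt_fst.comp analyticAt_snd) rfl
    have h2 : AnalyticAt ℂ (fun p : (Fin n → ℂ) × (Mat n × E) =>
        (Ring.inverse p.2.1 p.1, p.2.2)) (0, (l, φ x)) := by
      refine AnalyticAt.prod ?_ (analyticAt_snd.comp analyticAt_snd)
      exact AnalyticAt.apply_mat h1 analyticAt_fst
    exact hβ.fun_comp_of_eq h2 (by rw [map_zero])
  set Ψ : (Fin n → ℂ) × (Mat n × E) → (Fin n → ℂ) := fun p i => p.2.1 p.1 i +
    ev (S.sol (fun j => taylorSeries fun w =>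
      MvPolynomial.eval (b (Ring.inverse p.2.1 w, φ.symm p.2.2)) (P j)) i) (p.2.1 p.1) with hΨ
  have happ : AnalyticAt ℂ (fun p : (Fin n → ℂ) × (Mat n × E) => p.2.1 p.1) (0, (l, φ x)) :=
    AnalyticAt.apply_mat (analyticAt_fst.comp analyticAt_snd) analyticAt_fst
  have hΨa : AnalyticAt ℂ Ψ (0, (l, φ x)) := by
    rw [analyticAt_pi_iff]
    intro i
    refine (analyticAt_pi_iff.1 happ i).add ?_
    have h := S.analyticAt_ev_sol hB hF i
    exact h.fun_comp_of_eq (f := fun p : (Fin n → ℂ) × (Mat n × E) => (p.2.1 p.1, p.2))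
      (happ.prod analyticAt_snd) (by simp)
  have hchart : ContMDiffAt (𝓘(ℂ, Fin n → ℂ).prod (𝓘(ℂ, Mat n).prod 𝓘(ℂ, E)))
      𝓘(ℂ, (Fin n → ℂ) × (Mat n × E)) ω
      (fun q : (Fin n → ℂ) × Mat n × X => (q.1, (q.2.1, φ q.2.2))) (0, l, x) := by
    refine contMDiffAt_fst.prodMk_space (ContMDiffAt.prodMk_space ?_ ?_)
    · exact contMDiffAt_fst.comp _ contMDiffAt_snd
    · exact ContMDiffAt.comp (g := φ) (f := fun q : (Fin n → ℂ) × Mat n × X => q.2.2) (0, l, x)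
        contMDiffAt_extChartAt (contMDiffAt_snd.comp _ contMDiffAt_snd)
  have hcomp := ContMDiffAt.comp_of_eq (g := Ψ) (x := ((0, l, x) : (Fin n → ℂ) × Mat n × X))
    (hΨa.contDiffAt (n := ω)).contMDiffAt hchart rfl
  refine hcomp.congr_of_eventuallyEq ?_
  have hsrc : ∀ᶠ q : (Fin n → ℂ) × Mat n × X in 𝓝 (0, l, x), q.2.2 ∈ φ.source :=
    (continuous_snd.comp continuous_snd).continuousAt.eventually
      (extChartAt_source_mem_nhds (I := 𝓘(ℂ, E)) x)
  filter_upwards [hsrc] with q hq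
  funext i
  simp only [hΨ, Function.comp_apply, φ.left_inv hq]
  rfl

end Manifold

end

end SingularSystem

theorem corollary3p2
    {n : ℕ} (A : (Fin n → ℂ) → (Fin n → ℂ)) (hA : AnalyticAt ℂ A 0)
    (hArank : SingularSystem.HasGenericRank A n)
    -- a complex manifold `X`
    {E : Type*} [NormedAddCommGroup E] [NormedSpace ℂ E] [FiniteDimensional ℂ E]
    {X : Type*} [TopologicalSpace X] [ChartedSpace E X] [IsManifold 𝓘(ℂ, E) ω X]
    -- a holomorphic map `b` on an open neighbourhood `V` of `{0} × X`
    (V : Set ((Fin n → ℂ) × X)) (hV : IsOpen V) (hV0 : ∀ x : X, (0, x) ∈ V)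
    (b : (Fin n → ℂ) × X → (Fin n → ℂ))
    (hb : ContMDiffOn (𝓘(ℂ, Fin n → ℂ).prod 𝓘(ℂ, E)) 𝓘(ℂ, Fin n → ℂ) ω b V) :
    ∃ (Ω : Set ((Fin n → ℂ) × SingularSystem.Mat n × X))
      (Γ : (Fin n → ℂ) × SingularSystem.Mat n × X → (Fin n → ℂ)),
      -- `Ω` is an open neighbourhood of `{0} × GLₙ(ℂ) × X` in `ℂⁿ × GLₙ(ℂ) × X`
      IsOpen Ω ∧ (∀ q ∈ Ω, IsUnit q.2.1.det) ∧
      (∀ (l : SingularSystem.Mat n) (x : X), IsUnit l.det → (0, l, x) ∈ Ω) ∧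
      -- `Γ` is holomorphic on `Ω`
      ContMDiffOn
        (𝓘(ℂ, Fin n → ℂ).prod (𝓘(ℂ, SingularSystem.Mat n).prod 𝓘(ℂ, E)))
        𝓘(ℂ, Fin n → ℂ) ω Γ Ω ∧
      -- `Γ` parametrizes the invertible solutions
      (∀ (u : (Fin n → ℂ) → (Fin n → ℂ)) (x₀ : X), SingularSystem.IsBiholomorphismGerm u →
        (∀ᶠ z in 𝓝 (0 : Fin n → ℂ), A (u z) = b (z, x₀)) →
        ∀ᶠ z in 𝓝 (0 : Fin n → ℂ), u z = Γ (z, fderiv ℂ u 0, x₀)) ∧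
      -- normalization at `z = 0`
      (∀ (l : SingularSystem.Mat n) (x : X), IsUnit l.det →
        Γ (0, l, x) = 0 ∧ HasFDerivAt (fun z => Γ (z, l, x)) l 0) ∧
      -- form of the Taylor coefficients
      (∃ (ℓ₀ : ℕ) (k : (Fin n → ℕ) → ℕ)
        (p : (α : Fin n → ℕ) → Fin n →
          MvPolynomial (SingularSystem.JetIndex n (ℓ₀ + ∑ i, α i)) ℂ),
        ∀ (α : Fin n → ℕ) (l : SingularSystem.Mat n) (x : X), IsUnit l.det →
          SingularSystem.taylorCoeff (fun z => Γ (z, l, x)) α =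
            fun i => MvPolynomial.eval
              (SingularSystem.jetPoint (ℓ₀ + ∑ i, α i) l
                (SingularSystem.taylorCoeff (fun z => b (z, x)))) (p α i) / l.det ^ k α) := by
  obtain ⟨S, P, hB⟩ := SingularSystem.exists_leadingSystem hA hArank
  have hbx : ∀ x : X,
      ContMDiffAt (𝓘(ℂ, Fin n → ℂ).prod 𝓘(ℂ, E)) 𝓘(ℂ, Fin n → ℂ) ω b (0, x) := fun x =>
    hb.contMDiffAt (hV.mem_nhds (hV0 x))
  have hban : ∀ x, AnalyticAt ℂ (fun z => b (z, x)) 0 := fun x =>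
    SingularSystem.analyticAt_of_contMDiffAt (hbx x)
  have hdet : IsOpen {q : (Fin n → ℂ) × SingularSystem.Mat n × X | IsUnit q.2.1.det} := by
    simp only [isUnit_iff_ne_zero]
    refine isOpen_ne_fun ?_ continuous_const
    exact ContinuousLinearMap.continuous_det.comp (continuous_fst.comp continuous_snd)
  -- Being holomorphic at a point is an open condition, so `Ω` may consist of the points near which
  -- the parametrization is holomorphic.
  refine ⟨{q | IsUnit q.2.1.det} ∩ {q | ∀ᶠ q' in 𝓝 q, ContMDiffAt
      (𝓘(ℂ, Fin n → ℂ).prod (𝓘(ℂ, SingularSystem.Mat n).prod 𝓘(ℂ, E)))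
      𝓘(ℂ, Fin n → ℂ) ω (SingularSystem.solMap S P b) q'}, SingularSystem.solMap S P b,
    hdet.inter isOpen_setOfPred_eventually_nhds, fun q hq => hq.1, fun l x hl => ⟨hl, ?_⟩,
    fun q hq => hq.2.self_of_nhds.contMDiffWithinAt, fun u x hu hsol => ?_, fun l x hl => ?_, ?_⟩
  · exact (contMDiffAt_iff_contMDiffAt_nhds (by simp)).1
      (SingularSystem.contMDiffAt_solMap hB hl (hbx x))
  · exact SingularSystem.eventually_eq_solMap hB (fun _ _ => rfl) (hban x) hu hsol
  · exact ⟨SingularSystem.solMap_zero hB (hban x) l, SingularSystem.hasFDerivAt_solMap hB (hban x) l⟩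
  · choose k p hp using fun α => S.exists_jetCoeff_eq P α
    refine ⟨S.d, k, p, fun α l x hl => funext fun i => ?_⟩
    choose f hf using fun i => SingularSystem.exists_represents (analyticAt_pi_iff.1 (hban x) i)
    rw [SingularSystem.taylorCoeff_solMap hB (hban x) hl hf]
    exact hp α l hl _ f hf i
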